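/- \textbf{Setting.} Let $d\ge 3$ and let $L(s,F)=\sum_{n\ge1}\lambda_F(n)n^{-s}=\prod_p\prod_{j=1}^d(1-\alpha_{j,F}(p)p^{-s})^{-1}$, where $\lambda_F$ is the multiplicative function with $\lambda_F(p^r)=\sum_{r_1+\dots+r_d=r}\prod_j\alpha_{j,F}(p)^{r_j}$. For $q\ge2$ and a primitive Dirichlet character $\chi$ modulo $q$ let $L(s,F\times\chi)=\sum_{n\ge1}\lambda_F(n)\chi(n)n^{-s}=\prod_p\prod_{j=1}^d(1-\alpha_{j,F}(p)\chi(p)p^{-s})^{-1}$. All these series and products are assumed absolutely convergent for $\Re s>1$. Put $$L_\infty(s,F\times\chi)=N^{s/2}\prod_{j=1}^d\Gamma_{\mathbb R}(s+\mu_j),\qquad \Gamma_{\mathbb R}(s)=\pi^{-s/2}\Gamma(s/2),\qquad \Lambda(s,F\times\chi)=L(s,F\times\chi)L_\infty(s,F\times\chi),$$ where $N>0$ depends only on $F$ and $q$, and the $\mu_j\in\mathbb C$ depend only on $F$ and $\chi(-1)$ and satisfy $\Re\mu_j\ge-1+\theta_F$ for a fixed $\theta_F$ with $\frac1{2d}<\theta_F<\frac12$.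 Assume that for every $q\ge 2$ and every primitive $\chi$ modulo $q$: (i) $\Lambda(s,F\times\chi)$ extends to an entire function of order $1$ (so $L(s,F\times\chi)=\Lambda(s,F\times\chi)/L_\infty(s,F\times\chi)$ is defined on $\mathbb C$); (ii) $\Lambda(s,F\times\chi)=\kappa\,\Lambda(1-s,\tilde F\times\overline\chi)$ for some $\kappa=\kappa_{F,\chi}$ with $|\kappa|=1$, where $\tilde F$ is the dual, with parameters $\overline{\alpha_{j,F}(p)}$, $\overline{\mu_j}$ and the same $N$, so that $\lambda_{\tilde F}(n)=\overline{\lambda_F(n)}$; (iii) $N\prod_{j=1}^d|\tfrac12+\mu_j+3|\ll_F N\ll_F q^d$ for large $q$. Assume moreover: (A1) $|\lambda_F(n)|\le\tau_d(n)$ for all $n\ge1$, where $\tau_d$ is the $d$-fold divisor function. (A2) For some fixed $\varepsilon>0$, $\sum_{X\le n\le X+Y}|\lambda_F(n)|^2\ll_F Y$ for all sufficiently large $X$ and all $X^{1-\varepsilon}\le Y\le X$. (A3) $\sum_{n\le X,\ (n,\prod_{P_1\le p\le P_2}p)=1}|\lambda_F(n)|^2\ll_F X\frac{\log P_1}{\log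 P_2}$ for all $2\le P_1\le P_2\le X$. Fix $c_F>0$, $0\le\beta<1$, constants $K_1,K_2>0$ and a function $\psi(q)\to0$ such that $K_1\log^{100}q\le K_2q^{\psi(q)}$ for all large $q$. For $q\ge2$ and a set $\mathcal F_q$ of primitive Dirichlet characters modulo $q$, consider the condition (A4) for all $T\ge 1$ with $K_1\log^{100}q\le T\le K_2q^{\psi(q)}$, $$\prod_{\chi\in\mathcal F_q}L(\sigma+it,F\times\chi)\ne0\quad\text{for }\sigma>1-\frac{c_F}{\log^\beta(qT)},\ |t|\le T.$$ \textbf{Theorem.} For every $\eta<1-\beta$ there is a constant $C$, depending only on $F$, $c_F$, $\beta$, $K_1$, $K_2$, $\psi$ and $\eta$, such that for every $q\ge2$ and every set $\mathcal F_q$ of primitive Dirichlet characters modulo $q$ satisfying (A4), $$\sum_{\chi\in\mathcal F_q}\big|L(\tfrac12,F\times\chi)\big|^2\le C\,\frac{q^{d/2}}{\log^\eta q}.$$ -/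

import Mathlib

open Filter Topology ComplexConjugate

noncomputable section

/-- The data attached to an `L`-function `F` of degree `d` and to its twists by Dirichlet characters:
* `α p j` is the `j`-th local parameter `α_{j,F}(p)` at the prime `p`
  (only its values at primes are ever used);
* `N q` is the conductor of `F × χ`, for `χ` primitive modulo `q`;
* `μ ε j` is the `j`-th parameter at infinity of `F × χ` when `χ(-1) = ε`. -/
structure LData (d : ℕ) where
  α : ℕ → Fin d → ℂ
  N : ℕ → ℝ
  μ : ℂ → Fin d → ℂ

/-- The Euler product `∏_p ∏_j (1 - a_j(p) p^{-s})⁻¹` is absolutely convergent for `Re s > 1`: all its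
factors are well defined, and `∑_{p,j} |(1 - a_j(p) p^{-s})⁻¹ - 1| < ∞`. -/
def EulerProductConverges {d : ℕ} (a : ℕ → Fin d → ℂ) : Prop :=
  ∀ s : ℂ, 1 < s.re →
    (∀ (p : Nat.Primes) (j : Fin d), 1 - a p j * ((p : ℕ) : ℂ) ^ (-s) ≠ 0) ∧
    Summable fun x : Nat.Primes × Fin d ↦
      ‖(1 - a x.1 x.2 * ((x.1 : ℕ) : ℂ) ^ (-s))⁻¹ - 1‖

/-- `f` is an entire function of order exactly `ρ`. -/
def IsEntireOfOrder (f : ℂ → ℂ) (ρ : ℝ) : Prop :=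
  Differentiable ℂ f ∧
  (∀ r : ℝ, ρ < r → f =O[cocompact ℂ] fun s ↦ Real.exp (‖s‖ ^ r)) ∧
  (∀ r : ℝ, r < ρ → ¬ f =O[cocompact ℂ] fun s ↦ Real.exp (‖s‖ ^ r))

/-- The `d`-fold divisor function `τ_d(n)`: the number of ordered factorisations `n = n₁ ⋯ n_d`. -/
def divisorFunction (d n : ℕ) : ℕ := (Nat.finMulAntidiag d n).card

namespace LData

variable {d : ℕ} (F : LData d) {q : ℕ} (χ : DirichletCharacter ℂ q)

/-- `λ_F(p^r) = ∑_{r₁ + ⋯ + r_d = r} ∏_j α_{j,F}(p)^{r_j}`. -/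
def localCoeff (p r : ℕ) : ℂ :=
  ∑ e ∈ Finset.piAntidiag (Finset.univ : Finset (Fin d)) r, ∏ j, F.α p j ^ e j

/-- The multiplicative function `λ_F`: `λ_F(n) = ∏_{p^r ∥ n} λ_F(p^r)` for `n ≥ 1`. -/
def coeff (n : ℕ) : ℂ := if n = 0 then 0 else n.factorization.prod F.localCoeff

/-- The Dirichlet coefficients `λ_F(n) χ(n)` of `L(s, F × χ)`. -/
def twistedCoeff (n : ℕ) : ℂ := F.coeff n * χ (n : ZMod q)

/-- The local parameters `α_{j,F}(p) χ(p)` of `L(s, F × χ)`. -/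
def twistedParam (p : ℕ) (j : Fin d) : ℂ := F.α p j * χ (p : ZMod q)

/-- The factor at infinity `L_∞(s, F × χ) = N^{s/2} ∏_j Γ_ℝ(s + μ_j)`. -/
def gammaFactor (s : ℂ) : ℂ :=
  (F.N q : ℂ) ^ (s / 2) * ∏ j, Complex.Gammaℝ (s + F.μ (χ (-1)) j)

/-- `g` is an extension to an entire function of `L(s, F × χ) L_∞(s, F × χ)`, the latter being
defined for `Re s > 1` through the Dirichlet series. -/
def IsEntireExtension (g : ℂ → ℂ) : Prop :=
  Differentiable ℂ g ∧
    ∀ s : ℂ, 1 < s.re → g s = LSeries (F.twistedCoeff χ) s * F.gammaFactor χ s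

/-- There is at most one entire extension. -/
theorem IsEntireExtension.unique {F : LData d} {χ : DirichletCharacter ℂ q} {g h : ℂ → ℂ}
    (hg : F.IsEntireExtension χ g) (hh : F.IsEntireExtension χ h) : g = h := by
  have hga : AnalyticOnNhd ℂ g Set.univ := hg.1.differentiableOn.analyticOnNhd isOpen_univ
  have hha : AnalyticOnNhd ℂ h Set.univ := hh.1.differentiableOn.analyticOnNhd isOpen_univ
  refine hga.eq_of_eventuallyEq hha (z₀ := 2) ?_
  have : ∀ᶠ s : ℂ in 𝓝 2, 1 < s.re :=
    Complex.continuous_re.continuousAt.eventually (lt_mem_nhds (by norm_num))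
  filter_upwards [this] with s hs
  rw [hg.2 s hs, hh.2 s hs]

/-- The complete `L`-function `Λ(s, F × χ)`: the entire extension (when there is one). -/
def completedL : ℂ → ℂ := Classical.epsilon (F.IsEntireExtension χ)

theorem completedL_spec (h : ∃ g, F.IsEntireExtension χ g) :
    F.IsEntireExtension χ (F.completedL χ) := Classical.epsilon_spec h

theorem completedL_eq {g : ℂ → ℂ} (h : F.IsEntireExtension χ g) : F.completedL χ = g :=
  (F.completedL_spec χ ⟨g, h⟩).unique h

/-- The continuation of `L(s, F × χ)` to the whole plane, `L = Λ / L_∞`. As `1 / Γ_ℝ` is entire, with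
zeros exactly at the poles of `Γ_ℝ`, where Mathlib's `Γ_ℝ` and its inverse have value `0`, the
expression below is the correct value at every `s`, poles of `L_∞` included. -/
def L (s : ℂ) : ℂ := F.completedL χ s / F.gammaFactor χ s

/-- In the half plane of absolute convergence, `L(s, F × χ)` is its Dirichlet series. -/
theorem L_eq_LSeries (h : ∃ g, F.IsEntireExtension χ g) (hN : 0 < F.N q)
    (hμ : ∀ j, -1 ≤ (F.μ (χ (-1)) j).re) {s : ℂ} (hs : 1 < s.re) :
    F.L χ s = LSeries (F.twistedCoeff χ) s := by
  have hne : F.gammaFactor χ s ≠ 0 := by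
    refine mul_ne_zero ?_ (Finset.prod_ne_zero_iff.mpr fun j _ ↦ ?_)
    · rw [Complex.cpow_def_of_ne_zero (by exact_mod_cast hN.ne')]
      exact Complex.exp_ne_zero _
    · apply Complex.Gammaℝ_ne_zero_of_re_pos
      rw [Complex.add_re]
      linarith [hμ j]
  rw [L, (F.completedL_spec χ h).2 s hs, mul_div_assoc, div_self hne, mul_one]

/-- The dual `F̃`: its parameters are the complex conjugates of those of `F`, so that
`λ_{F̃}(n)` is the conjugate of `λ_F(n)`. The conductor is the same. -/
def dual : LData d where
  α p j := conj (F.α p j)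
  N := F.N
  μ ε j := conj (F.μ ε j)

theorem coeff_dual (n : ℕ) : F.dual.coeff n = conj (F.coeff n) := by
  unfold coeff
  split_ifs
  · simp
  · simp [Finsupp.prod, localCoeff, dual, map_prod, map_sum]

/-- The analytic conductor `C(s, F × χ) = N ∏_j |s + μ_j + 3|`. -/
def analyticConductor (s : ℂ) : ℝ := F.N q * ∏ j, ‖s + F.μ (χ (-1)) j + 3‖

/-- The standing properties of `F` and of its twists by all primitive characters modulo all `q ≥ 2`. -/
structure Axioms : Prop where
  summable : ∀ s : ℂ, 1 < s.re → LSeriesSummable F.coeff s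
  euler : EulerProductConverges F.α
  summable_twist : ∀ (q : ℕ) (χ : DirichletCharacter ℂ q), 2 ≤ q → χ.IsPrimitive →
    ∀ s : ℂ, 1 < s.re → LSeriesSummable (F.twistedCoeff χ) s
  euler_twist : ∀ (q : ℕ) (χ : DirichletCharacter ℂ q), 2 ≤ q → χ.IsPrimitive →
    EulerProductConverges (F.twistedParam χ)
  conductor_pos : ∀ q : ℕ, 2 ≤ q → 0 < F.N q
  /-- The parameters at infinity have real part at least `-1 + θ_F`. -/
  param_infinity : ∃ θ : ℝ, 1 / (2 * (d : ℝ)) < θ ∧ θ < 1 / 2 ∧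
    ∀ (q : ℕ) (χ : DirichletCharacter ℂ q), 2 ≤ q → χ.IsPrimitive →
      ∀ j, -1 + θ ≤ (F.μ (χ (-1)) j).re
  /-- `Λ(s, F × χ)` extends to an entire function of order `1`. -/
  entire : ∀ (q : ℕ) (χ : DirichletCharacter ℂ q), 2 ≤ q → χ.IsPrimitive →
    ∃ g : ℂ → ℂ, F.IsEntireExtension χ g ∧ IsEntireOfOrder g 1
  /-- `Λ(s, F × χ) = κ Λ(1 - s, F̃ × χ̄)` with `|κ| = 1`; note that `χ⁻¹` is the conjugate `χ̄`. -/
  functional_equation : ∀ (q : ℕ) (χ : DirichletCharacter ℂ q), 2 ≤ q → χ.IsPrimitive →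
    ∃ κ : ℂ, ‖κ‖ = 1 ∧
      ∀ s : ℂ, F.completedL χ s = κ * F.dual.completedL χ⁻¹ (1 - s)
  /-- `C(1/2, F × χ) ≪_F N ≪_F q^d` for large `q`. -/
  conductor_bound : ∃ K : ℝ, ∀ᶠ q : ℕ in atTop, ∀ χ : DirichletCharacter ℂ q, χ.IsPrimitive →
    F.analyticConductor χ (1 / 2) ≤ K * F.N q ∧ F.N q ≤ K * (q : ℝ) ^ d

/-- (A1) `|λ_F(n)| ≤ τ_d(n)` for all `n ≥ 1`. -/
def RamanujanBound : Prop := ∀ n : ℕ, 1 ≤ n → ‖F.coeff n‖ ≤ divisorFunction d n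

/-- (A2) For some fixed `ε > 0`: `∑_{X ≤ n ≤ X + Y} |λ_F(n)|² ≪_F Y` for all large `X` and all
`X^{1-ε} ≤ Y ≤ X`. -/
def ShortIntervalBound : Prop :=
  ∃ ε : ℝ, 0 < ε ∧ ∃ K X₀ : ℝ, ∀ X Y : ℝ, 2 ≤ X → X₀ ≤ X → X ^ (1 - ε) ≤ Y → Y ≤ X →
    ∑ n ∈ Finset.Icc ⌈X⌉₊ ⌊X + Y⌋₊, ‖F.coeff n‖ ^ 2 ≤ K * Y

/-- (A3) `∑_{n ≤ X, (n, ∏_{P₁ ≤ p ≤ P₂} p) = 1} |λ_F(n)|² ≪_F X log P₁ / log P₂` for all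
`2 ≤ P₁ ≤ P₂ ≤ X`. -/
def SieveBound : Prop :=
  ∃ K : ℝ, ∀ X P₁ P₂ : ℝ, 2 ≤ P₁ → P₁ ≤ P₂ → P₂ ≤ X →
    ∑ n ∈ Finset.Icc 1 ⌊X⌋₊ with
        n.Coprime (∏ p ∈ Finset.Icc ⌈P₁⌉₊ ⌊P₂⌋₊ with p.Prime, p), ‖F.coeff n‖ ^ 2
      ≤ K * (X * (Real.log P₁ / Real.log P₂))

/-- The zero free region up to height `T` for the characters of a set `𝓕` of characters modulo `q`:
`∏_{χ ∈ 𝓕} L(σ + it, F × χ) ≠ 0` for `σ > 1 - c / log^β (qT)` and `|t| ≤ T`. -/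
def ZeroFreeRegion (𝓕 : Finset (DirichletCharacter ℂ q)) (c β T : ℝ) : Prop :=
  ∀ σ t : ℝ, 1 - c / Real.log (q * T) ^ β < σ → |t| ≤ T →
    ∏ χ ∈ 𝓕, F.L χ (σ + t * Complex.I) ≠ 0

/-- (A4) at the modulus `q`: the zero free region holds for every `T` with
`K₁ log^100 q ≤ T ≤ K₂ q^ψ` (and `T ≥ 1`, which only matters for bounded `q`). -/
def ZeroFreeRegions (𝓕 : Finset (DirichletCharacter ℂ q)) (c β K₁ K₂ ψ : ℝ) : Prop :=
  ∀ T : ℝ, 1 ≤ T → K₁ * Real.log q ^ 100 ≤ T → T ≤ K₂ * (q : ℝ) ^ ψ →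
    F.ZeroFreeRegion 𝓕 c β T

end LData

end

/-!
The central values `L(1/2, F × χ)` are written, by an approximate functional equation, as sums of
`λ_F(n) χ(n) n^{-1/2}` with a smooth weight of length about `Y = q^{d/2}`
(`LData.Axioms.exists_norm_L_half_le`, `AdmissibleKernel.integral_mul_LSeries`). Over the characters of
`𝓕` these sums form a vector `∑ λ_F(n) • weightVec n` in a Euclidean space. Since `d ≥ 3`, the sums are
longer than `q`, so that the mean value theorem over the characters modulo `q` bounds the square of the norm
of this vector by `O(q^{d/2})` (`exists_norm_sum_weightVec_le`). A
power of `log q` has to be gained.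

Let `p` run over the primes from `exp (log^β' q)` to `q^{1/10}`, where `β < β' < 1 - η`. By the sieve
bound, the integers without any prime factor in this range contribute a mean square that is smaller by the
factor `log^{β' - 1} q`, which is the gain that the theorem claims
(`LData.SieveBound.exists_secondMoment_sieveFlow_le`). All other integers contribute less, thanks to the
zero free region. To separate them, each integer gets the weight `∏ (1 - x w(p))` over its exact prime
factors `p`, where `w` is a smooth indicator of the range of the auxiliary primes. This weight is `1` at
`x = 0` and it sieves the range at `x = 1`. As it is multiplicative, its derivative in `x` turns the sum
into minus a bilinear sum over `n = p m`, up to integers divisible by `p²` and to truncation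
(`LData.norm_sum_le_of_sieveFlow`); so it suffices to bound this bilinear sum for every `x ∈ [0, 1]`.

After cutting the range of `p` into windows `p ≈ e^v`, and separating `p` from `m` by the Mellin transform
of the smooth weight, the bilinear sum factors, for each character, into a Dirichlet polynomial in `m`, to
which the mean value theorem applies, and a prime sum `∑ λ_F(p) χ(p) p^{-s}` over the window
(`LData.norm_bilinear_block_le`). For every `χ ∈ 𝓕` the latter saves `log^{90} q` over the trivial bound:
it is a contour integral of the sum over all primes, which inside the zero free region is a holomorphic
logarithm of `L(s, F × χ)` up to a bounded function; the Borel-Carathéodory theorem bounds this logarithm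
polynomially in `log q`, and moving the line of integration into the region gains `exp (-v l / 2)`, with
`l` the width of the region and `v ≥ log^β' q` (`LData.Axioms.exists_norm_primeWindow_le`). Smoothing the
windows by triangles, whose Laplace transform decays quadratically, makes the contributions from outside
the region negligible.

Growth of `L(s, F × χ)` is needed only in the crude form of the Phragmén-Lindelöf principle
(`LData.Axioms.exists_norm_L_le`). The parity `χ(-1)`, on which the factors at infinity depend, is fixed
until the end.
-/


/-! ### Coefficients and local parameters -/

namespace LData

variable {d : ℕ} (F : LData d)

theorem localCoeff_zero (p : ℕ) : F.localCoeff p 0 = 1 := by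
  simp [localCoeff]

theorem localCoeff_one (p : ℕ) : F.localCoeff p 1 = ∑ j, F.α p j := by
  classical
  unfold localCoeff
  symm
  refine Finset.sum_bij (fun j _ ↦ Pi.single j 1) ?_ ?_ ?_ ?_
  · intro j _
    simp
  · intro i _ j _ h
    by_contra hij
    have := congrFun h i
    simp [hij] at this
  · intro e he
    simp only [Finset.mem_piAntidiag] at he
    obtain ⟨a, ha⟩ := (Finsupp.sum_eq_one_iff (Finsupp.equivFunOnFinite.symm e)).1
      (by rw [Finsupp.sum_fintype] <;> simp [he.1])
    refine ⟨a, Finset.mem_univ _, ?_⟩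
    have := congrArg Finsupp.equivFunOnFinite ha
    simpa using this.symm
  · intro j _
    rw [Finset.prod_eq_single j] <;> simp +contextual

theorem coeff_zero : F.coeff 0 = 0 := by simp [coeff]

theorem coeff_one : F.coeff 1 = 1 := by simp [coeff]

theorem coeff_mul_of_coprime {m n : ℕ} (h : m.Coprime n) :
    F.coeff (m * n) = F.coeff m * F.coeff n := by
  rcases eq_or_ne m 0 with rfl | hm
  · simp [coeff]
  rcases eq_or_ne n 0 with rfl | hn
  · simp [coeff]
  simp only [coeff, hm, hn, mul_eq_zero, or_self, if_false]
  rw [Nat.factorization_mul hm hn, Finsupp.prod_add_index_of_disjoint]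
  simpa using h.disjoint_primeFactors

theorem coeff_prime_pow {p : ℕ} (hp : p.Prime) (k : ℕ) : F.coeff (p ^ k) = F.localCoeff p k := by
  rw [coeff, if_neg (pow_ne_zero _ hp.ne_zero), hp.factorization_pow,
    Finsupp.prod_single_index (F.localCoeff_zero p)]

theorem coeff_prime {p : ℕ} (hp : p.Prime) : F.coeff p = ∑ j, F.α p j := by
  rw [← F.localCoeff_one p, ← F.coeff_prime_pow hp, pow_one]

/-- The complete homogeneous sums have generating series `∏ⱼ (1 - αⱼ X)⁻¹`. -/
theorem prod_one_sub_mul_mk_localCoeff (p : ℕ) :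
    (∏ j, (1 - PowerSeries.C (F.α p j) * PowerSeries.X)) * PowerSeries.mk (F.localCoeff p) = 1 := by
  classical
  have h1 : PowerSeries.mk (F.localCoeff p) = ∏ j, PowerSeries.mk (fun n ↦ F.α p j ^ n) := by
    ext n
    rw [PowerSeries.coeff_prod, PowerSeries.coeff_mk, localCoeff]
    refine Finset.sum_bij (fun e _ ↦ Finsupp.equivFunOnFinite.symm e) ?_ ?_ ?_ ?_
    · intro e he
      simpa using he
    · intro a _ b _ h
      exact Finsupp.equivFunOnFinite.symm.injective h
    · intro e he
      refine ⟨⇑e, by simpa using he, by simp⟩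
    · intro e _
      simp
  rw [h1, ← Finset.prod_mul_distrib]
  refine Finset.prod_eq_one fun j _ ↦ ?_
  have h2 := congrArg (PowerSeries.rescale (F.α p j)) (PowerSeries.mk_one_mul_one_sub_eq_one ℂ)
  rw [map_mul, PowerSeries.rescale_mk, map_sub, map_one, PowerSeries.rescale_X] at h2
  rw [mul_comm]
  simpa using h2

/-- At a point `x` where the series of complete homogeneous sums converges absolutely, it is inverse
to `∏ⱼ (1 - αⱼ x)`. -/
theorem prod_one_sub_mul_tsum_localCoeff (p : ℕ) {x : ℂ}
    (hx : Summable fun r ↦ ‖F.localCoeff p r * x ^ r‖) :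
    (∏ j, (1 - F.α p j * x)) * ∑' r, F.localCoeff p r * x ^ r = 1 := by
  classical
  set Q : Polynomial ℂ := ∏ j, (1 - Polynomial.C (F.α p j) * Polynomial.X) with hQ
  have hQe : Q.eval x = ∏ j, (1 - F.α p j * x) := by
    simp [hQ, Polynomial.eval_prod]
  have hQc : (Q : PowerSeries ℂ) = ∏ j, (1 - PowerSeries.C (F.α p j) * PowerSeries.X) := by
    rw [hQ, ← Polynomial.coeToPowerSeries.ringHom_apply, map_prod]
    simp
  have hsupp : ∀ n ∉ Finset.range (Q.natDegree + 1), Q.coeff n * x ^ n = 0 := by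
    intro n hn
    rw [Polynomial.coeff_eq_zero_of_natDegree_lt, zero_mul]
    simpa using hn
  have hQt : ∑' n, Q.coeff n * x ^ n = Q.eval x := by
    rw [tsum_eq_sum hsupp, Polynomial.eval_eq_sum_range]
  have hQs : Summable fun n ↦ ‖Q.coeff n * x ^ n‖ := by
    refine summable_of_ne_finset_zero (s := Finset.range (Q.natDegree + 1)) fun n hn ↦ ?_
    rw [hsupp n hn, norm_zero]
  rw [← hQe, ← hQt, tsum_mul_tsum_eq_tsum_sum_antidiagonal_of_summable_norm hQs hx]
  have key : ∀ n, ∑ kl ∈ Finset.HasAntidiagonal.antidiagonal n,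
      Q.coeff kl.1 * x ^ kl.1 * (F.localCoeff p kl.2 * x ^ kl.2) = if n = 0 then 1 else 0 := by
    intro n
    have h := congrArg (PowerSeries.coeff n) (F.prod_one_sub_mul_mk_localCoeff p)
    rw [← hQc, PowerSeries.coeff_mul, PowerSeries.coeff_one] at h
    have h2 : ∑ kl ∈ Finset.HasAntidiagonal.antidiagonal n,
        Q.coeff kl.1 * x ^ kl.1 * (F.localCoeff p kl.2 * x ^ kl.2)
        = (∑ kl ∈ Finset.HasAntidiagonal.antidiagonal n, Q.coeff kl.1 * F.localCoeff p kl.2) * x ^ n := by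
      rw [Finset.sum_mul]
      refine Finset.sum_congr rfl fun kl hkl ↦ ?_
      rw [← Finset.HasAntidiagonal.mem_antidiagonal.1 hkl, pow_add]
      ring
    rw [h2]
    simp only [Polynomial.coeff_coe, PowerSeries.coeff_mk] at h
    rw [h]
    split_ifs with h0 <;> simp [h0]
  simp_rw [key]
  simp

theorem divisorFunction_prime_pow_le {p : ℕ} (hp : p.Prime) (d k : ℕ) :
    divisorFunction d (p ^ k) ≤ (k + 1) ^ d := by
  classical
  unfold divisorFunction
  calc (Nat.finMulAntidiag d (p ^ k)).card
      ≤ (Fintype.piFinset fun _ : Fin d ↦ (p ^ k).divisors).card := by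
        refine Finset.card_le_card fun f hf ↦ ?_
        rw [Fintype.mem_piFinset]
        intro i
        exact Nat.mem_divisors.2 ⟨Nat.dvd_of_mem_finMulAntidiag hf i, pow_ne_zero _ hp.ne_zero⟩
    _ = (k + 1) ^ d := by
        simp [Nat.divisors_prime_pow hp]

variable {F}

theorem RamanujanBound.norm_localCoeff_le (hA : F.RamanujanBound) {p : ℕ} (hp : p.Prime) (k : ℕ) :
    ‖F.localCoeff p k‖ ≤ ((k : ℝ) + 1) ^ d := by
  rw [← F.coeff_prime_pow hp]
  refine (hA _ (Nat.one_le_pow _ _ hp.pos)).trans ?_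
  exact_mod_cast divisorFunction_prime_pow_le hp d k

theorem RamanujanBound.norm_coeff_prime_le (hA : F.RamanujanBound) {p : ℕ} (hp : p.Prime) :
    ‖F.coeff p‖ ≤ 2 ^ d := by
  have := hA.norm_localCoeff_le hp 1
  rw [← F.coeff_prime_pow hp, pow_one] at this
  norm_num at this
  exact this

theorem summable_add_one_pow_mul_geometric (d : ℕ) {r : ℝ} (h0 : 0 ≤ r) (hr : r < 1) :
    Summable fun k : ℕ ↦ ((k : ℝ) + 1) ^ d * r ^ k := by
  have h1 : Summable fun k : ℕ ↦ (k : ℝ) ^ d * r ^ k :=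
    summable_pow_mul_geometric_of_norm_lt_one d (by rwa [Real.norm_of_nonneg h0])
  have h2 : Summable fun k : ℕ ↦ r ^ k := summable_geometric_of_lt_one h0 hr
  refine Summable.of_nonneg_of_le (fun k ↦ by positivity) (fun k ↦ ?_) ((h1.add h2).mul_left (2 ^ d))
  rw [← add_one_mul, ← mul_assoc]
  refine mul_le_mul_of_nonneg_right ?_ (by positivity)
  rcases Nat.eq_zero_or_pos k with rfl | hk
  · have : (1:ℝ) ≤ 2 ^ d := one_le_pow₀ (by norm_num)
    have h3 : (0:ℝ) ≤ ((0:ℕ):ℝ) ^ d := by positivity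
    simp only [Nat.cast_zero, zero_add, one_pow] at *
    nlinarith
  · have hk' : (1:ℝ) ≤ k := by exact_mod_cast hk
    calc ((k:ℝ) + 1) ^ d ≤ (2 * k) ^ d := by gcongr; linarith
      _ = 2 ^ d * (k:ℝ) ^ d := mul_pow _ _ _
      _ ≤ 2 ^ d * ((k:ℝ) ^ d + 1) := by gcongr; linarith

theorem RamanujanBound.summable_localCoeff (hA : F.RamanujanBound) {p : ℕ} (hp : p.Prime) {x : ℂ}
    (hx : ‖x‖ < 1) : Summable fun r ↦ ‖F.localCoeff p r * x ^ r‖ := by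
  refine Summable.of_nonneg_of_le (fun _ ↦ norm_nonneg _) (fun k ↦ ?_)
    (summable_add_one_pow_mul_geometric d (norm_nonneg x) hx)
  rw [norm_mul, norm_pow]
  gcongr
  exact hA.norm_localCoeff_le hp k

/-- A local parameter of modulus greater than `1` would make the series of `λ_F(p^r) x^r`, which
converges for `|x| < 1`, have a pole in the open unit disc. -/
theorem RamanujanBound.norm_param_le (hA : F.RamanujanBound) {p : ℕ} (hp : p.Prime) (j : Fin d) :
    ‖F.α p j‖ ≤ 1 := by
  by_contra! h
  have h0 : F.α p j ≠ 0 := fun h' ↦ by simp [h'] at h; linarith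
  have hx : ‖(F.α p j)⁻¹‖ < 1 := by
    rw [norm_inv]
    exact inv_lt_one_of_one_lt₀ h
  have := F.prod_one_sub_mul_tsum_localCoeff p (hA.summable_localCoeff hp hx)
  rw [Finset.prod_eq_zero (Finset.mem_univ j) (by simp [h0])] at this
  simp at this


/-- The sieve bound with an empty set of primes is the mean square bound for `λ_F`. -/
theorem SieveBound.exists_secondMoment_le (hA : F.SieveBound) :
    ∃ K : ℝ, 0 < K ∧ ∀ M : ℕ, ∑ n ∈ Finset.Icc 1 M, ‖F.coeff n‖ ^ 2 ≤ K * M := by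
  obtain ⟨K, hK⟩ := hA
  have h3 : ∀ M : ℕ, 3 ≤ M → ∑ n ∈ Finset.Icc 1 M, ‖F.coeff n‖ ^ 2 ≤ K * M := by
    intro M hM
    have hM' : (3:ℝ) ≤ M := by exact_mod_cast hM
    -- No integer lies in `[5/2, 5/2]`, so that nothing is sieved out.
    have h := hK M (5/2) (5/2) (by norm_num) le_rfl (by linarith)
    have h1 : ⌈(5/2 : ℝ)⌉₊ = 3 := by
      rw [Nat.ceil_eq_iff] <;> norm_num
    have h2 : ⌊(5/2 : ℝ)⌋₊ = 2 := by
      rw [Nat.floor_eq_iff] <;> norm_num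
    have h4 : Real.log (5/2) ≠ 0 := (Real.log_pos (by norm_num)).ne'
    simpa [h1, h2, div_self h4] using h
  set K' := |K| + ∑ n ∈ Finset.Icc 1 3, ‖F.coeff n‖ ^ 2 + 1 with hK'
  have hs : 0 ≤ ∑ n ∈ Finset.Icc 1 3, ‖F.coeff n‖ ^ 2 := by positivity
  refine ⟨K', by positivity, fun M ↦ ?_⟩
  rcases le_or_gt 3 M with hM | hM
  · refine (h3 M hM).trans ?_
    gcongr
    linarith [le_abs_self K]
  · rcases Nat.eq_zero_or_pos M with rfl | h0
    · simp
    have h1 : (1:ℝ) ≤ M := by exact_mod_cast h0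
    have h2 : ∑ n ∈ Finset.Icc 1 M, ‖F.coeff n‖ ^ 2 ≤ ∑ n ∈ Finset.Icc 1 3, ‖F.coeff n‖ ^ 2 :=
      Finset.sum_le_sum_of_subset_of_nonneg (Finset.Icc_subset_Icc_right hM.le)
        (fun _ _ _ ↦ by positivity)
    calc _ ≤ K' := by linarith [abs_nonneg K]
      _ ≤ K' * M := le_mul_of_one_le_right (by positivity) h1

/-- Writing `n = p^k m` with `p ∤ m` and `k ≥ r`, the factors `λ_F(p^k)` grow polynomially in `k`, so that
the sum over `k` converges. -/
theorem exists_secondMoment_multiples_le (hA1 : F.RamanujanBound) (hA3 : F.SieveBound) (r : ℕ) :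
    ∃ C : ℝ, 0 < C ∧ ∀ p : ℕ, p.Prime → ∀ M : ℕ,
      ∑ n ∈ Finset.Icc 1 M with p ^ r ∣ n, ‖F.coeff n‖ ^ 2 ≤ C * (M / (p : ℝ) ^ r) := by
  classical
  obtain ⟨K, hK, hKM⟩ := hA3.exists_secondMoment_le
  have hsum := summable_add_one_pow_mul_geometric (d + d) (r := 1 / 2) (by norm_num) (by norm_num)
  set S := ∑' k : ℕ, ((k : ℝ) + 1) ^ (d + d) * (1 / 2) ^ k with hS
  have hS0 : 0 ≤ S := tsum_nonneg fun k ↦ by positivity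
  refine ⟨K * (((r : ℝ) + 1) ^ (d + d) * S) + 1, by positivity, fun p hp M ↦ ?_⟩
  have hp2 : (2:ℝ) ≤ p := by exact_mod_cast hp.two_le
  have hp0 : (0:ℝ) < p := by linarith
  -- `n ↦ (k, m)` with `n = p^k m` and `p ∤ m` is injective, and its image lies in `T`.
  set T : Finset (Σ _ : ℕ, ℕ) := (Finset.Ico r (r + (M + 1))).sigma fun k ↦ Finset.Icc 1 (M / p ^ k)
    with hT
  set φ : ℕ → Σ _ : ℕ, ℕ := fun n ↦ ⟨n.factorization p, n / p ^ n.factorization p⟩ with hφ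
  set g : (Σ _ : ℕ, ℕ) → ℝ := fun y ↦ ‖F.localCoeff p y.1‖ ^ 2 * ‖F.coeff y.2‖ ^ 2 with hg
  have hfg : ∀ n ∈ Finset.filter (fun n ↦ p ^ r ∣ n) (Finset.Icc 1 M), ‖F.coeff n‖ ^ 2 = g (φ n) := by
    intro n hn
    simp only [Finset.mem_filter, Finset.mem_Icc] at hn
    have h0 : n ≠ 0 := by omega
    conv_lhs => rw [← Nat.ordProj_mul_ordCompl_eq_self n p]
    rw [F.coeff_mul_of_coprime ((Nat.coprime_ordCompl hp h0).pow_left _), F.coeff_prime_pow hp,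
      norm_mul, mul_pow]
  have hinj : Set.InjOn φ (Finset.filter (fun n ↦ p ^ r ∣ n) (Finset.Icc 1 M)) := by
    intro a _ b _ hab
    have h1 : a.factorization p = b.factorization p := congrArg Sigma.fst hab
    have h2 : a / p ^ a.factorization p = b / p ^ b.factorization p := congrArg (fun x ↦ x.2) hab
    rw [← Nat.ordProj_mul_ordCompl_eq_self a p, ← Nat.ordProj_mul_ordCompl_eq_self b p, h2, h1]
  have hmap : (Finset.filter (fun n ↦ p ^ r ∣ n) (Finset.Icc 1 M)).image φ ⊆ T := by
    intro y hy
    obtain ⟨n, hn, rfl⟩ := Finset.mem_image.1 hy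
    simp only [Finset.mem_filter, Finset.mem_Icc] at hn
    have h0 : n ≠ 0 := by omega
    have h1 : r ≤ n.factorization p := (hp.pow_dvd_iff_le_factorization h0).1 hn.2
    have h2 : n.factorization p < n := Nat.factorization_lt p h0
    simp only [hT, hφ, Finset.mem_sigma, Finset.mem_Ico, Finset.mem_Icc]
    exact ⟨⟨h1, by omega⟩, Nat.ordCompl_pos p h0, Nat.div_le_div_right hn.1.2⟩
  calc ∑ n ∈ Finset.Icc 1 M with p ^ r ∣ n, ‖F.coeff n‖ ^ 2
      = ∑ n ∈ Finset.Icc 1 M with p ^ r ∣ n, g (φ n) := Finset.sum_congr rfl hfg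
    _ = ∑ y ∈ (Finset.filter (fun n ↦ p ^ r ∣ n) (Finset.Icc 1 M)).image φ, g y :=
        (Finset.sum_image hinj).symm
    _ ≤ ∑ y ∈ T, g y :=
        Finset.sum_le_sum_of_subset_of_nonneg hmap fun _ _ _ ↦ by positivity
    _ = ∑ k ∈ Finset.Ico r (r + (M + 1)), ‖F.localCoeff p k‖ ^ 2 *
          ∑ m ∈ Finset.Icc 1 (M / p ^ k), ‖F.coeff m‖ ^ 2 := by
        rw [hT, Finset.sum_sigma]
        simp only [hg, Finset.mul_sum]
    _ ≤ ∑ k ∈ Finset.Ico r (r + (M + 1)), ((k : ℝ) + 1) ^ (d + d) * (K * (M / (p : ℝ) ^ k)) := by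
        refine Finset.sum_le_sum fun k _ ↦ ?_
        refine mul_le_mul ?_ ?_ (by positivity) (by positivity)
        · rw [pow_add, ← sq]
          gcongr
          exact hA1.norm_localCoeff_le hp k
        · refine (hKM _).trans ?_
          gcongr
          exact_mod_cast Nat.cast_div_le
    _ = ∑ i ∈ Finset.range (M + 1),
          (((r + i : ℕ) : ℝ) + 1) ^ (d + d) * (K * (M / (p : ℝ) ^ (r + i))) := by
        rw [Finset.sum_Ico_eq_sum_range]
        simp
    _ ≤ ∑ i ∈ Finset.range (M + 1), K * ((r : ℝ) + 1) ^ (d + d) * (M / (p : ℝ) ^ r) *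
          (((i : ℝ) + 1) ^ (d + d) * (1 / 2) ^ i) := by
        refine Finset.sum_le_sum fun i _ ↦ ?_
        have h1 : (((r + i : ℕ) : ℝ) + 1) ^ (d + d) ≤ ((r : ℝ) + 1) ^ (d + d) * ((i : ℝ) + 1) ^ (d + d) := by
          rw [← mul_pow]
          gcongr
          push_cast
          nlinarith [(Nat.cast_nonneg r : (0:ℝ) ≤ r), (Nat.cast_nonneg i : (0:ℝ) ≤ i)]
        have h2 : (M : ℝ) / (p : ℝ) ^ (r + i) ≤ M / (p : ℝ) ^ r * (1 / 2) ^ i := by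
          rw [pow_add, ← div_div, div_eq_mul_inv _ ((p:ℝ) ^ i), ← inv_pow, one_div]
          gcongr
        calc _ ≤ (((r : ℝ) + 1) ^ (d + d) * ((i : ℝ) + 1) ^ (d + d)) *
              (K * (M / (p : ℝ) ^ r * (1 / 2) ^ i)) := by gcongr
          _ = _ := by ring
    _ ≤ K * ((r : ℝ) + 1) ^ (d + d) * (M / (p : ℝ) ^ r) * S := by
        rw [← Finset.mul_sum]
        gcongr
        exact hsum.sum_le_tsum _ fun _ _ ↦ by positivity
    _ ≤ (K * (((r : ℝ) + 1) ^ (d + d) * S) + 1) * (M / (p : ℝ) ^ r) := by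
        have : 0 ≤ (M : ℝ) / (p : ℝ) ^ r := by positivity
        linarith

end LData

/-! ### The mean value theorem over characters -/

/-- The number of integers of an interval of length `X` in a residue class modulo `q`. -/
theorem card_filter_Ico_natCast_eq_le {q : ℕ} [NeZero q] (A X : ℕ) (x : ZMod q) :
    (((Finset.Ico A (A + X)).filter fun n : ℕ ↦ (n : ZMod q) = x).card : ℝ) ≤ X / q + 1 := by
  have hq : (0:ℝ) < q := by exact_mod_cast Nat.pos_of_ne_zero (NeZero.ne q)
  have h1 : (Finset.Ico A (A + X)).filter (fun n : ℕ ↦ (n : ZMod q) = x) =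
      (Finset.Ico A (A + X)).filter (fun n ↦ n ≡ x.val [MOD q]) := by
    refine Finset.filter_congr fun n _ ↦ ?_
    rw [← ZMod.natCast_eq_natCast_iff, ZMod.natCast_zmod_val]
  rw [h1]
  have h2 := Nat.Ico_filter_modEq_card (A) (A + X) (Nat.pos_of_ne_zero (NeZero.ne q)) x.val
  have h3 : ((((Finset.Ico A (A + X)).filter fun n ↦ n ≡ x.val [MOD q]).card : ℤ) : ℚ)
      ≤ X / q + 1 := by
    rw [h2]
    push_cast
    rw [max_le_iff]
    constructor
    · have e1 := Int.ceil_lt_add_one ((((A:ℚ) + X) - x.val) / q)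
      have e2 := Int.le_ceil (((A:ℚ) - x.val) / q)
      have e3 : (((A:ℚ) + X) - x.val) / q = ((A:ℚ) - x.val) / q + X / q := by ring
      push_cast at *
      linarith
    · positivity
  have h4 := (Rat.cast_le (K := ℝ)).2 h3
  push_cast at h4
  exact h4

/-- Orthogonality of the characters modulo `q`. -/
theorem DirichletCharacter.sum_mul_conj {q : ℕ} [NeZero q] (x y : ZMod q) :
    ∑ χ : DirichletCharacter ℂ q, χ x * conj (χ y) =
      if IsUnit y ∧ y = x then (q.totient : ℂ) else 0 := by
  by_cases hy : IsUnit y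
  · have h := DirichletCharacter.sum_char_inv_mul_char_eq ℂ hy x
    simp only [hy, true_and]
    rw [← h]
    refine Finset.sum_congr rfl fun χ _ ↦ ?_
    have h2 : conj (χ y) = χ y⁻¹ := by
      have := MulChar.star_apply' χ y
      rw [Complex.star_def] at this
      obtain ⟨u, rfl⟩ := hy
      rw [this, MulChar.inv_apply, Ring.inverse_unit, ZMod.inv_coe_unit]
    rw [h2, mul_comm]
  · simp only [hy, false_and, if_false]
    refine Finset.sum_eq_zero fun χ _ ↦ ?_
    rw [χ.map_nonunit hy, map_zero, mul_zero]

/-- The mean value theorem for Dirichlet polynomials over a set of characters modulo `q`. -/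
theorem DirichletCharacter.sum_norm_sum_sq_le {q : ℕ} [NeZero q]
    (𝓕 : Finset (DirichletCharacter ℂ q)) {S : Finset ℕ} {A X : ℕ}
    (hS : S ⊆ Finset.Ico A (A + X)) (a : ℕ → ℂ) :
    ∑ χ ∈ 𝓕, ‖∑ n ∈ S, a n * χ (n : ZMod q)‖ ^ 2 ≤ (X + q) * ∑ n ∈ S, ‖a n‖ ^ 2 := by
  classical
  have hq : (0:ℝ) < q := by exact_mod_cast Nat.pos_of_ne_zero (NeZero.ne q)
  set b : ZMod q → ℂ := fun x ↦ ∑ n ∈ S with ((n : ℕ) : ZMod q) = x, a n with hb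
  have hsum : ∀ χ : DirichletCharacter ℂ q,
      ∑ n ∈ S, a n * χ (n : ZMod q) = ∑ x, b x * χ x := by
    intro χ
    rw [← Finset.sum_fiberwise S (fun n : ℕ ↦ (n : ZMod q))]
    refine Finset.sum_congr rfl fun x _ ↦ ?_
    rw [hb, Finset.sum_mul]
    refine Finset.sum_congr rfl fun n hn ↦ ?_
    rw [(Finset.mem_filter.1 hn).2]
  -- Orthogonality of all characters modulo `q`; extending the sum from `𝓕` to them costs nothing.
  have hortho : ∑ χ : DirichletCharacter ℂ q, ‖∑ x, b x * χ x‖ ^ 2 ≤ q * ∑ x, ‖b x‖ ^ 2 := by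
    have h1 : ((∑ χ : DirichletCharacter ℂ q, ‖∑ x, b x * χ x‖ ^ 2 : ℝ) : ℂ) =
        ∑ x, if IsUnit x then (q.totient : ℂ) * (‖b x‖ ^ 2 : ℝ) else 0 := by
      push_cast
      calc ∑ χ : DirichletCharacter ℂ q, (‖∑ x, b x * χ x‖ : ℂ) ^ 2
          = ∑ χ : DirichletCharacter ℂ q, ∑ y, ∑ x, b x * conj (b y) * (χ x * conj (χ y)) := by
            refine Finset.sum_congr rfl fun χ _ ↦ ?_
            rw [← Complex.mul_conj', map_sum, Finset.sum_mul_sum, Finset.sum_comm]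
            refine Finset.sum_congr rfl fun y _ ↦ Finset.sum_congr rfl fun x _ ↦ ?_
            rw [map_mul]
            ring
        _ = ∑ y, ∑ x, b x * conj (b y) * ∑ χ : DirichletCharacter ℂ q, (χ x * conj (χ y)) := by
            rw [Finset.sum_comm]
            refine Finset.sum_congr rfl fun y _ ↦ ?_
            rw [Finset.sum_comm]
            simp_rw [Finset.mul_sum]
        _ = _ := by
            refine Finset.sum_congr rfl fun y _ ↦ ?_
            simp_rw [DirichletCharacter.sum_mul_conj]
            by_cases hy : IsUnit y
            · simp only [hy, true_and, mul_ite, mul_zero, if_true]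
              rw [Finset.sum_ite_eq]
              simp only [Finset.mem_univ, if_true]
              rw [Complex.mul_conj']
              ring
            · simp [hy]
    have h2 : ∑ χ : DirichletCharacter ℂ q, ‖∑ x, b x * χ x‖ ^ 2 =
        ∑ x, if IsUnit x then (q.totient : ℝ) * ‖b x‖ ^ 2 else 0 := by
      have h3 : ((∑ x : ZMod q, if IsUnit x then (q.totient : ℝ) * ‖b x‖ ^ 2 else 0 : ℝ) : ℂ) =
          ∑ x, if IsUnit x then (q.totient : ℂ) * (‖b x‖ ^ 2 : ℝ) else 0 := by
        push_cast
        refine Finset.sum_congr rfl fun x _ ↦ ?_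
        split_ifs <;> simp
      rw [← h3] at h1
      exact_mod_cast h1
    rw [h2, Finset.mul_sum]
    refine Finset.sum_le_sum fun x _ ↦ ?_
    split_ifs
    · gcongr
      exact_mod_cast Nat.totient_le q
    · positivity
  have hcs : ∀ x, ‖b x‖ ^ 2 ≤ (X / q + 1) * ∑ n ∈ S with ((n : ℕ) : ZMod q) = x, ‖a n‖ ^ 2 := by
    intro x
    calc ‖b x‖ ^ 2 ≤ (∑ n ∈ S with ((n : ℕ) : ZMod q) = x, ‖a n‖) ^ 2 := by
          gcongr
          exact norm_sum_le _ _
      _ ≤ (S.filter fun n : ℕ ↦ (n : ZMod q) = x).card *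
            ∑ n ∈ S with ((n : ℕ) : ZMod q) = x, ‖a n‖ ^ 2 := sq_sum_le_card_mul_sum_sq
      _ ≤ _ := by
          gcongr
          refine le_trans ?_ (card_filter_Ico_natCast_eq_le A X x)
          exact_mod_cast Finset.card_le_card (Finset.filter_subset_filter _ hS)
  calc ∑ χ ∈ 𝓕, ‖∑ n ∈ S, a n * χ (n : ZMod q)‖ ^ 2
      ≤ ∑ χ : DirichletCharacter ℂ q, ‖∑ n ∈ S, a n * χ (n : ZMod q)‖ ^ 2 :=
        Finset.sum_le_sum_of_subset_of_nonneg (Finset.subset_univ _) fun _ _ _ ↦ by positivity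
    _ ≤ q * ∑ x, ‖b x‖ ^ 2 := by simpa only [hsum] using hortho
    _ ≤ q * ∑ x : ZMod q, (X / q + 1) * ∑ n ∈ S with ((n : ℕ) : ZMod q) = x, ‖a n‖ ^ 2 := by
        gcongr with x
        exact hcs x
    _ = (X + q) * ∑ n ∈ S, ‖a n‖ ^ 2 := by
        rw [← Finset.mul_sum, Finset.sum_fiberwise, ← mul_assoc]
        congr 1
        field_simp

/-! ### The logarithm of the Euler product -/

/-- The prime sum is at most the zeta sum, which has a simple pole at `1`. -/
theorem exists_tsum_primes_rpow_neg_le :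
    ∃ C : ℝ, 0 < C ∧ ∀ σ : ℝ, 1 < σ → σ ≤ 2 →
      ∑' p : Nat.Primes, ((p : ℕ) : ℝ) ^ (-σ) ≤ C / (σ - 1) := by
  have hlim := tendsto_sub_mul_tsum_nat_rpow
  have hev : ∀ᶠ σ : ℝ in 𝓝[>] 1, (σ - 1) * ∑' n : ℕ, 1 / (n : ℝ) ^ σ < 2 :=
    hlim.eventually_lt_const (by norm_num)
  obtain ⟨σ₀, hσ₀, h⟩ := (eventually_nhdsWithin_iff.1 hev |> Metric.eventually_nhds_iff.1)
  have hs : ∀ σ : ℝ, 1 < σ → Summable fun n : ℕ ↦ 1 / (n : ℝ) ^ σ := fun σ hσ ↦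
    Real.summable_one_div_nat_rpow.2 hσ
  set σ₁ := 1 + σ₀ / 2 with hσ₁
  have hσ₁' : 1 < σ₁ := by linarith
  set Z := ∑' n : ℕ, 1 / (n : ℝ) ^ σ₁ with hZ
  have hZ0 : 0 ≤ Z := tsum_nonneg fun n ↦ by positivity
  have hprime : ∀ σ : ℝ, 1 < σ →
      ∑' p : Nat.Primes, ((p : ℕ) : ℝ) ^ (-σ) ≤ ∑' n : ℕ, 1 / (n : ℝ) ^ σ := by
    intro σ hσ
    have h1 : ∀ p : Nat.Primes, ((p : ℕ) : ℝ) ^ (-σ) = 1 / ((p : ℕ) : ℝ) ^ σ := fun p ↦ by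
      rw [Real.rpow_neg (by positivity), one_div]
    simp_rw [h1]
    exact (hs σ hσ).tsum_subtype_le (fun n : ℕ ↦ 1 / (n : ℝ) ^ σ) {p : ℕ | p.Prime}
      (fun n ↦ by positivity)
  refine ⟨2 + Z, by positivity, fun σ h1 h2 ↦ ?_⟩
  rw [le_div_iff₀ (by linarith)]
  rcases lt_or_ge (σ - 1) σ₀ with h3 | h3
  · have h4 := h (y := σ) (by rw [Real.dist_eq, abs_of_pos (by linarith)]; exact h3) h1
    have h5 := mul_le_mul_of_nonneg_right (hprime σ h1) (by linarith : 0 ≤ σ - 1)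
    linarith
  · have h4 : ∑' n : ℕ, 1 / (n : ℝ) ^ σ ≤ Z := by
      refine (hs σ h1).tsum_le_tsum (fun n ↦ ?_) (hs σ₁ hσ₁')
      rcases Nat.eq_zero_or_pos n with rfl | hn
      · simp [Real.zero_rpow (by linarith : σ ≠ 0), Real.zero_rpow (by linarith : σ₁ ≠ 0)]
      · have : (1:ℝ) ≤ n := by exact_mod_cast hn
        gcongr
        linarith
    have h5 := (hprime σ h1).trans h4
    have h6 : 0 ≤ ∑' p : Nat.Primes, ((p : ℕ) : ℝ) ^ (-σ) := tsum_nonneg fun p ↦ by positivity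
    nlinarith

namespace LData

variable {d : ℕ} (F : LData d) {q : ℕ} (χ : DirichletCharacter ℂ q)

/-- The sum `∑_p λ_F(p) χ(p) p^{-s}` over the primes, for `Re s > 1`. -/
noncomputable def primeSeries (s : ℂ) : ℂ :=
  ∑' p : Nat.Primes, F.coeff p * χ ((p : ℕ) : ZMod q) * ((p : ℕ) : ℂ) ^ (-s)

/-- The contribution of the prime powers `p^k`, `k ≥ 2`, to `log L(s, F × χ)`; it is holomorphic and
bounded to the left of `Re s = 1`. -/
noncomputable def logRemainder (s : ℂ) : ℂ :=
  ∑' p : Nat.Primes, ∑ j, (Complex.log (1 - F.twistedParam χ p j * ((p : ℕ) : ℂ) ^ (-s))⁻¹ -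
    F.twistedParam χ p j * ((p : ℕ) : ℂ) ^ (-s))

variable {F}

theorem norm_natCast_prime_cpow_neg (p : Nat.Primes) (s : ℂ) :
    ‖((p : ℕ) : ℂ) ^ (-s)‖ = ((p : ℕ) : ℝ) ^ (-s.re) := by
  rw [Complex.norm_natCast_cpow_of_pos p.2.pos, Complex.neg_re]

theorem RamanujanBound.norm_twistedParam_mul_le (hA : F.RamanujanBound) (p : Nat.Primes) (j : Fin d)
    (s : ℂ) : ‖F.twistedParam χ p j * ((p : ℕ) : ℂ) ^ (-s)‖ ≤ ((p : ℕ) : ℝ) ^ (-s.re) := by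
  rw [norm_mul, norm_natCast_prime_cpow_neg, twistedParam, norm_mul]
  have h1 := hA.norm_param_le p.2 j
  have h2 := χ.norm_le_one ((p : ℕ) : ZMod q)
  have h3 : ‖F.α p j‖ * ‖χ ((p : ℕ) : ZMod q)‖ ≤ 1 := mul_le_one₀ h1 (norm_nonneg _) h2
  exact mul_le_of_le_one_left (by positivity) h3

/-- The local factors stay away from `0` up to the line `Re s = 9/10`: `2^{9/10} ≥ 5/3`. -/
theorem prime_rpow_neg_le {σ : ℝ} (hσ : 9 / 10 ≤ σ) (p : Nat.Primes) :
    ((p : ℕ) : ℝ) ^ (-σ) ≤ 3 / 5 := by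
  have hp : (2:ℝ) ≤ (p : ℕ) := by exact_mod_cast p.2.two_le
  calc ((p : ℕ) : ℝ) ^ (-σ) ≤ 2 ^ (-σ) := Real.rpow_le_rpow_of_nonpos (by norm_num) hp (by linarith)
    _ ≤ 2 ^ (-(9/10) : ℝ) := Real.rpow_le_rpow_of_exponent_le (by norm_num) (by linarith)
    _ ≤ 3 / 5 := by
        rw [Real.rpow_neg (by norm_num), inv_le_comm₀ (by positivity) (by norm_num)]
        have h1 : (((3:ℝ) / 5)⁻¹) = ((((3:ℝ) / 5)⁻¹) ^ (10:ℕ)) ^ ((1:ℝ)/10) := by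
          rw [← Real.rpow_natCast, ← Real.rpow_mul (by norm_num)]
          norm_num
        have h2 : (2:ℝ) ^ ((9:ℝ)/10) = ((2:ℝ) ^ (9:ℕ)) ^ ((1:ℝ)/10) := by
          rw [← Real.rpow_natCast, ← Real.rpow_mul (by norm_num)]
          norm_num
        rw [h1, h2]
        exact Real.rpow_le_rpow (by norm_num) (by norm_num) (by norm_num)

theorem RamanujanBound.norm_logRemainder_term_le (hA : F.RamanujanBound) {s : ℂ}
    (hs : 9 / 10 ≤ s.re) (p : Nat.Primes) :
    ‖∑ j, (Complex.log (1 - F.twistedParam χ p j * ((p : ℕ) : ℂ) ^ (-s))⁻¹ -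
      F.twistedParam χ p j * ((p : ℕ) : ℂ) ^ (-s))‖ ≤ d * (2 * ((p : ℕ) : ℝ) ^ (-(9 / 5) : ℝ)) := by
  have hp : (1:ℝ) ≤ (p : ℕ) := by exact_mod_cast p.2.one_lt.le
  refine (norm_sum_le _ _).trans ?_
  have hterm : ∀ j, ‖Complex.log (1 - F.twistedParam χ p j * ((p : ℕ) : ℂ) ^ (-s))⁻¹ -
      F.twistedParam χ p j * ((p : ℕ) : ℂ) ^ (-s)‖ ≤ 2 * ((p : ℕ) : ℝ) ^ (-(9 / 5) : ℝ) := by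
    intro j
    set x := F.twistedParam χ p j * ((p : ℕ) : ℂ) ^ (-s) with hx
    have h1 : ‖x‖ ≤ ((p : ℕ) : ℝ) ^ (-s.re) := hA.norm_twistedParam_mul_le χ p j s
    have h2 : ‖x‖ ≤ 3 / 5 := h1.trans (prime_rpow_neg_le hs p)
    refine (Complex.norm_log_one_sub_inv_sub_self_le (by linarith)).trans ?_
    have h3 : (1 - ‖x‖)⁻¹ ≤ 5 / 2 := by
      rw [inv_le_comm₀ (by linarith) (by norm_num)]
      linarith
    have h4 : ‖x‖ ^ 2 ≤ ((p : ℕ) : ℝ) ^ (-(9 / 5) : ℝ) := by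
      calc ‖x‖ ^ 2 ≤ (((p : ℕ) : ℝ) ^ (-s.re)) ^ 2 := by gcongr
        _ = ((p : ℕ) : ℝ) ^ (-s.re * 2) := by
            rw [← Real.rpow_natCast, ← Real.rpow_mul (by positivity)]
            norm_num
        _ ≤ _ := Real.rpow_le_rpow_of_exponent_le hp (by linarith)
    calc ‖x‖ ^ 2 * (1 - ‖x‖)⁻¹ / 2 ≤ ((p : ℕ) : ℝ) ^ (-(9 / 5) : ℝ) * (5 / 2) / 2 := by
          have : 0 ≤ 1 - ‖x‖ := by linarith
          gcongr
      _ ≤ _ := by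
          have : (0:ℝ) ≤ ((p : ℕ) : ℝ) ^ (-(9 / 5) : ℝ) := by positivity
          linarith
  calc ∑ j, ‖Complex.log (1 - F.twistedParam χ p j * ((p : ℕ) : ℂ) ^ (-s))⁻¹ -
      F.twistedParam χ p j * ((p : ℕ) : ℂ) ^ (-s)‖
      ≤ ∑ _j : Fin d, 2 * ((p : ℕ) : ℝ) ^ (-(9 / 5) : ℝ) := Finset.sum_le_sum fun j _ ↦ hterm j
    _ = _ := by simp

theorem summable_logRemainder_majorant (d : ℕ) :
    Summable fun p : Nat.Primes ↦ (d : ℝ) * (2 * ((p : ℕ) : ℝ) ^ (-(9 / 5) : ℝ)) :=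
  ((Nat.Primes.summable_rpow.2 (by norm_num)).mul_left 2).mul_left _

theorem RamanujanBound.norm_logRemainder_le (hA : F.RamanujanBound) {s : ℂ}
    (hs : 9 / 10 ≤ s.re) :
    ‖F.logRemainder χ s‖ ≤ ∑' p : Nat.Primes, (d : ℝ) * (2 * ((p : ℕ) : ℝ) ^ (-(9 / 5) : ℝ)) :=
  tsum_of_norm_bounded (summable_logRemainder_majorant d).hasSum
    fun p ↦ hA.norm_logRemainder_term_le χ hs p

theorem isOpen_lt_re (a : ℝ) : IsOpen {s : ℂ | a < s.re} :=
  isOpen_lt continuous_const Complex.continuous_re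

theorem differentiable_prime_cpow_neg (p : Nat.Primes) :
    Differentiable ℂ fun s : ℂ ↦ ((p : ℕ) : ℂ) ^ (-s) :=
  differentiable_neg.const_cpow (Or.inl (by exact_mod_cast p.2.ne_zero))

theorem RamanujanBound.differentiableOn_logRemainder (hA : F.RamanujanBound) :
    DifferentiableOn ℂ (F.logRemainder χ) {s : ℂ | 9 / 10 < s.re} := by
  refine Complex.differentiableOn_tsum_of_summable_norm (summable_logRemainder_majorant d) ?_
    (isOpen_lt_re _) fun p s hs ↦ hA.norm_logRemainder_term_le χ (le_of_lt hs) p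
  intro p
  refine DifferentiableOn.fun_sum fun j _ ↦ ?_
  have h1 : Differentiable ℂ fun s : ℂ ↦ F.twistedParam χ p j * ((p : ℕ) : ℂ) ^ (-s) :=
    (differentiable_prime_cpow_neg p).const_mul _
  intro s hs
  refine DifferentiableAt.differentiableWithinAt ?_
  refine DifferentiableAt.fun_sub ?_ h1.differentiableAt
  have h2 : ‖F.twistedParam χ p j * ((p : ℕ) : ℂ) ^ (-s)‖ < 1 :=
    ((hA.norm_twistedParam_mul_le χ p j s).trans (prime_rpow_neg_le (le_of_lt hs) p)).trans_lt
      (by norm_num)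
  have h3 := Complex.mem_slitPlane_of_norm_lt_one
    (z := -(F.twistedParam χ p j * ((p : ℕ) : ℂ) ^ (-s))) (by rwa [norm_neg])
  rw [← sub_eq_add_neg] at h3
  refine DifferentiableAt.clog ?_ ?_
  · exact DifferentiableAt.fun_inv ((differentiableAt_const _).sub h1.differentiableAt)
      (Complex.slitPlane_ne_zero h3)
  · refine Or.inl ?_
    have h4 : 0 < (1 - F.twistedParam χ p j * ((p : ℕ) : ℂ) ^ (-s)).re := by
      rw [Complex.sub_re, Complex.one_re]
      linarith [Complex.re_le_norm (F.twistedParam χ p j * ((p : ℕ) : ℂ) ^ (-s))]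
    rw [Complex.inv_re]
    exact div_pos h4 (Complex.normSq_pos.2 (Complex.slitPlane_ne_zero h3))

theorem RamanujanBound.norm_primeSeries_term_le (hA : F.RamanujanBound) (p : Nat.Primes) (s : ℂ) :
    ‖F.coeff p * χ ((p : ℕ) : ZMod q) * ((p : ℕ) : ℂ) ^ (-s)‖ ≤
      2 ^ d * ((p : ℕ) : ℝ) ^ (-s.re) := by
  rw [norm_mul, norm_natCast_prime_cpow_neg, norm_mul]
  gcongr
  calc _ ≤ (2:ℝ) ^ d * 1 := by
        gcongr
        · exact hA.norm_coeff_prime_le p.2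
        · exact χ.norm_le_one _
    _ = _ := mul_one _

theorem RamanujanBound.summable_primeSeries (hA : F.RamanujanBound) {s : ℂ} (hs : 1 < s.re) :
    Summable fun p : Nat.Primes ↦ F.coeff p * χ ((p : ℕ) : ZMod q) * ((p : ℕ) : ℂ) ^ (-s) :=
  Summable.of_norm_bounded ((Nat.Primes.summable_rpow.2 (by linarith)).mul_left (2 ^ d))
    fun p ↦ hA.norm_primeSeries_term_le χ p s

theorem RamanujanBound.exists_norm_primeSeries_le (hA : F.RamanujanBound) :
    ∃ C : ℝ, 0 < C ∧ ∀ (q : ℕ) (χ : DirichletCharacter ℂ q) (s : ℂ), 1 < s.re → s.re ≤ 2 →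
      ‖F.primeSeries χ s‖ ≤ C / (s.re - 1) := by
  obtain ⟨C, hC, h⟩ := exists_tsum_primes_rpow_neg_le
  refine ⟨2 ^ d * C, by positivity, fun q χ s h1 h2 ↦ ?_⟩
  have hs : Summable fun p : Nat.Primes ↦ ((p : ℕ) : ℝ) ^ (-s.re) :=
    Nat.Primes.summable_rpow.2 (by linarith)
  refine (tsum_of_norm_bounded (hs.mul_left (2 ^ d)).hasSum
    fun p ↦ hA.norm_primeSeries_term_le χ p s).trans ?_
  rw [tsum_mul_left, mul_div_assoc]
  gcongr
  exact h _ h1 h2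

theorem RamanujanBound.differentiableOn_primeSeries (hA : F.RamanujanBound) :
    DifferentiableOn ℂ (F.primeSeries χ) {s : ℂ | 1 < s.re} := by
  intro s hs
  have hs' : 1 < s.re := hs
  set a := (1 + s.re) / 2 with ha
  have h1 : DifferentiableOn ℂ (F.primeSeries χ) {s : ℂ | a < s.re} := by
    refine Complex.differentiableOn_tsum_of_summable_norm
      (u := fun p : Nat.Primes ↦ (2:ℝ) ^ d * ((p : ℕ) : ℝ) ^ (-a))
      ((Nat.Primes.summable_rpow.2 (by linarith)).mul_left _) ?_
      (isOpen_lt_re _) fun p s hs ↦ ?_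
    · intro p
      exact ((differentiable_prime_cpow_neg p).const_mul _).differentiableOn
    · refine (hA.norm_primeSeries_term_le χ p s).trans ?_
      have hp : (1:ℝ) ≤ (p : ℕ) := by exact_mod_cast p.2.one_lt.le
      gcongr
      exact le_of_lt hs
  exact (h1.differentiableAt ((isOpen_lt_re a).mem_nhds (by simp only [Set.mem_ofPred_eq]; linarith))).differentiableWithinAt

theorem twistedCoeff_mul_of_coprime {m n : ℕ} (h : m.Coprime n) :
    F.twistedCoeff χ (m * n) = F.twistedCoeff χ m * F.twistedCoeff χ n := by
  simp only [twistedCoeff, F.coeff_mul_of_coprime h, Nat.cast_mul, map_mul]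
  ring

/-- The Euler product in logarithmic form. -/
theorem RamanujanBound.exp_primeSeries_add_logRemainder (hA : F.RamanujanBound) {s : ℂ}
    (hs : 1 < s.re) (hsum : LSeriesSummable (F.twistedCoeff χ) s) :
    Complex.exp (F.primeSeries χ s + F.logRemainder χ s) = LSeries (F.twistedCoeff χ) s := by
  have hs0 : s ≠ 0 := fun h ↦ by simp [h] at hs; linarith
  set f : ℕ → ℂ := LSeries.term (F.twistedCoeff χ) s with hf
  have hf' : ∀ n, f n = F.twistedCoeff χ n * (n : ℂ) ^ (-s) := by
    intro n
    rcases eq_or_ne n 0 with rfl | hn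
    · simp [hf, twistedCoeff, coeff_zero]
    · rw [hf, LSeries.term_of_ne_zero hn, Complex.cpow_neg, div_eq_mul_inv]
  have hprod := EulerProduct.eulerProduct_hasProd (f := f)
    (by simp [hf', twistedCoeff, coeff_one])
    (by
      intro m n h
      rw [hf', hf', hf', twistedCoeff_mul_of_coprime χ h, Nat.cast_mul,
        Complex.natCast_mul_natCast_cpow]
      ring) hsum.norm (by simp [hf])
  have hlocal : ∀ p : Nat.Primes, ∑' e, f ((p : ℕ) ^ e) =
      Complex.exp (∑ j, Complex.log (1 - F.twistedParam χ p j * ((p : ℕ) : ℂ) ^ (-s))⁻¹) := by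
    intro p
    set x := χ ((p : ℕ) : ZMod q) * ((p : ℕ) : ℂ) ^ (-s) with hx
    have hx1 : ‖x‖ < 1 := by
      rw [hx, norm_mul, norm_natCast_prime_cpow_neg]
      have h2 := χ.norm_le_one ((p : ℕ) : ZMod q)
      have h3 := prime_rpow_neg_le (by linarith : 9 / 10 ≤ s.re) p
      have h4 : 0 ≤ ((p : ℕ) : ℝ) ^ (-s.re) := by positivity
      nlinarith [norm_nonneg (χ ((p : ℕ) : ZMod q))]
    have h1 : ∀ e, f ((p : ℕ) ^ e) = F.localCoeff p e * x ^ e := by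
      intro e
      rw [hf', twistedCoeff, F.coeff_prime_pow p.2, hx, Nat.cast_pow, Nat.cast_pow, map_pow,
        mul_pow, ← Complex.cpow_nat_mul, ← Complex.natCast_cpow_natCast_mul, mul_assoc]
    simp_rw [h1]
    have h2 := F.prod_one_sub_mul_tsum_localCoeff p (hA.summable_localCoeff p.2 hx1)
    have h3 : ∀ j, 1 - F.α p j * x = 1 - F.twistedParam χ p j * ((p : ℕ) : ℂ) ^ (-s) := by
      intro j
      rw [hx, twistedParam]
      ring
    simp_rw [h3] at h2
    have h4 : ∀ j, 1 - F.twistedParam χ p j * ((p : ℕ) : ℂ) ^ (-s) ≠ 0 := fun j hj ↦ by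
      rw [Finset.prod_eq_zero (Finset.mem_univ j) hj, zero_mul] at h2
      exact zero_ne_one h2
    rw [Complex.exp_sum]
    simp_rw [Complex.exp_log (inv_ne_zero (h4 _))]
    rw [Finset.prod_inv_distrib]
    exact (eq_inv_of_mul_eq_one_right h2)
  have hE : HasSum (fun p : Nat.Primes ↦
      ∑ j, (Complex.log (1 - F.twistedParam χ p j * ((p : ℕ) : ℂ) ^ (-s))⁻¹ -
      F.twistedParam χ p j * ((p : ℕ) : ℂ) ^ (-s))) (F.logRemainder χ s) :=
    (Summable.of_norm_bounded (summable_logRemainder_majorant d)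
      fun p ↦ hA.norm_logRemainder_term_le χ (by linarith) p).hasSum
  have hP := (hA.summable_primeSeries χ hs).hasSum
  have hPE := (hP.add hE).cexp
  have hcongr : (Complex.exp ∘ fun p : Nat.Primes ↦
      F.coeff p * χ ((p : ℕ) : ZMod q) * ((p : ℕ) : ℂ) ^ (-s) +
      ∑ j, (Complex.log (1 - F.twistedParam χ p j * ((p : ℕ) : ℂ) ^ (-s))⁻¹ -
      F.twistedParam χ p j * ((p : ℕ) : ℂ) ^ (-s))) = fun p : Nat.Primes ↦ ∑' e, f ((p : ℕ) ^ e) := by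
    funext p
    rw [hlocal, Function.comp_apply, Finset.sum_sub_distrib]
    congr 1
    have : F.coeff p * χ ((p : ℕ) : ZMod q) * ((p : ℕ) : ℂ) ^ (-s) =
        ∑ j, F.twistedParam χ p j * ((p : ℕ) : ℂ) ^ (-s) := by
      rw [F.coeff_prime p.2, ← Finset.sum_mul, Finset.sum_mul]
      rfl
    rw [this]
    ring
  rw [hcongr] at hPE
  exact hPE.unique hprod

end LData

/-! ### Bounds for the Gamma function -/

theorem Complex.norm_sin_le_exp_abs_im (w : ℂ) : ‖Complex.sin w‖ ≤ Real.exp |w.im| := by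
  rw [Complex.sin, norm_div, norm_mul, Complex.norm_I, mul_one, Complex.norm_ofNat]
  rw [div_le_iff₀ (by norm_num)]
  refine (norm_sub_le _ _).trans ?_
  rw [Complex.norm_exp, Complex.norm_exp]
  have h1 : (-w * Complex.I).re = w.im := by simp
  have h2 : (w * Complex.I).re = -w.im := by simp
  rw [h1, h2]
  have h3 : Real.exp w.im ≤ Real.exp |w.im| := Real.exp_le_exp.2 (le_abs_self _)
  have h4 : Real.exp (-w.im) ≤ Real.exp |w.im| := Real.exp_le_exp.2 (neg_le_abs _)
  linarith

theorem Complex.norm_Gamma_le {s : ℂ} (hs : 0 < s.re) : ‖Complex.Gamma s‖ ≤ Real.Gamma s.re := by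
  rw [Complex.Gamma_eq_integral hs, Real.Gamma_eq_integral hs, Complex.GammaIntegral]
  refine (MeasureTheory.norm_integral_le_integral_norm _).trans (le_of_eq ?_)
  refine MeasureTheory.setIntegral_congr_fun measurableSet_Ioi fun x hx ↦ ?_
  have hx' : 0 < x := hx
  rw [norm_mul, Complex.norm_cpow_eq_rpow_re_of_pos hx', Complex.norm_real,
    Real.norm_of_nonneg (Real.exp_pos _).le]
  simp

theorem Real.exists_Gamma_le {a : ℝ} (ha : 0 < a) (b : ℝ) :
    ∃ C : ℝ, 0 < C ∧ ∀ x : ℝ, a ≤ x → x ≤ b → Real.Gamma x ≤ C := by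
  have hcont : ContinuousOn Real.Gamma (Set.Icc a b) :=
    Real.differentiableOn_Gamma_Ioi.continuousOn.mono fun x hx ↦ lt_of_lt_of_le ha hx.1
  obtain ⟨C, hC⟩ := isCompact_Icc.exists_bound_of_continuousOn hcont
  refine ⟨|C| + 1, by positivity, fun x h1 h2 ↦ ?_⟩
  have h3 := hC x ⟨h1, h2⟩
  rw [Real.norm_eq_abs] at h3
  linarith [le_abs_self (Real.Gamma x), le_abs_self C]

/-- By the recursion `Γ(w + 1) = w Γ(w)`, shifting to the right increases `|Γ|` away from the real axis. -/
theorem Complex.norm_Gamma_le_norm_Gamma_add_natCast {w : ℂ} (hw : 1 ≤ |w.im|) (k : ℕ) :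
    ‖Complex.Gamma w‖ ≤ ‖Complex.Gamma (w + k)‖ := by
  induction k with
  | zero => simp
  | succ k ih =>
    have h1 : 1 ≤ ‖w + k‖ := by
      refine le_trans ?_ (Complex.abs_im_le_norm _)
      simpa using hw
    have h0 : w + k ≠ 0 := fun h ↦ by simp [h] at h1; linarith
    rw [Nat.cast_succ, ← add_assoc, Complex.Gamma_add_one _ h0, norm_mul]
    nlinarith [norm_nonneg (Complex.Gamma (w + k))]

theorem Complex.norm_pi_cpow (s : ℂ) : ‖(Real.pi : ℂ) ^ s‖ = Real.pi ^ s.re :=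
  Complex.norm_cpow_eq_rpow_re_of_pos Real.pi_pos s

theorem exists_pi_rpow_le (a b : ℝ) :
    ∃ C : ℝ, 0 < C ∧ ∀ x : ℝ, a ≤ x → x ≤ b → Real.pi ^ x ≤ C := by
  refine ⟨Real.pi ^ b, by positivity, fun x _ h2 ↦ ?_⟩
  exact Real.rpow_le_rpow_of_exponent_le (by linarith [Real.pi_gt_three]) h2

theorem Complex.exists_norm_Gammaℝ_le {a : ℝ} (ha : 0 < a) (b : ℝ) :
    ∃ C : ℝ, 0 < C ∧ ∀ s : ℂ, a ≤ s.re → s.re ≤ b → ‖Complex.Gammaℝ s‖ ≤ C := by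
  obtain ⟨C₁, hC₁, h₁⟩ := exists_pi_rpow_le (-b / 2) (-a / 2)
  obtain ⟨C₂, hC₂, h₂⟩ := Real.exists_Gamma_le (half_pos ha) (b / 2)
  refine ⟨C₁ * C₂, by positivity, fun s h3 h4 ↦ ?_⟩
  have hre : (s / 2).re = s.re / 2 := by simp
  rw [Complex.Gammaℝ_def, norm_mul, Complex.norm_pi_cpow]
  have h5 : (-s / 2).re = -s.re / 2 := by simp
  refine mul_le_mul (h₁ _ (by rw [h5]; linarith) (by rw [h5]; linarith)) ?_ (norm_nonneg _) hC₁.le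
  refine (Complex.norm_Gamma_le (by rw [hre]; linarith)).trans ?_
  rw [hre]
  exact h₂ _ (by linarith) (by linarith)

/-- In vertical strips `1 / Γ_ℝ` grows at most exponentially: by Euler's reflection formula it is a
Gamma value times a sine. -/
theorem Complex.exists_norm_inv_Gammaℝ_le (a b : ℝ) :
    ∃ C : ℝ, 0 < C ∧ ∀ s : ℂ, a ≤ s.re → s.re ≤ b →
      ‖(Complex.Gammaℝ s)⁻¹‖ ≤ C * Real.exp (2 * |s.im|) := by
  obtain ⟨C₁, hC₁, h₁⟩ := exists_pi_rpow_le (a / 2) (b / 2)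
  obtain ⟨k, hk⟩ := exists_nat_gt (b / 2)
  obtain ⟨C₂, hC₂, h₂⟩ := Real.exists_Gamma_le (a := 1 - b / 2 + k) (by linarith) (1 - a / 2 + k)
  have hcomp : IsCompact (Set.Icc a b ×ℂ Set.Icc (-2) 2) := isCompact_Icc.reProdIm isCompact_Icc
  obtain ⟨C₃, hC₃⟩ := hcomp.exists_bound_of_continuousOn
    (Complex.differentiable_Gammaℝ_inv.continuous.continuousOn)
  refine ⟨C₁ * C₂ + |C₃|, by positivity, fun s h3 h4 ↦ ?_⟩
  rcases le_or_gt |s.im| 2 with h5 | h5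
  · have h6 := hC₃ s ⟨⟨h3, h4⟩, abs_le.1 h5⟩
    have h7 : 1 ≤ Real.exp (2 * |s.im|) := Real.one_le_exp (by positivity)
    have h8 : 0 < C₁ * C₂ := by positivity
    calc _ ≤ C₃ := h6
      _ ≤ (C₁ * C₂ + |C₃|) * 1 := by linarith [le_abs_self C₃]
      _ ≤ _ := by gcongr
  · set z := s / 2 with hz
    have hzim : z.im = s.im / 2 := by simp [hz]
    have hzre : z.re = s.re / 2 := by simp [hz]
    have him : 1 ≤ |(1 - z).im| := by
      rw [Complex.sub_im, Complex.one_im, zero_sub, abs_neg, hzim, abs_div, abs_two]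
      linarith
    have hΓ : ‖Complex.Gamma (1 - z)‖ ≤ C₂ := by
      refine (Complex.norm_Gamma_le_norm_Gamma_add_natCast him k).trans ?_
      have hre : (1 - z + k).re = 1 - s.re / 2 + k := by simp [hzre]
      refine (Complex.norm_Gamma_le (by rw [hre]; linarith)).trans ?_
      rw [hre]
      exact h₂ _ (by linarith) (by linarith)
    have hne : ∀ w : ℂ, w.im ≠ 0 → Complex.Gamma w ≠ 0 := fun w hw ↦
      Complex.Gamma_ne_zero fun m hm ↦ hw (by rw [hm]; simp)
    have him0 : z.im ≠ 0 := by
      rw [hzim]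
      intro h
      have : s.im = 0 := by linarith
      rw [this] at h5
      norm_num at h5
    have hG1 := hne z him0
    have hG2 := hne (1 - z) (by simpa using him0)
    have hrefl := Complex.Gamma_mul_Gamma_one_sub z
    have hsin : Complex.sin (Real.pi * z) ≠ 0 := fun h ↦ by
      rw [h, div_zero] at hrefl
      exact mul_ne_zero hG1 hG2 hrefl
    -- Reflection: `1 / Γ(z) = Γ(1 - z) sin(π z) / π`.
    have hinv : (Complex.Gamma z)⁻¹ =
        Complex.Gamma (1 - z) * Complex.sin (Real.pi * z) / Real.pi := by
      have hpi : (Real.pi : ℂ) ≠ 0 := by exact_mod_cast Real.pi_ne_zero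
      rw [eq_div_iff hsin] at hrefl
      rw [eq_div_iff hpi, inv_mul_eq_iff_eq_mul₀ hG1, ← mul_assoc, hrefl]
    have hsinle : ‖Complex.sin (Real.pi * z)‖ ≤ Real.exp (2 * |s.im|) := by
      refine (Complex.norm_sin_le_exp_abs_im _).trans (Real.exp_le_exp.2 ?_)
      rw [Complex.im_ofReal_mul, hzim, abs_mul, abs_of_pos Real.pi_pos, abs_div, abs_two]
      nlinarith [Real.pi_lt_four, abs_nonneg s.im]
    rw [Complex.Gammaℝ_def, mul_inv, ← Complex.cpow_neg, norm_mul, Complex.norm_pi_cpow, ← hz, hinv,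
      norm_div, norm_mul, Complex.norm_real, Real.norm_of_nonneg Real.pi_pos.le]
    have h6 : (-(-s / 2)).re = s.re / 2 := by
      rw [neg_div, neg_neg]
      simp
    rw [h6]
    have h7 : Real.pi ^ (s.re / 2) ≤ C₁ := h₁ _ (by linarith) (by linarith)
    calc Real.pi ^ (s.re / 2) *
          (‖Complex.Gamma (1 - z)‖ * ‖Complex.sin (Real.pi * z)‖ / Real.pi)
        ≤ C₁ * (C₂ * Real.exp (2 * |s.im|) / 1) := by
          gcongr
          linarith [Real.pi_gt_three]
      _ ≤ _ := by
          rw [div_one, ← mul_assoc]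
          gcongr
          linarith [abs_nonneg C₃]

/-! ### Completed and uncompleted L-functions: functional equation and growth -/

namespace LData

variable {d : ℕ} {F : LData d} {q : ℕ} {χ : DirichletCharacter ℂ q}

/-- The product of the `Γ_ℝ`-factors at infinity, without the conductor; `ε` stands for `χ(-1)`. -/
noncomputable def gammaInf (F : LData d) (ε s : ℂ) : ℂ := ∏ j, Complex.Gammaℝ (s + F.μ ε j)

theorem gammaFactor_eq (s : ℂ) :
    F.gammaFactor χ s = (F.N q : ℂ) ^ (s / 2) * F.gammaInf (χ (-1)) s := rfl

theorem Axioms.isEntireExtension (hF : F.Axioms) (hq : 2 ≤ q) (hχ : χ.IsPrimitive) :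
    F.IsEntireExtension χ (F.completedL χ) := by
  obtain ⟨g, hg, -⟩ := hF.entire q χ hq hχ
  exact F.completedL_spec χ ⟨g, hg⟩

theorem Axioms.isEntireOfOrder (hF : F.Axioms) (hq : 2 ≤ q) (hχ : χ.IsPrimitive) :
    IsEntireOfOrder (F.completedL χ) 1 := by
  obtain ⟨g, hg, hg1⟩ := hF.entire q χ hq hχ
  rwa [F.completedL_eq χ hg]

theorem twistedCoeff_dual (n : ℕ) :
    F.dual.twistedCoeff χ⁻¹ n = conj (F.twistedCoeff χ n) := by
  rw [twistedCoeff, twistedCoeff, coeff_dual, map_mul, ← MulChar.star_eq_inv, MulChar.star_apply,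
    Complex.star_def]

theorem inv_apply_neg_one : χ⁻¹ (-1) = χ (-1) := by
  rw [MulChar.inv_apply]
  congr 1
  have h := Ring.inverse_unit (-1 : (ZMod q)ˣ)
  simpa using h

theorem LSeries_dual (s : ℂ) :
    LSeries (F.dual.twistedCoeff χ⁻¹) s = conj (LSeries (F.twistedCoeff χ) (conj s)) := by
  rw [LSeries, LSeries, Complex.conj_tsum]
  refine tsum_congr fun n ↦ ?_
  rcases eq_or_ne n 0 with rfl | hn
  · simp
  rw [LSeries.term_of_ne_zero hn, LSeries.term_of_ne_zero hn, twistedCoeff_dual, map_div₀,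
    ← Complex.conj_cpow _ _ (by rw [Complex.natCast_arg]; exact Real.pi_ne_zero.symm),
    Complex.conj_natCast]

theorem _root_.Complex.Gammaℝ_conj (s : ℂ) : Complex.Gammaℝ (conj s) = conj (Complex.Gammaℝ s) := by
  rw [Complex.Gammaℝ_def, Complex.Gammaℝ_def, map_mul, ← Complex.Gamma_conj, map_div₀,
    Complex.conj_ofNat]
  congr 1
  have h := Complex.conj_cpow (Real.pi : ℂ) (-conj s / 2)
    (by rw [Complex.arg_ofReal_of_nonneg Real.pi_pos.le]; exact Real.pi_ne_zero.symm)
  rw [Complex.conj_ofReal] at h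
  rw [h]
  simp [Complex.conj_ofNat]

theorem gammaFactor_dual (hN : 0 < F.N q) (s : ℂ) :
    F.dual.gammaFactor χ⁻¹ s = conj (F.gammaFactor χ (conj s)) := by
  rw [gammaFactor, gammaFactor, map_mul, map_prod]
  congr 1
  · have h := Complex.conj_cpow (F.N q : ℂ) (s / 2)
      (by rw [Complex.arg_ofReal_of_nonneg hN.le]; exact Real.pi_ne_zero.symm)
    rw [Complex.conj_ofReal] at h
    simpa [dual, Complex.conj_ofNat] using h
  · refine Finset.prod_congr rfl fun j _ ↦ ?_
    rw [← Complex.Gammaℝ_conj, inv_apply_neg_one]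
    simp [dual]

theorem Axioms.completedL_dual (hF : F.Axioms) (hq : 2 ≤ q) (hχ : χ.IsPrimitive) (s : ℂ) :
    F.dual.completedL χ⁻¹ s = conj (F.completedL χ (conj s)) := by
  have hext := hF.isEntireExtension hq hχ
  have h : F.dual.IsEntireExtension χ⁻¹ (fun s ↦ conj (F.completedL χ (conj s))) := by
    refine ⟨fun z ↦ ?_, fun s hs ↦ ?_⟩
    · have := (hext.1 (conj z)).conj_conj
      rw [Complex.conj_conj] at this
      exact this
    · beta_reduce
      rw [hext.2 _ (by simpa using hs), LSeries_dual, gammaFactor_dual (hF.conductor_pos q hq),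
        map_mul]
  rw [F.dual.completedL_eq χ⁻¹ h]

/-- The functional equation, with the dual written through complex conjugation. -/
theorem Axioms.exists_completedL_eq_conj (hF : F.Axioms) (hq : 2 ≤ q) (hχ : χ.IsPrimitive) :
    ∃ κ : ℂ, ‖κ‖ = 1 ∧ ∀ s, F.completedL χ s = κ * conj (F.completedL χ (1 - conj s)) := by
  obtain ⟨κ, hκ, h⟩ := hF.functional_equation q χ hq hχ
  refine ⟨κ, hκ, fun s ↦ ?_⟩
  rw [h s, hF.completedL_dual hq hχ]
  simp

theorem norm_twistedCoeff_le (n : ℕ) : ‖F.twistedCoeff χ n‖ ≤ ‖F.coeff n‖ := by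
  rw [twistedCoeff, norm_mul]
  exact mul_le_of_le_one_right (norm_nonneg _) (χ.norm_le_one _)

theorem norm_term_twistedCoeff_le (s : ℂ) (n : ℕ) :
    ‖LSeries.term (F.twistedCoeff χ) s n‖ ≤ ‖LSeries.term F.coeff (s.re : ℂ) n‖ := by
  rw [LSeries.norm_term_eq, LSeries.norm_term_eq, Complex.ofReal_re]
  split_ifs
  · exact le_rfl
  · gcongr
    exact norm_twistedCoeff_le n

theorem Axioms.norm_LSeries_le (hF : F.Axioms) {s : ℂ} (hs : 1 < s.re) :
    ‖LSeries (F.twistedCoeff χ) s‖ ≤ ∑' n, ‖LSeries.term F.coeff (s.re : ℂ) n‖ :=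
  tsum_of_norm_bounded (hF.summable (s.re : ℂ) (by simpa using hs)).norm.hasSum
    fun n ↦ norm_term_twistedCoeff_le s n

theorem exists_norm_gammaInf_le (F : LData d) (ε : ℂ) {a : ℝ} (ha : ∀ j, 0 < a + (F.μ ε j).re)
    (b : ℝ) :
    ∃ C : ℝ, 0 < C ∧ ∀ s : ℂ, a ≤ s.re → s.re ≤ b → ‖F.gammaInf ε s‖ ≤ C := by
  choose C hC h using fun j ↦ Complex.exists_norm_Gammaℝ_le (ha j) (b + (F.μ ε j).re)
  refine ⟨∏ j, C j, Finset.prod_pos fun j _ ↦ hC j, fun s h1 h2 ↦ ?_⟩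
  rw [gammaInf, norm_prod]
  refine Finset.prod_le_prod (fun _ _ ↦ norm_nonneg _) fun j _ ↦ h j _ ?_ ?_
  · rw [Complex.add_re]; linarith
  · rw [Complex.add_re]; linarith

theorem exists_norm_inv_gammaInf_le (F : LData d) (ε : ℂ) (a b : ℝ) :
    ∃ C : ℝ, 0 < C ∧ ∀ s : ℂ, a ≤ s.re → s.re ≤ b →
      ‖(F.gammaInf ε s)⁻¹‖ ≤ C * Real.exp (2 * d * |s.im|) := by
  choose C hC h using fun j ↦
    Complex.exists_norm_inv_Gammaℝ_le (a + (F.μ ε j).re) (b + (F.μ ε j).re)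
  refine ⟨∏ j, (C j * Real.exp (2 * |(F.μ ε j).im|)),
    Finset.prod_pos fun j _ ↦ mul_pos (hC j) (Real.exp_pos _), fun s h1 h2 ↦ ?_⟩
  rw [gammaInf, ← Finset.prod_inv_distrib, norm_prod]
  have h3 : Real.exp (2 * d * |s.im|) = ∏ _j : Fin d, Real.exp (2 * |s.im|) := by
    rw [Finset.prod_const, Finset.card_univ, Fintype.card_fin, ← Real.exp_nat_mul]
    congr 1
    ring
  rw [h3, ← Finset.prod_mul_distrib]
  refine Finset.prod_le_prod (fun _ _ ↦ norm_nonneg _) fun j _ ↦ ?_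
  refine (h j (s + F.μ ε j) (by rw [Complex.add_re]; linarith)
    (by rw [Complex.add_re]; linarith)).trans ?_
  rw [mul_assoc, ← Real.exp_add]
  have := hC j
  gcongr
  rw [Complex.add_im]
  linarith [abs_add_le s.im (F.μ ε j).im]

/-- The conductor-normalised completed `L`-function `Λ(s) N^{-s/2}`. -/
noncomputable def normalizedL (F : LData d) {q : ℕ} (χ : DirichletCharacter ℂ q) (s : ℂ) : ℂ :=
  F.completedL χ s * (F.N q : ℂ) ^ (-(s / 2))

theorem norm_conductor_cpow (hN : 0 < F.N q) (s : ℂ) :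
    ‖(F.N q : ℂ) ^ s‖ = F.N q ^ s.re :=
  Complex.norm_cpow_eq_rpow_re_of_pos hN s

theorem L_eq_normalizedL_div (s : ℂ) :
    F.L χ s = F.normalizedL χ s * (F.gammaInf (χ (-1)) s)⁻¹ := by
  rw [L, gammaFactor_eq, normalizedL, Complex.cpow_neg, div_eq_mul_inv, mul_inv, mul_assoc]

theorem differentiable_conductor_cpow (hN : 0 < F.N q) :
    Differentiable ℂ fun s : ℂ ↦ (F.N q : ℂ) ^ (-(s / 2)) :=
  (differentiable_id.div_const 2).neg.const_cpow (Or.inl (by exact_mod_cast hN.ne'))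

theorem Axioms.differentiable_normalizedL (hF : F.Axioms) (hq : 2 ≤ q) (hχ : χ.IsPrimitive) :
    Differentiable ℂ (F.normalizedL χ) :=
  (hF.isEntireExtension hq hχ).1.mul (differentiable_conductor_cpow (hF.conductor_pos q hq))

theorem Axioms.differentiable_L (hF : F.Axioms) (hq : 2 ≤ q) (hχ : χ.IsPrimitive) :
    Differentiable ℂ (F.L χ) := by
  have h : F.L χ = fun s ↦ F.normalizedL χ s * ∏ j, (Complex.Gammaℝ (s + F.μ (χ (-1)) j))⁻¹ := by
    funext s
    rw [L_eq_normalizedL_div, gammaInf, Finset.prod_inv_distrib]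
  rw [h]
  refine (hF.differentiable_normalizedL hq hχ).mul (Differentiable.fun_finsetProd fun j _ ↦ ?_)
  exact Complex.differentiable_Gammaℝ_inv.comp (differentiable_id.add_const _)

theorem Axioms.norm_completedL_one_sub_conj (hF : F.Axioms) (hq : 2 ≤ q) (hχ : χ.IsPrimitive)
    (s : ℂ) : ‖F.completedL χ s‖ = ‖F.completedL χ (1 - conj s)‖ := by
  obtain ⟨κ, hκ, h⟩ := hF.exists_completedL_eq_conj hq hχ
  rw [h s, norm_mul, hκ, one_mul, RCLike.norm_conj]

/-- In a vertical strip, `exp (|s|²)` is dominated by a double exponential with a small rate. -/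
theorem isBigO_exp_normSq_strip {a b : ℝ} :
    (fun s : ℂ ↦ Real.exp (‖s‖ ^ (2 : ℝ))) =O[comap (_root_.abs ∘ Complex.im) atTop ⊓
      𝓟 (Complex.re ⁻¹' Set.Ioo a b)]
      fun s ↦ Real.exp ((2 * (|a| + |b|) ^ 2 + 16) * Real.exp (1 / 2 * |s.im|)) := by
  refine Asymptotics.IsBigO.of_bound 1 ?_
  refine Filter.eventually_inf_principal.2 (Eventually.of_forall fun s hs ↦ ?_)
  rw [one_mul, Real.norm_of_nonneg (Real.exp_pos _).le, Real.norm_of_nonneg (Real.exp_pos _).le,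
    Real.exp_le_exp]
  have h1 : |s.re| ≤ |a| + |b| := by
    have h2 := hs.1
    have h3 := hs.2
    rw [abs_le]
    constructor
    · linarith [neg_abs_le a, abs_nonneg b]
    · linarith [le_abs_self b, abs_nonneg a]
  have h4 : ‖s‖ ^ (2 : ℝ) = s.re ^ 2 + s.im ^ 2 := by
    rw [Real.rpow_two, Complex.sq_norm, Complex.normSq_apply]
    ring
  have h5 : 1 ≤ Real.exp (1 / 2 * |s.im|) := Real.one_le_exp (by positivity)
  have h6 : (1 / 2 * |s.im|) ^ 2 / 2 ≤ Real.exp (1 / 2 * |s.im|) := by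
    have := Real.quadratic_le_exp_of_nonneg (x := 1 / 2 * |s.im|) (by positivity)
    linarith [abs_nonneg s.im]
  have h7 : s.re ^ 2 ≤ (|a| + |b|) ^ 2 := by
    rw [← sq_abs s.re]
    gcongr
  have h8 : s.im ^ 2 = |s.im| ^ 2 := (sq_abs _).symm
  rw [h4, h8]
  have h9 : 0 ≤ (|a| + |b|) ^ 2 := by positivity
  nlinarith

theorem comap_abs_im_le_cocompact : comap (_root_.abs ∘ Complex.im) atTop ≤ cocompact ℂ := by
  rw [← Metric.cobounded_eq_cocompact, ← comap_norm_atTop, ← tendsto_iff_comap]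
  exact tendsto_atTop_mono (fun s ↦ Complex.abs_im_le_norm s) tendsto_comap

/-- Convexity: the Phragmén-Lindelöf principle and the functional equation bound `Λ(s) N^{-s/2}` in a
strip by its values in the half plane of absolute convergence. -/
theorem Axioms.exists_norm_normalizedL_le (hF : F.Axioms) (ε : ℂ) :
    ∃ C : ℝ, 0 < C ∧ ∀ (q : ℕ) (χ : DirichletCharacter ℂ q), 2 ≤ q → χ.IsPrimitive → χ (-1) = ε →
      ∀ s : ℂ, -2 ≤ s.re → s.re ≤ 3 → ‖F.normalizedL χ s‖ ≤ C * (1 + F.N q) ^ 3 := by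
  by_cases hex : ∃ (q : ℕ) (χ : DirichletCharacter ℂ q), 2 ≤ q ∧ χ.IsPrimitive ∧ χ (-1) = ε
  swap
  · exact ⟨1, one_pos, fun q χ h1 h2 h3 ↦ (hex ⟨q, χ, h1, h2, h3⟩).elim⟩
  have hμ : ∀ j, 0 < 3 + (F.μ ε j).re := by
    obtain ⟨q, χ, h1, h2, h3⟩ := hex
    obtain ⟨θ, hθ, -, h⟩ := hF.param_infinity
    intro j
    have h4 := h q χ h1 h2 j
    rw [h3] at h4
    have : 0 ≤ 1 / (2 * (d : ℝ)) := by positivity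
    linarith
  obtain ⟨C₁, hC₁, hγ⟩ := exists_norm_gammaInf_le F ε hμ 3
  set C₂ := ∑' n, ‖LSeries.term F.coeff ((3 : ℝ) : ℂ) n‖ with hC₂
  have hC₂0 : 0 ≤ C₂ := tsum_nonneg fun n ↦ norm_nonneg _
  refine ⟨C₁ * (C₂ + 1), by positivity, fun q χ hq hχ hε s hs1 hs2 ↦ ?_⟩
  have hN := hF.conductor_pos q hq
  have hent := hF.isEntireOfOrder hq hχ
  -- On `Re z = 3` the Dirichlet series converges; on `Re z = -2` the functional equation reflects to it.
  have h3 : ∀ z : ℂ, z.re = 3 → ‖F.completedL χ z‖ ≤ F.N q ^ (3 / 2 : ℝ) * (C₁ * (C₂ + 1)) := by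
    intro z hz
    rw [(hF.isEntireExtension hq hχ).2 z (by rw [hz]; norm_num), norm_mul, gammaFactor_eq, norm_mul,
      norm_conductor_cpow hN, hε]
    have h4 := hF.norm_LSeries_le (χ := χ) (s := z) (by rw [hz]; norm_num)
    rw [hz] at h4
    have h5 := hγ z hz.ge hz.le
    have h6 : (z / 2).re = 3 / 2 := by simp [hz]
    rw [h6]
    calc _ ≤ C₂ * (F.N q ^ (3 / 2 : ℝ) * C₁) := by gcongr
      _ = F.N q ^ (3 / 2 : ℝ) * (C₁ * C₂) := by ring
      _ ≤ _ := by gcongr; linarith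
  have hNle : ∀ r : ℝ, 0 ≤ r → r ≤ 3 → F.N q ^ r ≤ (1 + F.N q) ^ 3 := by
    intro r hr0 hr
    calc F.N q ^ r ≤ (1 + F.N q) ^ r := Real.rpow_le_rpow hN.le (by linarith) hr0
      _ ≤ (1 + F.N q) ^ (3 : ℝ) := Real.rpow_le_rpow_of_exponent_le (by linarith) hr
      _ = (1 + F.N q) ^ 3 := by norm_cast
  have hbd : ∀ z : ℂ, z.re ≤ 3 → ∀ r : ℝ, 0 ≤ r → r ≤ 3 → 3 / 2 - z.re / 2 = r →
      ‖F.completedL χ z‖ ≤ F.N q ^ (3 / 2 : ℝ) * (C₁ * (C₂ + 1)) →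
      ‖F.normalizedL χ z‖ ≤ C₁ * (C₂ + 1) * (1 + F.N q) ^ 3 := by
    intro z hz r hr0 hr hzr h
    have h6 : (-(z / 2)).re = -(z.re / 2) := by simp
    rw [normalizedL, norm_mul, norm_conductor_cpow hN, h6]
    calc _ ≤ F.N q ^ (3 / 2 : ℝ) * (C₁ * (C₂ + 1)) * F.N q ^ (-(z.re / 2)) := by gcongr
      _ = C₁ * (C₂ + 1) * F.N q ^ r := by
          rw [mul_comm, ← mul_assoc, ← Real.rpow_add hN, mul_comm, ← hzr]
          congr 2
          ring
      _ ≤ _ := by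
          gcongr
          exact hNle r hr0 hr
  -- The strip has width `5`, and `1/2 < π/5`; the order of growth `1` of `Λ` gives `exp (|s|²)`.
  refine PhragmenLindelof.vertical_strip (f := F.normalizedL χ) (a := -2) (b := 3)
    (hF.differentiable_normalizedL hq hχ).diffContOnCl ?_ ?_ ?_ hs1 hs2
  · refine ⟨1 / 2, ?_, 2 * (|(-2 : ℝ)| + |3|) ^ 2 + 16, ?_⟩
    · rw [lt_div_iff₀ (by norm_num)]
      linarith [Real.pi_gt_three]
    · have h4 : F.completedL χ =O[comap (_root_.abs ∘ Complex.im) atTop ⊓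
          𝓟 (Complex.re ⁻¹' Set.Ioo (-2) 3)] fun s ↦ Real.exp (‖s‖ ^ (2 : ℝ)) :=
        (hent.2.1 2 (by norm_num)).mono (inf_le_left.trans comap_abs_im_le_cocompact)
      have h5 : (fun s : ℂ ↦ (F.N q : ℂ) ^ (-(s / 2))) =O[comap (_root_.abs ∘ Complex.im) atTop ⊓
          𝓟 (Complex.re ⁻¹' Set.Ioo (-2) 3)] fun _ ↦ (1 : ℝ) := by
        refine Asymptotics.IsBigO.of_bound (max (F.N q ^ (1 : ℝ)) (F.N q ^ (-(3 / 2) : ℝ))) ?_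
        refine Filter.eventually_inf_principal.2 (Eventually.of_forall fun z hz ↦ ?_)
        have h6 : (-(z / 2)).re = -(z.re / 2) := by simp
        have hz1 : -2 < z.re := hz.1
        have hz2 : z.re < 3 := hz.2
        rw [norm_conductor_cpow hN, h6, norm_one, mul_one]
        rcases le_total 1 (F.N q) with h | h
        · exact le_max_of_le_left (Real.rpow_le_rpow_of_exponent_le h (by linarith))
        · exact le_max_of_le_right (Real.rpow_le_rpow_of_exponent_ge hN h (by linarith))
      have h7 := (h4.trans isBigO_exp_normSq_strip).mul h5
      simp only [mul_one] at h7
      exact h7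
  · intro z hz
    refine hbd z (by rw [hz]; norm_num) (5 / 2) (by norm_num) (by norm_num)
      (by rw [hz]; norm_num) ?_
    rw [hF.norm_completedL_one_sub_conj hq hχ]
    exact h3 _ (by simp [hz]; norm_num)
  · intro z hz
    exact hbd z hz.le 0 le_rfl (by norm_num) (by rw [hz]; norm_num) (h3 z hz)

/-- The bound is far from sharp; a bound by powers of the conductor that is at most exponential in `Im s` is
enough for the Borel-Carathéodory theorem. -/
theorem Axioms.exists_norm_L_le (hF : F.Axioms) (ε : ℂ) :
    ∃ C : ℝ, 0 < C ∧ ∀ (q : ℕ) (χ : DirichletCharacter ℂ q), 2 ≤ q → χ.IsPrimitive → χ (-1) = ε →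
      ∀ s : ℂ, 0 ≤ s.re → s.re ≤ 2 →
        ‖F.L χ s‖ ≤ C * (1 + F.N q) ^ 3 * Real.exp (2 * d * |s.im|) := by
  obtain ⟨C₁, hC₁, h₁⟩ := hF.exists_norm_normalizedL_le ε
  obtain ⟨C₂, hC₂, h₂⟩ := exists_norm_inv_gammaInf_le F ε 0 2
  refine ⟨C₁ * C₂, by positivity, fun q χ hq hχ hε s hs1 hs2 ↦ ?_⟩
  have hN := hF.conductor_pos q hq
  rw [L_eq_normalizedL_div, norm_mul, hε]
  calc _ ≤ C₁ * (1 + F.N q) ^ 3 * (C₂ * Real.exp (2 * d * |s.im|)) :=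
        mul_le_mul (h₁ q χ hq hχ hε s (by linarith) (by linarith)) (h₂ s hs1 hs2) (norm_nonneg _)
          (by positivity)
    _ = _ := by ring

end LData

/-! ### The prime sum inside a zero free region -/

/-- A continuous branch of the logarithm of a holomorphic function is holomorphic. -/
theorem DifferentiableAt.of_continuousAt_exp {f g : ℂ → ℂ} {z : ℂ} (hf : ContinuousAt f z)
    (hg : DifferentiableAt ℂ g z) (hfg : ∀ᶠ w in 𝓝 z, Complex.exp (f w) = g w) :
    DifferentiableAt ℂ f z := by
  have hgz : g z ≠ 0 := by
    rw [← hfg.self_of_nhds]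
    exact Complex.exp_ne_zero _
  have h1 : ∀ᶠ w in 𝓝 z, ‖f w - f z‖ < 1 := by
    have := Metric.tendsto_nhds.1 hf.tendsto 1 one_pos
    simpa only [dist_eq_norm] using this
  have h2 : f =ᶠ[𝓝 z] fun w ↦ f z + Complex.log (g w / g z) := by
    filter_upwards [h1, hfg] with w hw1 hw2
    rw [← hw2, ← hfg.self_of_nhds, ← Complex.exp_sub, Complex.log_exp]
    · ring
    · linarith [neg_abs_le (f w - f z).im, Complex.abs_im_le_norm (f w - f z), Real.pi_gt_three]
    · linarith [le_abs_self (f w - f z).im, Complex.abs_im_le_norm (f w - f z), Real.pi_gt_three]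
  refine DifferentiableAt.congr_of_eventuallyEq ?_ h2
  refine (differentiableAt_const _).fun_add (DifferentiableAt.clog (hg.div_const _) ?_)
  rw [div_self hgz]
  exact Complex.one_mem_slitPlane

/-- A nowhere vanishing holomorphic function on a convex open set has a holomorphic logarithm. -/
theorem exists_differentiableOn_exp_eq {U : Set ℂ} (hU : Convex ℝ U) (hUo : IsOpen U)
    (hne : U.Nonempty) {g : ℂ → ℂ} (hg : DifferentiableOn ℂ g U) (hg0 : ∀ z ∈ U, g z ≠ 0) :
    ∃ f : ℂ → ℂ, DifferentiableOn ℂ f U ∧ ∀ z ∈ U, Complex.exp (f z) = g z := by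
  have hcontr : ContractibleSpace U := hU.contractibleSpace hne
  have hsc : IsSimplyConnected U := by
    have : SimplyConnectedSpace U := inferInstance
    exact this
  obtain ⟨f, hf, hfg⟩ := Complex.exists_continuousOn_eqOn_exp_comp hsc hUo hg.continuousOn
    (by rintro ⟨z, hz, h⟩; exact hg0 z hz h)
  refine ⟨f, fun z hz ↦ DifferentiableAt.differentiableWithinAt ?_, hfg⟩
  exact DifferentiableAt.of_continuousAt_exp (hf.continuousAt (hUo.mem_nhds hz))
    (hg.differentiableAt (hUo.mem_nhds hz))
    (by filter_upwards [hUo.mem_nhds hz] with w hw using hfg hw)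

/-- The half strip `Re s > a`, `|Im s| < T`. -/
def halfStrip (a T : ℝ) : Set ℂ := {s | a < s.re ∧ |s.im| < T}

theorem isOpen_halfStrip (a T : ℝ) : IsOpen (halfStrip a T) :=
  (isOpen_lt continuous_const Complex.continuous_re).inter
    (isOpen_lt (Complex.continuous_im.abs) continuous_const)

theorem convex_halfStrip (a T : ℝ) : Convex ℝ (halfStrip a T) := by
  have h1 : Convex ℝ {s : ℂ | a < s.re} := convex_halfSpace_re_gt a
  have h2 : Convex ℝ {s : ℂ | s.im < T} := convex_halfSpace_im_lt T
  have h3 : Convex ℝ {s : ℂ | -T < s.im} := convex_halfSpace_im_gt (-T)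
  convert! h1.inter (h3.inter h2) using 1
  ext s
  simp [halfStrip, abs_lt]

theorem nonempty_halfStrip (a : ℝ) {T : ℝ} (hT : 0 < T) : (halfStrip a T).Nonempty :=
  ⟨((a + 1 : ℝ) : ℂ), by simp [halfStrip, hT]⟩

namespace LData

variable {d : ℕ} {F : LData d} {q : ℕ} {χ : DirichletCharacter ℂ q}

theorem Axioms.L_eq_exp (hF : F.Axioms) (hA : F.RamanujanBound) (hq : 2 ≤ q) (hχ : χ.IsPrimitive)
    {s : ℂ} (hs : 1 < s.re) :
    F.L χ s = Complex.exp (F.primeSeries χ s + F.logRemainder χ s) := by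
  rw [hA.exp_primeSeries_add_logRemainder χ hs (hF.summable_twist q χ hq hχ s hs)]
  refine F.L_eq_LSeries χ ⟨_, hF.isEntireExtension hq hχ⟩ (hF.conductor_pos q hq) ?_ hs
  obtain ⟨θ, hθ, -, h⟩ := hF.param_infinity
  intro j
  have h4 := h q χ hq hχ j
  have : 0 ≤ 1 / (2 * (d : ℝ)) := by positivity
  linarith

/-- The prime sum continues holomorphically to the zero free region. -/
theorem Axioms.exists_primeSeries_continuation (hF : F.Axioms) (hA : F.RamanujanBound) (hq : 2 ≤ q)
    (hχ : χ.IsPrimitive) {l T : ℝ} (hl0 : 0 < l) (hl : l ≤ 1 / 10) (hT : 0 < T)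
    (hzf : ∀ s ∈ halfStrip (1 - l) T, F.L χ s ≠ 0) :
    ∃ h : ℂ → ℂ, DifferentiableOn ℂ h (halfStrip (1 - l) T) ∧
      (∀ s ∈ halfStrip 1 T, h s = F.primeSeries χ s) ∧
      ∀ s ∈ halfStrip (1 - l) T,
        Complex.exp (h s) = F.L χ s * Complex.exp (-F.logRemainder χ s) := by
  set g : ℂ → ℂ := fun s ↦ F.L χ s * Complex.exp (-F.logRemainder χ s) with hg
  have hsub : halfStrip (1 - l) T ⊆ {s : ℂ | 9 / 10 < s.re} := fun s hs ↦ by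
    have := hs.1
    simp only [Set.mem_ofPred_eq]
    linarith
  have hgd : DifferentiableOn ℂ g (halfStrip (1 - l) T) :=
    (hF.differentiable_L hq hχ).differentiableOn.mul
      ((hA.differentiableOn_logRemainder χ).mono hsub).neg.cexp
  obtain ⟨f, hf, hfg⟩ := exists_differentiableOn_exp_eq (convex_halfStrip (1 - l) T)
    (isOpen_halfStrip _ _) (nonempty_halfStrip _ hT) hgd
    fun z hz ↦ mul_ne_zero (hzf z hz) (Complex.exp_ne_zero _)
  have hsub1 : halfStrip 1 T ⊆ halfStrip (1 - l) T := fun s hs ↦ ⟨by linarith [hs.1], hs.2⟩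
  have hsub2 : halfStrip 1 T ⊆ {s : ℂ | 1 < s.re} := fun s hs ↦ hs.1
  -- On `Re s > 1` the branch differs from the prime sum by a constant, as both have the same
  -- exponential.
  set D : ℂ → ℂ := fun s ↦ f s - F.primeSeries χ s with hD
  have hDd : DifferentiableOn ℂ D (halfStrip 1 T) :=
    (hf.mono hsub1).sub ((hA.differentiableOn_primeSeries χ).mono hsub2)
  have hexp : ∀ s ∈ halfStrip 1 T, Complex.exp (D s) = 1 := by
    intro s hs
    rw [hD, Complex.exp_sub, hfg s (hsub1 hs), hg]
    beta_reduce
    rw [hF.L_eq_exp hA hq hχ hs.1, Complex.exp_add, mul_assoc, ← Complex.exp_add, add_neg_cancel,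
      Complex.exp_zero, mul_one, div_self (Complex.exp_ne_zero _)]
  have hderiv : Set.EqOn (deriv D) 0 (halfStrip 1 T) := by
    intro s hs
    have h1 : HasDerivAt D (deriv D s) s :=
      (hDd.differentiableAt ((isOpen_halfStrip 1 T).mem_nhds hs)).hasDerivAt
    have h2 := h1.cexp
    have h3 : (fun x ↦ Complex.exp (D x)) =ᶠ[𝓝 s] fun _ ↦ 1 := by
      filter_upwards [(isOpen_halfStrip 1 T).mem_nhds hs] with w hw using hexp w hw
    have h4 := (h2.congr_of_eventuallyEq h3.symm).unique (hasDerivAt_const s (1:ℂ))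
    exact (mul_eq_zero.1 h4).resolve_left (Complex.exp_ne_zero _)
  have hconst : ∃ c, ∀ s ∈ halfStrip 1 T, D s = c :=
    (isOpen_halfStrip 1 T).exists_is_const_of_deriv_eq_zero
      (convex_halfStrip 1 T).isPreconnected hDd hderiv
  obtain ⟨c, hc⟩ := hconst
  have hc1 : Complex.exp c = 1 := by
    obtain ⟨s, hs⟩ := nonempty_halfStrip 1 hT
    rw [← hc s hs]
    exact hexp s hs
  refine ⟨fun s ↦ f s - c, hf.sub_const c, fun s hs ↦ ?_, fun s hs ↦ ?_⟩
  · rw [← hc s hs]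
    simp [hD]
  · rw [Complex.exp_sub, hc1, div_one, hfg s hs]

/-- The Borel-Carathéodory theorem bounds the continued prime sum inside the zero free region. -/
theorem norm_continuation_le {h : ℂ → ℂ} {l T M : ℝ} (hl0 : 0 < l) (hl : l ≤ 1 / 10) (hM : 0 < M)
    (hd : DifferentiableOn ℂ h (halfStrip (1 - l) T))
    (hbd : ∀ s ∈ halfStrip (1 - l) T, s.re ≤ 2 → ‖Complex.exp (h s)‖ ≤ Real.exp M) {s : ℂ}
    (hs1 : 1 - l / 2 ≤ s.re) (hs2 : s.re ≤ 1 + 5 / 2 * l) (hs3 : |s.im| ≤ T - 1) :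
    ‖h s‖ ≤ 6 * M + 7 * ‖h (1 + l + s.im * Complex.I)‖ := by
  set c : ℂ := 1 + l + s.im * Complex.I with hc
  have hcre : c.re = 1 + l := by simp [hc]
  have hcim : c.im = s.im := by simp [hc]
  -- The disc of radius `2 l` about `1 + l + i Im s` lies in the half strip, and `s` lies in the concentric
  -- disc of radius `3 l / 2`.
  have hball : ∀ w ∈ Metric.ball (0:ℂ) (2 * l), c + w ∈ halfStrip (1 - l) T ∧ (c + w).re ≤ 2 := by
    intro w hw
    rw [mem_ball_zero_iff] at hw
    have h1 := (Complex.abs_re_le_norm w).trans_lt hw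
    have h2 := (Complex.abs_im_le_norm w).trans_lt hw
    rw [abs_lt] at h1
    refine ⟨⟨?_, ?_⟩, ?_⟩
    · rw [Complex.add_re, hcre]
      linarith
    · rw [Complex.add_im, hcim]
      calc |s.im + w.im| ≤ |s.im| + |w.im| := abs_add_le _ _
        _ < T := by linarith
    · rw [Complex.add_re, hcre]
      linarith
  have hw : s - c = ((s.re - (1 + l) : ℝ) : ℂ) := by
    apply Complex.ext <;> simp [hc]
  have hwn : ‖s - c‖ ≤ 3 / 2 * l := by
    rw [hw, Complex.norm_real, Real.norm_eq_abs, abs_le]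
    constructor <;> linarith
  have hB := Complex.borelCaratheodory (f := fun w ↦ h (c + w)) (R := 2 * l) (z := s - c) hM
    (by
      refine hd.comp (by fun_prop) fun w hw ↦ (hball w hw).1)
    (by
      intro w hw
      have h1 := hbd _ (hball w hw).1 (hball w hw).2
      rw [Complex.norm_exp, Real.exp_le_exp] at h1
      exact h1) (by linarith)
    (by rw [mem_ball_zero_iff]; linarith)
  simp only [add_sub_cancel, add_zero] at hB
  refine hB.trans ?_
  have h0 := norm_nonneg (s - c)
  have hpos : 0 < 2 * l - ‖s - c‖ := by linarith
  gcongr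
  · rw [div_le_iff₀ hpos]
    nlinarith
  · rw [div_le_iff₀ hpos]
    have := norm_nonneg (h c)
    nlinarith

end LData

/-! ### The triangle function and its Laplace transform -/

/-- The triangle function `max(0, 1 - |y|)`; its integer translates form a partition of unity. -/
def tri (y : ℝ) : ℝ := max 0 (1 - |y|)

/-- The two-sided Laplace transform of the triangle function, away from `w = 0`. -/
noncomputable def triLaplace (w : ℂ) : ℂ := (Complex.exp w - 2 + Complex.exp (-w)) / w ^ 2

theorem tri_nonneg (y : ℝ) : 0 ≤ tri y := le_max_left _ _

theorem tri_le_one (y : ℝ) : tri y ≤ 1 := by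
  rw [tri, max_le_iff]
  exact ⟨zero_le_one, by linarith [abs_nonneg y]⟩

theorem tri_neg (y : ℝ) : tri (-y) = tri y := by simp [tri]

theorem tri_eq_zero {y : ℝ} (hy : 1 ≤ |y|) : tri y = 0 := max_eq_left (by linarith)

theorem continuous_tri : Continuous tri := by unfold tri; fun_prop

theorem integral_one_sub_mul_exp {w : ℂ} (hw : w ≠ 0) :
    ∫ y in (0:ℝ)..1, (1 - (y:ℂ)) * Complex.exp (-w * y) =
      Complex.exp (-w) / w ^ 2 + 1 / w - 1 / w ^ 2 := by
  have hderiv : ∀ y ∈ Set.uIcc (0:ℝ) 1, HasDerivAt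
      (fun y : ℝ ↦ -(1 - (y:ℂ)) * Complex.exp (-w * y) / w + Complex.exp (-w * y) / w ^ 2)
      ((1 - (y:ℂ)) * Complex.exp (-w * y)) y := by
    intro y _
    have h1 : HasDerivAt (fun y : ℝ ↦ (y:ℂ)) 1 y := Complex.ofRealCLM.hasDerivAt
    have h2 : HasDerivAt (fun y : ℝ ↦ Complex.exp (-w * y)) (Complex.exp (-w * y) * (-w * 1)) y :=
      (h1.const_mul (-w)).cexp
    have h3 : HasDerivAt (fun y : ℝ ↦ -(1 - (y:ℂ))) (- -1) y := (h1.const_sub 1).fun_neg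
    convert! ((h3.fun_mul h2).div_const w).fun_add (h2.div_const (w ^ 2)) using 1
    field_simp
    ring
  rw [intervalIntegral.integral_eq_sub_of_hasDerivAt hderiv
    (Continuous.intervalIntegrable (by fun_prop) _ _)]
  simp
  ring

theorem integral_tri_mul_exp {w : ℂ} (hw : w ≠ 0) :
    ∫ y : ℝ, (tri y : ℂ) * Complex.exp (-w * y) = triLaplace w := by
  have hsupp : ∫ y : ℝ, (tri y : ℂ) * Complex.exp (-w * y) =
      ∫ y in (-1:ℝ)..1, (tri y : ℂ) * Complex.exp (-w * y) := by
    rw [intervalIntegral.integral_eq_integral_of_support_subset]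
    intro y hy
    by_contra hy'
    apply hy
    have : 1 ≤ |y| := by
      by_contra! h
      rw [abs_lt] at h
      exact hy' ⟨h.1, h.2.le⟩
    simp [tri_eq_zero this]
  have hint : ∀ a b : ℝ, IntervalIntegrable (fun y : ℝ ↦ (tri y : ℂ) * Complex.exp (-w * y))
      MeasureTheory.volume a b := fun a b ↦ by
    have := continuous_tri
    exact Continuous.intervalIntegrable (by fun_prop) _ _
  rw [hsupp, ← intervalIntegral.integral_add_adjacent_intervals (hint (-1) 0) (hint 0 1)]
  have h1 : ∫ y in (0:ℝ)..1, (tri y : ℂ) * Complex.exp (-w * y) =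
      ∫ y in (0:ℝ)..1, (1 - (y:ℂ)) * Complex.exp (-w * y) := by
    refine intervalIntegral.integral_congr fun y hy ↦ ?_
    rw [Set.uIcc_of_le zero_le_one] at hy
    have : tri y = 1 - y := by
      rw [tri, abs_of_nonneg hy.1, max_eq_right (by linarith [hy.2])]
    simp [this]
  have h2 : ∫ y in (-1:ℝ)..0, (tri y : ℂ) * Complex.exp (-w * y) =
      ∫ y in (0:ℝ)..1, (1 - (y:ℂ)) * Complex.exp (- -w * y) := by
    have h3 := intervalIntegral.integral_comp_neg (a := 0) (b := 1)
      (fun y : ℝ ↦ (tri y : ℂ) * Complex.exp (-w * y))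
    rw [neg_zero] at h3
    rw [← h3]
    refine intervalIntegral.integral_congr fun y hy ↦ ?_
    rw [Set.uIcc_of_le zero_le_one] at hy
    have : tri y = 1 - y := by
      rw [tri, abs_of_nonneg hy.1, max_eq_right (by linarith [hy.2])]
    simp [this, tri_neg]
  rw [h1, h2, integral_one_sub_mul_exp hw, integral_one_sub_mul_exp (neg_ne_zero.2 hw), triLaplace]
  field_simp
  ring_nf

/-- The bound is for the range of real parts that occurs in the contour shift. -/
theorem norm_triLaplace_le {w : ℂ} (h1 : 1 / 4 ≤ |w.re|) (h2 : |w.re| ≤ 2) :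
    ‖triLaplace w‖ ≤ 300 * (1 + w.im ^ 2)⁻¹ := by
  rw [triLaplace, norm_div, norm_pow, div_eq_mul_inv]
  have he : Real.exp 2 ≤ 15 / 2 := by
    have h3 : Real.exp 2 = Real.exp 1 ^ 2 := by rw [← Real.exp_nat_mul]; norm_num
    rw [h3]
    have := Real.exp_one_lt_d9
    have := Real.exp_pos 1
    nlinarith
  have hnum : ‖Complex.exp w - 2 + Complex.exp (-w)‖ ≤ 17 := by
    refine (norm_add_le _ _).trans ((add_le_add_left (norm_sub_le _ _) _).trans ?_)
    rw [Complex.norm_exp, Complex.norm_exp, Complex.neg_re, Complex.norm_ofNat]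
    have h3 : Real.exp w.re ≤ 15 / 2 :=
      (Real.exp_le_exp.2 ((le_abs_self _).trans h2)).trans he
    have h4 : Real.exp (-w.re) ≤ 15 / 2 :=
      (Real.exp_le_exp.2 ((neg_le_abs _).trans h2)).trans he
    linarith
  have hden : 1 / 16 * (1 + w.im ^ 2) ≤ ‖w‖ ^ 2 := by
    rw [Complex.sq_norm, Complex.normSq_apply]
    have : (1 / 4) ^ 2 ≤ w.re ^ 2 := by
      rw [← sq_abs w.re]
      gcongr
    nlinarith [sq_nonneg w.im]
  calc _ ≤ 17 * (1 / 16 * (1 + w.im ^ 2))⁻¹ := by gcongr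
    _ = 272 * (1 + w.im ^ 2)⁻¹ := by rw [mul_inv]; ring
    _ ≤ _ := by
        have : 0 ≤ (1 + w.im ^ 2)⁻¹ := by positivity
        linarith

theorem continuous_triLaplace_vertical {c : ℝ} (hc : c ≠ 0) :
    Continuous fun u : ℝ ↦ triLaplace (c + u * Complex.I) := by
  unfold triLaplace
  refine Continuous.div (by fun_prop) (by fun_prop) fun u ↦ pow_ne_zero _ fun h ↦ hc ?_
  simpa using congrArg Complex.re h

theorem integrable_triLaplace_vertical {c : ℝ} (h1 : 1 / 4 ≤ |c|) (h2 : |c| ≤ 2) :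
    MeasureTheory.Integrable fun u : ℝ ↦ triLaplace (c + u * Complex.I) := by
  have hc : c ≠ 0 := fun h ↦ by rw [h, abs_zero] at h1; norm_num at h1
  refine (integrable_inv_one_add_sq.const_mul 300).mono'
    (continuous_triLaplace_vertical hc).aestronglyMeasurable (Eventually.of_forall fun u ↦ ?_)
  have h := norm_triLaplace_le (w := c + u * Complex.I) (by simpa using h1) (by simpa using h2)
  simpa using h

/-- Laplace inversion for the triangle function. -/
theorem integral_triLaplace_mul_exp {c : ℝ} (h1 : 1 / 4 ≤ |c|) (h2 : |c| ≤ 2) (y : ℝ) :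
    ∫ u : ℝ, triLaplace (c + u * Complex.I) * Complex.exp ((c + u * Complex.I) * y) =
      2 * Real.pi * tri y := by
  have hc : c ≠ 0 := fun h ↦ by rw [h, abs_zero] at h1; norm_num at h1
  set f : ℝ → ℂ := fun x ↦ (tri x : ℂ) * Complex.exp (-c * x) with hf
  have hfc : Continuous f := by
    have := continuous_tri
    fun_prop
  have hfs : HasCompactSupport f := by
    refine HasCompactSupport.intro (isCompact_Icc (a := (-1:ℝ)) (b := 1)) fun x hx ↦ ?_
    have : 1 ≤ |x| := by
      by_contra! h
      rw [abs_lt] at h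
      exact hx ⟨h.1.le, h.2.le⟩
    simp [hf, tri_eq_zero this]
  have hfi : MeasureTheory.Integrable f := hfc.integrable_of_hasCompactSupport hfs
  have hF : FourierTransform.fourier f =
      fun ξ : ℝ ↦ triLaplace (c + (2 * Real.pi * ξ : ℝ) * Complex.I) := by
    funext ξ
    have hw : (c + (2 * Real.pi * ξ : ℝ) * Complex.I : ℂ) ≠ 0 := fun h ↦ hc (by
      simpa using congrArg Complex.re h)
    rw [Real.fourier_real_eq_integral_exp_smul, ← integral_tri_mul_exp hw]
    refine MeasureTheory.integral_congr_ae (Eventually.of_forall fun x ↦ ?_)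
    simp only [hf, smul_eq_mul]
    rw [mul_left_comm, ← Complex.exp_add]
    congr 2
    push_cast
    ring
  have hFi : MeasureTheory.Integrable (FourierTransform.fourier f) := by
    rw [hF]
    exact (integrable_triLaplace_vertical h1 h2).comp_mul_left' (R := 2 * Real.pi) (by positivity)
  have hinv := congrFun (hfc.fourierInv_fourier_eq hfi hFi) y
  rw [Real.fourierInv_eq_fourier_neg, Real.fourier_real_eq_integral_exp_smul, hF] at hinv
  have h3 := MeasureTheory.Measure.integral_comp_mul_left
    (fun u : ℝ ↦ triLaplace (c + u * Complex.I) * Complex.exp ((c + u * Complex.I) * y))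
    (2 * Real.pi)
  have hpi : (0:ℝ) < 2 * Real.pi := by positivity
  have h4 : ∫ ξ : ℝ, triLaplace (c + (2 * Real.pi * ξ : ℝ) * Complex.I) *
      Complex.exp ((c + (2 * Real.pi * ξ : ℝ) * Complex.I) * y) = tri y := by
    have h5 : (tri y : ℂ) = Complex.exp (c * y) * f y := by
      simp only [hf]
      rw [mul_left_comm, ← Complex.exp_add]
      simp
    rw [h5, ← hinv, ← MeasureTheory.integral_const_mul]
    refine MeasureTheory.integral_congr_ae (Eventually.of_forall fun ξ ↦ ?_)
    simp only [smul_eq_mul]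
    rw [← mul_assoc, ← Complex.exp_add, mul_comm]
    congr 2
    push_cast
    ring
  rw [h4, abs_of_pos (inv_pos.2 hpi)] at h3
  rw [h3, Complex.real_smul, ← mul_assoc]
  push_cast
  rw [mul_inv_cancel₀ (by exact_mod_cast hpi.ne'), one_mul]

/-! ### Contour shifts for smooth windows -/

/-- The integrand of the Laplace inversion of a window of the prime sum, as a function of the variable
of the prime sum. -/
noncomputable def windowKernel (v : ℝ) (s z : ℂ) : ℂ :=
  triLaplace (z - s) * Complex.exp ((z - s) * v)

theorem norm_windowKernel_le {v : ℝ} {s z : ℂ} (h1 : 1 / 4 ≤ |z.re - s.re|)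
    (h2 : |z.re - s.re| ≤ 2) :
    ‖windowKernel v s z‖ ≤
      300 * (1 + (z.im - s.im) ^ 2)⁻¹ * Real.exp (v * (z.re - s.re)) := by
  have h3 : ((z - s) * (v : ℂ)).re = v * (z.re - s.re) := by
    rw [Complex.re_mul_ofReal, Complex.sub_re, mul_comm]
  rw [windowKernel, norm_mul, Complex.norm_exp, h3]
  gcongr
  have := norm_triLaplace_le (w := z - s) (by simpa using h1) (by simpa using h2)
  simpa using this

theorem integrable_windowKernel_majorant (t E : ℝ) :
    MeasureTheory.Integrable fun y : ℝ ↦ 300 * (1 + (y - t) ^ 2)⁻¹ * E :=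
  ((integrable_inv_one_add_sq.comp_sub_right t).const_mul 300).mul_const E

theorem integral_Ioi_inv_one_add_sub_sq_le {T t : ℝ} (hT : 0 < T) (ht : |t| ≤ T / 2) :
    ∫ y in Set.Ioi T, (1 + (y - t) ^ 2)⁻¹ ≤ 2 / T := by
  have h1 := MeasureTheory.integral_sub_right_eq_self (μ := MeasureTheory.volume)
    (fun y ↦ (Set.Ioi (T - t)).indicator (fun y : ℝ ↦ (1 + y ^ 2)⁻¹) y) t
  rw [MeasureTheory.integral_indicator measurableSet_Ioi, integral_Ioi_inv_one_add_sq] at h1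
  have h2 : ∫ y in Set.Ioi T, (1 + (y - t) ^ 2)⁻¹ = Real.pi / 2 - Real.arctan (T - t) := by
    rw [← h1, ← MeasureTheory.integral_indicator measurableSet_Ioi]
    congr 1
    funext y
    by_cases hy : T < y
    · rw [Set.indicator_of_mem (show y ∈ Set.Ioi T from hy),
        Set.indicator_of_mem (show y - t ∈ Set.Ioi (T - t) by simpa using hy)]
    · rw [Set.indicator_of_notMem (show y ∉ Set.Ioi T from hy),
        Set.indicator_of_notMem (show y - t ∉ Set.Ioi (T - t) by simpa using hy)]
  have h3 : 0 < T - t := by linarith [le_abs_self t]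
  rw [h2, ← Real.arctan_inv_of_pos h3]
  have h4 : Real.arctan (T - t)⁻¹ ≤ (T - t)⁻¹ := by
    have := Real.le_tan (Real.arctan_nonneg.2 (inv_nonneg.2 h3.le)) (Real.arctan_lt_pi_div_two _)
    rwa [Real.tan_arctan] at this
  refine h4.trans ?_
  rw [inv_le_comm₀ h3 (by positivity), inv_div]
  linarith [le_abs_self t]

theorem integral_Iic_inv_one_add_sub_sq_le {T t : ℝ} (hT : 0 < T) (ht : |t| ≤ T / 2) :
    ∫ y in Set.Iic (-T), (1 + (y - t) ^ 2)⁻¹ ≤ 2 / T := by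
  have h := integral_Ioi_inv_one_add_sub_sq_le (t := -t) hT (by rwa [abs_neg])
  have h1 := integral_comp_neg_Ioi T (fun y : ℝ ↦ (1 + (y - t) ^ 2)⁻¹)
  rw [← h1]
  refine le_trans (le_of_eq ?_) h
  congr 1
  funext y
  congr 2
  ring

/-- Moving the line of integration from `Re z = a` to `Re z = b` inside the rectangle `|Im z| ≤ T`,
where the integrand continues holomorphically; the tails stay on `Re z = a`. -/
theorem norm_integral_windowKernel_le {P h : ℂ → ℂ} {a b T v B P₀ E : ℝ} {s : ℂ} (hba : b ≤ a)
    (hab1 : a - b ≤ 1) (hT : 1 ≤ T) (hst : |s.im| ≤ T / 2) (hv : 0 ≤ v)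
    (hre : ∀ x ∈ Set.Icc b a, 1 / 4 ≤ |x - s.re| ∧ |x - s.re| ≤ 2)
    (hh : DifferentiableOn ℂ h (Set.Icc b a ×ℂ Set.Icc (-T) T))
    (hPh : ∀ y ∈ Set.Icc (-T) T, h (a + y * Complex.I) = P (a + y * Complex.I))
    (hB : ∀ z ∈ Set.Icc b a ×ℂ Set.Icc (-T) T, ‖h z‖ ≤ B)
    (hP : ∀ y : ℝ, ‖P (a + y * Complex.I)‖ ≤ P₀)
    (hPc : Continuous fun y : ℝ ↦ P (a + y * Complex.I))
    (hE : Real.exp (v * (a - 1)) ≤ E) :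
    ‖∫ y : ℝ, windowKernel v s (a + y * Complex.I) * P (a + y * Complex.I)‖ ≤
      Real.exp (v * (1 - s.re)) *
        (1200 * E * P₀ / T + 2400 * E * B / T ^ 2 + 1200 * B * Real.exp (-(v * (1 - b)))) := by
  have hP0 : 0 ≤ P₀ := (norm_nonneg _).trans (hP 0)
  have hE0 : 0 ≤ E := (Real.exp_pos _).le.trans hE
  have hB0 : 0 ≤ B := (norm_nonneg _).trans
    (hB (a : ℂ) ⟨by simp [hba], by simp only [Set.mem_preimage, Complex.ofReal_im, Set.mem_Icc]; constructor <;> linarith⟩)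
  have hka := fun y : ℝ ↦ norm_windowKernel_le (v := v) (s := s) (z := a + y * Complex.I)
    (by simpa using (hre a ⟨hba, le_rfl⟩).1) (by simpa using (hre a ⟨hba, le_rfl⟩).2)
  set X := Real.exp (v * (1 - s.re)) with hX
  have hXE : Real.exp (v * (a - s.re)) ≤ X * E := by
    have : v * (a - s.re) = v * (1 - s.re) + v * (a - 1) := by ring
    rw [this, Real.exp_add]
    gcongr
  have hka' : ∀ y : ℝ, ‖windowKernel v s (a + y * Complex.I) * P (a + y * Complex.I)‖ ≤
      300 * (1 + (y - s.im) ^ 2)⁻¹ * (X * E * P₀) := by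
    intro y
    have h1 := hka y
    simp only [Complex.add_re, Complex.ofReal_re, Complex.mul_re, Complex.I_re, mul_zero,
      Complex.ofReal_im, Complex.I_im, mul_one, sub_self, add_zero, Complex.add_im,
      Complex.mul_im, zero_add] at h1
    rw [norm_mul]
    calc _ ≤ 300 * (1 + (y - s.im) ^ 2)⁻¹ * Real.exp (v * (a - s.re)) * P₀ := by
          gcongr
          exact hP y
      _ ≤ 300 * (1 + (y - s.im) ^ 2)⁻¹ * (X * E) * P₀ := by gcongr
      _ = _ := by ring
  have hca : a - s.re ≠ 0 := fun h ↦ by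
    have := (hre a ⟨hba, le_rfl⟩).1
    rw [h, abs_zero] at this
    norm_num at this
  have hcont : Continuous fun y : ℝ ↦
      windowKernel v s (a + y * Complex.I) * P (a + y * Complex.I) := by
    refine Continuous.mul ?_ hPc
    unfold windowKernel
    refine Continuous.mul ?_ (by fun_prop)
    have h1 := (continuous_triLaplace_vertical hca).comp (continuous_id.sub continuous_const :
      Continuous fun y : ℝ ↦ y - s.im)
    convert! h1 using 2 with y
    simp only [Function.comp_apply]
    congr 1
    apply Complex.ext <;> simp
  have hint : MeasureTheory.Integrable fun y : ℝ ↦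
      windowKernel v s (a + y * Complex.I) * P (a + y * Complex.I) :=
    (integrable_windowKernel_majorant s.im (X * E * P₀)).mono' hcont.aestronglyMeasurable
      (Eventually.of_forall hka')
  -- The tails stay on `Re z = a`, where the quadratic decay of the kernel gains a factor `1 / T`.
  have htail : ∀ S : Set ℝ, ∫ y in S, (1 + (y - s.im) ^ 2)⁻¹ ≤ 2 / T →
      ‖∫ y in S, windowKernel v s (a + y * Complex.I) * P (a + y * Complex.I)‖ ≤
        X * (600 * E * P₀ / T) := by
    intro S hS
    have h1 := MeasureTheory.norm_integral_le_of_norm_le (μ := MeasureTheory.volume.restrict S)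
      ((integrable_windowKernel_majorant s.im (X * E * P₀)).integrableOn)
      (Eventually.of_forall hka')
    refine h1.trans ?_
    rw [MeasureTheory.integral_mul_const, MeasureTheory.integral_const_mul]
    calc _ ≤ 300 * (2 / T) * (X * E * P₀) := by gcongr
      _ = _ := by ring
  have hsplit : ∫ y : ℝ, windowKernel v s (a + y * Complex.I) * P (a + y * Complex.I) =
      (∫ y in Set.Iic (-T), windowKernel v s (a + y * Complex.I) * P (a + y * Complex.I)) +
      (∫ y in (-T)..T, windowKernel v s (a + y * Complex.I) * P (a + y * Complex.I)) +
      ∫ y in Set.Ioi T, windowKernel v s (a + y * Complex.I) * P (a + y * Complex.I) := by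
    rw [intervalIntegral.integral_of_le (by linarith),
      ← MeasureTheory.setIntegral_union (Set.Iic_disjoint_Ioc le_rfl)
        measurableSet_Ioc hint.integrableOn hint.integrableOn,
      Set.Iic_union_Ioc_eq_Iic (by linarith),
      ← MeasureTheory.setIntegral_union (Set.Iic_disjoint_Ioi le_rfl) measurableSet_Ioi
        hint.integrableOn hint.integrableOn, Set.Iic_union_Ioi, MeasureTheory.setIntegral_univ]
  -- On the segment `|Im z| ≤ T` the integrand is replaced by its continuation, and the theorem of Cauchy applies.
  have hkd : DifferentiableOn ℂ (fun z ↦ windowKernel v s z * h z)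
      (Set.Icc b a ×ℂ Set.Icc (-T) T) := by
    refine DifferentiableOn.mul ?_ hh
    intro z hz
    have hz0 : z - s ≠ 0 := fun h0 ↦ by
      have h1 := (hre z.re hz.1).1
      have h2 := congrArg Complex.re h0
      rw [Complex.sub_re, Complex.zero_re] at h2
      rw [h2, abs_zero] at h1
      norm_num at h1
    refine DifferentiableAt.differentiableWithinAt ?_
    unfold windowKernel triLaplace
    have hz2 : (z - s) ^ 2 ≠ 0 := pow_ne_zero _ hz0
    fun_prop (disch := assumption)
  have hrect := Complex.integral_boundary_rect_eq_zero_of_differentiableOn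
    (fun z ↦ windowKernel v s z * h z) ⟨b, -T⟩ ⟨a, T⟩
    (by simpa only [Set.uIcc_of_le hba, Set.uIcc_of_le (by linarith : -T ≤ T)] using hkd)
  simp only at hrect
  have hmid : ∫ y in (-T)..T, windowKernel v s (a + y * Complex.I) * P (a + y * Complex.I) =
      ∫ y in (-T)..T, windowKernel v s (a + y * Complex.I) * h (a + y * Complex.I) := by
    refine intervalIntegral.integral_congr fun y hy ↦ ?_
    rw [Set.uIcc_of_le (by linarith)] at hy
    simp only [hPh y hy]
  have hhor : ∀ y₀ : ℝ, |y₀| = T →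
      ‖∫ x in b..a, windowKernel v s (x + y₀ * Complex.I) * h (x + y₀ * Complex.I)‖ ≤
        X * (1200 * E * B / T ^ 2) := by
    intro y₀ hy₀
    have h1 : ∀ x ∈ Set.uIoc b a,
        ‖windowKernel v s (x + y₀ * Complex.I) * h (x + y₀ * Complex.I)‖ ≤
          X * (1200 * E * B / T ^ 2) := by
      intro x hx
      rw [Set.uIoc_of_le hba] at hx
      have hx' : x ∈ Set.Icc b a := ⟨hx.1.le, hx.2⟩
      have h2 := norm_windowKernel_le (v := v) (s := s) (z := x + y₀ * Complex.I)
        (by simpa using (hre x hx').1) (by simpa using (hre x hx').2)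
      simp only [Complex.add_re, Complex.ofReal_re, Complex.mul_re, Complex.I_re, mul_zero,
        Complex.ofReal_im, Complex.I_im, mul_one, sub_self, add_zero, Complex.add_im,
        Complex.mul_im, zero_add] at h2
      have h3 : ‖h (x + y₀ * Complex.I)‖ ≤ B := hB _ ⟨by simpa using hx', by
        simpa using abs_le.1 hy₀.le⟩
      have h4 : T / 2 ≤ |y₀ - s.im| := by
        have := abs_sub_abs_le_abs_sub y₀ s.im
        linarith
      have h5 : T ^ 2 / 4 ≤ 1 + (y₀ - s.im) ^ 2 := by
        rw [← sq_abs (y₀ - s.im)]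
        nlinarith
      have h6 : (1 + (y₀ - s.im) ^ 2)⁻¹ ≤ 4 / T ^ 2 := by
        rw [inv_le_comm₀ (by positivity) (by positivity), inv_div]
        exact h5
      have h7 : Real.exp (v * (x - s.re)) ≤ X * E := by
        refine le_trans (Real.exp_le_exp.2 ?_) hXE
        have := hx.2
        gcongr
      rw [norm_mul]
      calc _ ≤ 300 * (4 / T ^ 2) * (X * E) * B := by
            gcongr
            refine h2.trans ?_
            gcongr
        _ = _ := by ring
    have h2 := intervalIntegral.norm_integral_le_of_norm_le_const h1
    rw [abs_of_nonneg (by linarith)] at h2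
    refine h2.trans (mul_le_of_le_one_right (by positivity) hab1)
  have hleft : ‖∫ y in (-T)..T, windowKernel v s (b + y * Complex.I) * h (b + y * Complex.I)‖ ≤
      X * (1200 * B * Real.exp (-(v * (1 - b)))) := by
    have h1 : ∀ y ∈ Set.Ioc (-T) T,
        ‖windowKernel v s (b + y * Complex.I) * h (b + y * Complex.I)‖ ≤
          300 * (1 + (y - s.im) ^ 2)⁻¹ * (X * Real.exp (-(v * (1 - b))) * B) := by
      intro y hy
      have hb' : b ∈ Set.Icc b a := ⟨le_rfl, hba⟩
      have h2 := norm_windowKernel_le (v := v) (s := s) (z := b + y * Complex.I)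
        (by simpa using (hre b hb').1) (by simpa using (hre b hb').2)
      simp only [Complex.add_re, Complex.ofReal_re, Complex.mul_re, Complex.I_re, mul_zero,
        Complex.ofReal_im, Complex.I_im, mul_one, sub_self, add_zero, Complex.add_im,
        Complex.mul_im, zero_add] at h2
      have h3 : ‖h (b + y * Complex.I)‖ ≤ B := hB _ ⟨by simpa using hba, by
        simpa using ⟨hy.1.le, hy.2⟩⟩
      have h4 : Real.exp (v * (b - s.re)) = X * Real.exp (-(v * (1 - b))) := by
        rw [hX, ← Real.exp_add]
        congr 1
        ring
      rw [h4] at h2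
      rw [norm_mul]
      calc _ ≤ _ := mul_le_mul h2 h3 (norm_nonneg _) (by positivity)
        _ = _ := by ring
    have hM := integrable_windowKernel_majorant s.im (X * Real.exp (-(v * (1 - b))) * B)
    rw [intervalIntegral.integral_of_le (by linarith)]
    refine (MeasureTheory.norm_integral_le_of_norm_le hM.integrableOn
      (MeasureTheory.ae_restrict_of_forall_mem measurableSet_Ioc h1)).trans ?_
    refine (MeasureTheory.setIntegral_le_integral hM
      (Eventually.of_forall fun y ↦ by positivity)).trans ?_
    rw [MeasureTheory.integral_mul_const, MeasureTheory.integral_const_mul,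
      MeasureTheory.integral_sub_right_eq_self (fun y : ℝ ↦ (1 + y ^ 2)⁻¹),
      integral_univ_inv_one_add_sq]
    have h2 : 0 ≤ X * Real.exp (-(v * (1 - b))) * B := by positivity
    calc _ ≤ 300 * 4 * (X * Real.exp (-(v * (1 - b))) * B) := by
          gcongr
          exact Real.pi_lt_four.le
      _ = _ := by ring
  have hI : ‖∫ y in (-T)..T, windowKernel v s (a + y * Complex.I) * h (a + y * Complex.I)‖ ≤
      X * (1200 * E * B / T ^ 2) + X * (1200 * E * B / T ^ 2) +
        X * (1200 * B * Real.exp (-(v * (1 - b)))) := by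
    have h1 : Complex.I • (∫ y in (-T)..T,
        windowKernel v s (a + y * Complex.I) * h (a + y * Complex.I)) =
        (∫ x in b..a, windowKernel v s (x + (T:ℝ) * Complex.I) * h (x + (T:ℝ) * Complex.I)) -
        (∫ x in b..a, windowKernel v s (x + (-T:ℝ) * Complex.I) * h (x + (-T:ℝ) * Complex.I)) +
        Complex.I • (∫ y in (-T)..T,
          windowKernel v s (b + y * Complex.I) * h (b + y * Complex.I)) := by
      linear_combination hrect
    have h2 := congrArg norm h1
    rw [norm_smul, Complex.norm_I, one_mul] at h2
    rw [h2]
    refine (norm_add_le _ _).trans (add_le_add ((norm_sub_le _ _).trans (add_le_add ?_ ?_)) ?_)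
    · exact hhor T (abs_of_pos (by linarith))
    · exact hhor (-T) (by rw [abs_neg, abs_of_pos (by linarith)])
    · rw [norm_smul, Complex.norm_I, one_mul]
      exact hleft
  rw [hsplit, hmid]
  refine (norm_add_le _ _).trans ((add_le_add_left (norm_add_le _ _) _).trans ?_)
  have hT0 : 0 < T := by linarith
  have t1 := htail _ (integral_Iic_inv_one_add_sub_sq_le hT0 hst)
  have t2 := htail _ (integral_Ioi_inv_one_add_sub_sq_le hT0 hst)
  calc _ ≤ X * (600 * E * P₀ / T) + (X * (1200 * E * B / T ^ 2) + X * (1200 * E * B / T ^ 2) +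
        X * (1200 * B * Real.exp (-(v * (1 - b))))) + X * (600 * E * P₀ / T) :=
      add_le_add (add_le_add t1 hI) t2
    _ = _ := by ring

/-! ### Prime sums over windows -/

theorem natCast_cpow_neg_eq_exp {n : ℕ} (hn : n ≠ 0) (z : ℂ) :
    (n : ℂ) ^ (-z) = Complex.exp (-z * Real.log n) := by
  rw [Complex.cpow_def_of_ne_zero (by exact_mod_cast hn), ← Complex.natCast_log, mul_comm]

/-- The window of a single Dirichlet monomial. -/
theorem integral_windowKernel_mul_cpow {a v : ℝ} {s : ℂ} (h1 : 1 / 4 ≤ |a - s.re|)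
    (h2 : |a - s.re| ≤ 2) {n : ℕ} (hn : n ≠ 0) :
    ∫ y : ℝ, windowKernel v s (a + y * Complex.I) * (n : ℂ) ^ (-(a + y * Complex.I)) =
      2 * Real.pi * tri (Real.log n - v) * (n : ℂ) ^ (-s) := by
  have h3 := integral_triLaplace_mul_exp h1 h2 (v - Real.log n)
  have h4 := MeasureTheory.integral_sub_right_eq_self (μ := MeasureTheory.volume)
    (fun u : ℝ ↦ triLaplace ((a - s.re : ℝ) + u * Complex.I) *
      Complex.exp (((a - s.re : ℝ) + u * Complex.I) * (v - Real.log n : ℝ))) s.im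
  rw [h3, ← neg_sub (Real.log n) v, tri_neg] at h4
  rw [← h4, ← MeasureTheory.integral_mul_const]
  refine MeasureTheory.integral_congr_ae (Eventually.of_forall fun y ↦ ?_)
  have h5 : ((a - s.re : ℝ) : ℂ) + ((y - s.im : ℝ) : ℂ) * Complex.I = a + y * Complex.I - s := by
    apply Complex.ext <;> simp
  simp only
  rw [h5, windowKernel, natCast_cpow_neg_eq_exp hn, natCast_cpow_neg_eq_exp hn, mul_assoc,
    mul_assoc, ← Complex.exp_add, ← Complex.exp_add]
  congr 2
  push_cast
  ring

namespace LData

variable {d : ℕ} {F : LData d} {q : ℕ} {χ : DirichletCharacter ℂ q}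

/-- The part of the prime sum near `p ≈ e^v`, weighted by the triangle function; `S` is any finite set
that contains the primes of the window. -/
noncomputable def primeWindow (F : LData d) {q : ℕ} (χ : DirichletCharacter ℂ q) (S : Finset ℕ)
    (v : ℝ) (s : ℂ) : ℂ :=
  ∑ p ∈ S, (tri (Real.log p - v) : ℂ) * (F.coeff p * χ (p : ZMod q) * (p : ℂ) ^ (-s))

/-- The windowed prime sum as a contour integral of the whole prime sum. -/
theorem RamanujanBound.primeWindow_eq_integral (hA : F.RamanujanBound) {a v : ℝ} {s : ℂ} (ha : 1 < a)
    (h1 : 1 / 4 ≤ |a - s.re|) (h2 : |a - s.re| ≤ 2) {S : Finset ℕ} (hS : ∀ p ∈ S, p.Prime)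
    (hSv : ∀ p : ℕ, p.Prime → tri (Real.log p - v) ≠ 0 → p ∈ S) :
    2 * Real.pi * F.primeWindow χ S v s =
      ∫ y : ℝ, windowKernel v s (a + y * Complex.I) * F.primeSeries χ (a + y * Complex.I) := by
  classical
  have hca : a - s.re ≠ 0 := fun h ↦ by
    rw [h, abs_zero] at h1
    norm_num at h1
  have hkc : Continuous fun y : ℝ ↦ windowKernel v s (a + y * Complex.I) := by
    unfold windowKernel
    refine Continuous.mul ?_ (by fun_prop)
    have h1 := (continuous_triLaplace_vertical hca).comp (continuous_id.sub continuous_const :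
      Continuous fun y : ℝ ↦ y - s.im)
    convert! h1 using 2 with y
    simp only [Function.comp_apply]
    congr 1
    apply Complex.ext <;> simp
  have hki : MeasureTheory.Integrable fun y : ℝ ↦ windowKernel v s (a + y * Complex.I) := by
    refine (integrable_windowKernel_majorant s.im (Real.exp (v * (a - s.re)))).mono'
      hkc.aestronglyMeasurable (Eventually.of_forall fun y ↦ ?_)
    have h3 := norm_windowKernel_le (v := v) (s := s) (z := a + y * Complex.I)
      (by simpa using h1) (by simpa using h2)
    simpa using h3
  set f : Nat.Primes → ℝ → ℂ := fun p y ↦ windowKernel v s (a + y * Complex.I) *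
    (F.coeff p * χ ((p : ℕ) : ZMod q) * ((p : ℕ) : ℂ) ^ (-(a + y * Complex.I))) with hf
  have hfn : ∀ p y, ‖f p y‖ ≤ ‖windowKernel v s (a + y * Complex.I)‖ *
      (2 ^ d * ((p : ℕ) : ℝ) ^ (-a)) := by
    intro p y
    simp only [hf]
    rw [norm_mul]
    gcongr
    have := hA.norm_primeSeries_term_le χ p (a + y * Complex.I)
    simpa using this
  have hfc : ∀ p, Continuous (f p) := fun p ↦ by
    refine hkc.mul (continuous_const.mul ?_)
    exact (differentiable_prime_cpow_neg p).continuous.comp (by fun_prop)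
  have hfi : ∀ p, MeasureTheory.Integrable (f p) := fun p ↦
    (hki.norm.mul_const _).mono' (hfc p).aestronglyMeasurable (Eventually.of_forall (hfn p))
  have hsum : Summable fun p ↦ ∫ y, ‖f p y‖ := by
    refine Summable.of_nonneg_of_le (fun p ↦ MeasureTheory.integral_nonneg fun y ↦ norm_nonneg _)
      (fun p ↦ (MeasureTheory.integral_mono (hfi p).norm (hki.norm.mul_const _) (hfn p)).trans_eq
        (MeasureTheory.integral_mul_const _ _)) ?_
    exact ((Nat.Primes.summable_rpow.2 (by linarith)).mul_left _).mul_left _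
  have hmain := MeasureTheory.hasSum_integral_of_summable_integral_norm hfi hsum
  have hterm : ∀ p : Nat.Primes, ∫ y, f p y = 2 * Real.pi * ((tri (Real.log (p : ℕ) - v) : ℂ) *
      (F.coeff p * χ ((p : ℕ) : ZMod q) * ((p : ℕ) : ℂ) ^ (-s))) := by
    intro p
    have h3 := integral_windowKernel_mul_cpow (v := v) h1 h2 p.2.ne_zero
    have h4 : ∀ y, f p y = (F.coeff p * χ ((p : ℕ) : ZMod q)) *
        (windowKernel v s (a + y * Complex.I) * ((p : ℕ) : ℂ) ^ (-(a + y * Complex.I))) := by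
      intro y
      simp only [hf]
      ring
    simp_rw [h4]
    rw [MeasureTheory.integral_const_mul, h3]
    ring
  have hint : ∫ y : ℝ, ∑' p, f p y =
      ∫ y : ℝ, windowKernel v s (a + y * Complex.I) * F.primeSeries χ (a + y * Complex.I) := by
    refine MeasureTheory.integral_congr_ae (Eventually.of_forall fun y ↦ ?_)
    simp only [hf]
    rw [tsum_mul_left]
    rfl
  rw [← hint, ← hmain.tsum_eq]
  simp_rw [hterm]
  have hfin : ∑' p : Nat.Primes, (tri (Real.log (p : ℕ) - v) : ℂ) *
      (F.coeff p * χ ((p : ℕ) : ZMod q) * ((p : ℕ) : ℂ) ^ (-s)) = F.primeWindow χ S v s := by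
    have h3 : ∀ p : Nat.Primes, p ∉ (S.subtype Nat.Prime : Finset Nat.Primes) →
        (tri (Real.log (p : ℕ) - v) : ℂ) *
          (F.coeff p * χ ((p : ℕ) : ZMod q) * ((p : ℕ) : ℂ) ^ (-s)) = 0 := by
      intro p hp
      have h3 : tri (Real.log (p : ℕ) - v) = 0 := by
        by_contra h
        exact hp (Finset.mem_subtype.2 (hSv p p.2 h))
      simp [h3]
    rw [tsum_eq_sum h3]
    have h4 := Finset.sum_subtype_eq_sum_filter (s := S) (p := Nat.Prime)
      (fun p : ℕ ↦ (tri (Real.log p - v) : ℂ) * (F.coeff p * χ (p : ZMod q) * (p : ℂ) ^ (-s)))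
    rw [Finset.filter_true_of_mem hS] at h4
    exact h4
  rw [tsum_mul_left, hfin]

end LData

section Asymptotics

theorem eventually_mul_le_mul_pow (A : ℝ) {K : ℝ} (hK : 0 < K) :
    ∀ᶠ x : ℝ in atTop, A * x ≤ K * x ^ 100 := by
  have h : Tendsto (fun x : ℝ ↦ K * x ^ 99) atTop atTop :=
    (tendsto_pow_atTop (by norm_num)).const_mul_atTop hK
  filter_upwards [h.eventually_ge_atTop A, eventually_ge_atTop 0] with x hx h0
  calc A * x ≤ K * x ^ 99 * x := by gcongr
    _ = K * x ^ 100 := by ring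

theorem eventually_mul_pow_le_exp (K : ℝ) : ∀ᶠ x : ℝ in atTop, K * x ^ 100 ≤ Real.exp x := by
  have h := (Real.isLittleO_pow_exp_atTop (n := 100)).bound (c := (|K| + 1)⁻¹) (by positivity)
  filter_upwards [h, eventually_ge_atTop 0] with x hx h0
  rw [Real.norm_of_nonneg (by positivity), Real.norm_of_nonneg (Real.exp_pos _).le,
    inv_mul_eq_div, le_div_iff₀ (by positivity)] at hx
  have : 0 ≤ x ^ 100 := by positivity
  nlinarith [le_abs_self K]

/-- With `x = log q`, the width of the zero free region exceeds any multiple of `1 / log q`. -/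
theorem eventually_div_le_min {c β : ℝ} (hc : 0 < c) (hβ1 : β < 1) (A : ℝ) :
    ∀ᶠ x : ℝ in atTop, A / x ≤ min (c / (2 * x) ^ β) (1 / 10) := by
  have h1 : Tendsto (fun x : ℝ ↦ c / 2 ^ β * x ^ (1 - β)) atTop atTop :=
    (tendsto_rpow_atTop (by linarith)).const_mul_atTop (by positivity)
  filter_upwards [h1.eventually_ge_atTop A, eventually_gt_atTop 0, eventually_ge_atTop (10 * A)]
    with x hx h0 h2
  rw [le_min_iff]
  constructor
  · rw [Real.mul_rpow (by norm_num) h0.le, div_le_iff₀ h0]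
    rw [Real.rpow_sub h0, Real.rpow_one] at hx
    calc A ≤ _ := hx
      _ = _ := by field_simp
  · rw [div_le_iff₀ h0]
    linarith

/-- With `x = log q`, the product of the width of the zero free region and of `v ≥ log^β' q` exceeds any
multiple of `log log q`: this is where `β < β'` is used. -/
theorem eventually_log_le_rpow_mul_min {c β β' : ℝ} (hc : 0 < c) (hβ0 : 0 ≤ β) (hβ : β < β')
    (A : ℝ) :
    ∀ᶠ x : ℝ in atTop, A * Real.log x ≤ x ^ β' * min (c / (2 * x) ^ β) (1 / 10) := by
  have key : ∀ r : ℝ, 0 < r → ∀ k : ℝ, 0 < k → ∀ᶠ x : ℝ in atTop, A * Real.log x ≤ k * x ^ r := by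
    intro r hr k hk
    have h := (isLittleO_log_rpow_atTop hr).bound (c := k / (|A| + 1)) (by positivity)
    filter_upwards [h, eventually_ge_atTop 1] with x hx h1
    rw [Real.norm_of_nonneg (Real.log_nonneg h1), Real.norm_of_nonneg (by positivity),
      div_mul_eq_mul_div, le_div_iff₀ (by positivity)] at hx
    have := Real.log_nonneg h1
    nlinarith [le_abs_self A]
  filter_upwards [key (β' - β) (by linarith) (c / 2 ^ β) (by positivity),
    key β' (by linarith) (1 / 10) (by norm_num), eventually_gt_atTop 0] with x h1 h2 h0
  rw [mul_min_of_nonneg _ _ (by positivity), le_min_iff]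
  constructor
  · rw [Real.mul_rpow (by norm_num) h0.le]
    rw [Real.rpow_sub h0] at h1
    calc A * Real.log x ≤ _ := h1
      _ = _ := by field_simp
  · linarith

end Asymptotics

namespace LData

variable {d : ℕ} {F : LData d}

/-- The conductor is only bounded at moduli that have a primitive character. -/
theorem Axioms.exists_conductor_le (hF : F.Axioms) :
    ∃ K : ℝ, 1 ≤ K ∧ ∀ᶠ q : ℕ in atTop, ∀ χ : DirichletCharacter ℂ q, χ.IsPrimitive →
      F.N q ≤ K * (q : ℝ) ^ d := by
  obtain ⟨K, hK⟩ := hF.conductor_bound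
  refine ⟨max K 1, le_max_right _ _, ?_⟩
  filter_upwards [hK] with q hq χ hχ
  refine (hq χ hχ).2.trans ?_
  gcongr
  exact le_max_left _ _

/-- The growth of the exponential of the continued prime sum. -/
theorem Axioms.exists_norm_L_mul_exp_le (hF : F.Axioms) (hA : F.RamanujanBound) (ε : ℂ) {K : ℝ}
    (hK1 : 1 ≤ K) :
    ∃ M : ℝ, ∀ (q : ℕ) (χ : DirichletCharacter ℂ q), 2 ≤ q → χ.IsPrimitive → χ (-1) = ε →
      F.N q ≤ K * (q : ℝ) ^ d → ∀ z : ℂ, 9 / 10 ≤ z.re → z.re ≤ 2 →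
        ‖F.L χ z‖ * ‖Complex.exp (-F.logRemainder χ z)‖ ≤
          Real.exp (M + 3 * d * Real.log q + 2 * d * |z.im|) := by
  obtain ⟨C_L, hC_L, hL⟩ := hF.exists_norm_L_le ε
  obtain ⟨C_E, hC_E⟩ : ∃ C : ℝ, C = ∑' p : Nat.Primes, (d : ℝ) *
    (2 * ((p : ℕ) : ℝ) ^ (-(9 / 5) : ℝ)) := ⟨_, rfl⟩
  refine ⟨Real.log (C_L * (8 * K ^ 3)) + C_E, fun q χ hq2 hχ hχε hNK z hzre hz2 ↦ ?_⟩
  have hN := hF.conductor_pos q hq2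
  have hq0 : (0:ℝ) < q := by positivity
  have hq1 : (1:ℝ) ≤ q := by exact_mod_cast (by omega : 1 ≤ q)
  have h1 := hL q χ hq2 hχ hχε z (by linarith) hz2
  have h2 : ‖Complex.exp (-F.logRemainder χ z)‖ ≤ Real.exp C_E := by
    rw [Complex.norm_exp, Real.exp_le_exp]
    have h3 := hA.norm_logRemainder_le χ hzre
    have h4 := Complex.re_le_norm (-F.logRemainder χ z)
    rw [norm_neg] at h4
    rw [hC_E]
    exact h4.trans h3
  have h6 : Real.exp (3 * d * Real.log q) = ((q:ℝ) ^ d) ^ 3 := by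
    rw [← pow_mul]
    nth_rewrite 2 [← Real.exp_log hq0]
    rw [← Real.exp_nat_mul]
    congr 1
    push_cast
    ring
  have h5 : (1 + F.N q) ^ 3 ≤ 8 * K ^ 3 * Real.exp (3 * d * Real.log q) := by
    have h7 : 1 ≤ (q:ℝ) ^ d := one_le_pow₀ hq1
    have h8 : 1 + F.N q ≤ 2 * K * (q:ℝ) ^ d := by nlinarith
    calc (1 + F.N q) ^ 3 ≤ (2 * K * (q:ℝ) ^ d) ^ 3 := by gcongr
      _ = _ := by rw [h6]; ring
  have h8 : Real.exp (Real.log (C_L * (8 * K ^ 3))) = C_L * (8 * K ^ 3) :=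
    Real.exp_log (by positivity)
  calc _ ≤ C_L * (8 * K ^ 3 * Real.exp (3 * d * Real.log q)) * Real.exp (2 * d * |z.im|) *
        Real.exp C_E := by
        refine mul_le_mul (h1.trans ?_) h2 (norm_nonneg _) (by positivity)
        exact mul_le_mul_of_nonneg_right (mul_le_mul_of_nonneg_left h5 hC_L.le)
          (Real.exp_pos _).le
    _ = _ := by
        rw [Real.exp_add, Real.exp_add, Real.exp_add, h8]
        ring

set_option maxHeartbeats 1000000 in
/-- The zero free region makes every window of the prime sum smaller than its trivial bound
`e^{v (1 - Re s)}` by a large power of `log q`, for windows beyond `exp (log^β' q)`. -/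
theorem Axioms.exists_norm_primeWindow_le (hF : F.Axioms) (hA : F.RamanujanBound) (ε : ℂ)
    {c β β' K₁ : ℝ} (hc : 0 < c) (hβ0 : 0 ≤ β) (hβ : β < β') (hβ1 : β' < 1) (hK₁ : 0 < K₁) :
    ∃ C : ℝ, 0 < C ∧ ∀ᶠ q : ℕ in atTop, ∀ χ : DirichletCharacter ℂ q, χ.IsPrimitive →
      χ (-1) = ε →
      (∀ σ t : ℝ, 1 - c / Real.log (q * (K₁ * Real.log q ^ 100)) ^ β < σ →
        |t| ≤ K₁ * Real.log q ^ 100 → F.L χ (σ + t * Complex.I) ≠ 0) →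
      ∀ (S : Finset ℕ) (v : ℝ), (∀ p ∈ S, p.Prime) →
      (∀ p : ℕ, p.Prime → tri (Real.log p - v) ≠ 0 → p ∈ S) →
      Real.log q ^ β' ≤ v → v ≤ Real.log q →
      ∀ s : ℂ, (s.re = 3 / 5 ∨ s.re = 5 / 2) → |s.im| ≤ Real.log q →
        ‖F.primeWindow χ S v s‖ ≤ C * Real.exp (v * (1 - s.re)) / Real.log q ^ 90 := by
  obtain ⟨K, hK1, hK⟩ := hF.exists_conductor_le
  obtain ⟨M₀, hL'⟩ := hF.exists_norm_L_mul_exp_le hA ε hK1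
  obtain ⟨C_P, hC_P, hP⟩ := hA.exists_norm_primeSeries_le
  have hlog : Tendsto (fun q : ℕ ↦ Real.log q) atTop atTop :=
    Real.tendsto_log_atTop.comp tendsto_natCast_atTop_atTop
  set D : ℝ := 12 * d + 7 with hD
  have hD0 : 0 < D := by positivity
  refine ⟨7200 * C_P / K₁ + 28800 * D / K₁ + 1200 * D * K₁, by positivity, ?_⟩
  have e1 := hlog.eventually (eventually_mul_le_mul_pow (|M₀| + 3 * d + 18 * C_P + 6) hK₁)
  have e2 := hlog.eventually (eventually_mul_pow_le_exp K₁)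
  have e3 := hlog.eventually (eventually_div_le_min hc (hβ.trans hβ1) (2 / 5))
  have e4 := hlog.eventually (eventually_log_le_rpow_mul_min hc hβ0 hβ 400)
  filter_upwards [hK, e1, e2, e3, e4, hlog.eventually_ge_atTop 20, eventually_ge_atTop 2]
    with q hNq e1 e2 e3 e4 hx20 hq2 χ hχ hχε hzf S v hS hSv hv1 hv2 s hs him
  have hNK := hNq χ hχ
  have hN := hF.conductor_pos q hq2
  have hq0 : (0:ℝ) < q := by positivity
  have hq1 : (1:ℝ) ≤ q := by exact_mod_cast (by omega : 1 ≤ q)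
  set x := Real.log q with hx
  have hx0 : 0 < x := by linarith
  set T := K₁ * x ^ 100 with hT
  have hqx : Real.exp x = q := Real.exp_log hq0
  rw [hqx] at e2
  have hTx : (|M₀| + 3 * d + 18 * C_P + 6) * x ≤ T := e1
  have hd0 : (0:ℝ) ≤ d := Nat.cast_nonneg d
  have hT6 : 6 * x ≤ T := le_trans (by gcongr; linarith [abs_nonneg M₀]) hTx
  have hTC : 18 * C_P * x ≤ T := le_trans (by gcongr; linarith [abs_nonneg M₀]) hTx
  have hTM : (|M₀| + 3 * d) * x ≤ T :=
    le_trans (mul_le_mul_of_nonneg_right (by linarith) hx0.le) hTx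
  have hT0 : 0 < T := by linarith
  clear_value T x D
  -- The zero free region contains the half strip of width `l`; the minimum with `1/10` keeps it to the right
  -- of `Re s = 9/10`, where the contribution of the prime powers is bounded.
  set l := min (c / (2 * x) ^ β) (1 / 10) with hl
  have hl0 : 0 < l := lt_min (by positivity) (by norm_num)
  have hl10 : l ≤ 1 / 10 := min_le_right _ _
  have hlx : 2 / 5 / x ≤ l := e3
  have hlogqT : Real.log (q * T) ≤ 2 * x := by
    rw [Real.log_mul hq0.ne' hT0.ne']
    have := Real.log_le_log hT0 e2
    linarith
  have hlogqT0 : 0 < Real.log (q * T) := Real.log_pos (by nlinarith)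
  have hlc : l ≤ c / Real.log (q * T) ^ β := (min_le_left _ _).trans (by gcongr)
  clear_value l
  have hzf' : ∀ z ∈ halfStrip (1 - l) T, F.L χ z ≠ 0 := by
    intro z hz
    have := hzf z.re z.im (by linarith [hz.1]) hz.2.le
    rwa [Complex.re_add_im] at this
  obtain ⟨h, hhd, hhP, hhexp⟩ := hF.exists_primeSeries_continuation hA hq2 hχ hl0 hl10 hT0 hzf'
  -- The logarithm of `|L(s)|` is `O(T)`, as `T` is larger than `log q`.
  have hM : 0 < (2 * d + 1) * T := by positivity
  have hgrow : ∀ z ∈ halfStrip (1 - l) T, z.re ≤ 2 →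
      ‖Complex.exp (h z)‖ ≤ Real.exp ((2 * d + 1) * T) := by
    intro z hz hz2
    have hzre : 9 / 10 ≤ z.re := by linarith [hz.1]
    rw [hhexp z hz, norm_mul]
    refine (hL' q χ hq2 hχ hχε (hNq χ hχ) z hzre hz2).trans (Real.exp_le_exp.2 ?_)
    have h10 : M₀ ≤ |M₀| * x := by
      have := le_abs_self M₀
      have := abs_nonneg M₀
      nlinarith
    have h11 : 2 * d * |z.im| ≤ 2 * d * T := by
      have := hz.2.le
      gcongr
    rw [← hx]
    linarith
  -- The contour starts at `Re z = 1 + 1 / log q`, where `e^{v (a - 1)}` is bounded for `v ≤ log q`.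
  set a : ℝ := 1 + 1 / x with ha
  have hinvx : 1 / x ≤ 1 / 20 := by
    rw [div_le_div_iff₀ hx0 (by norm_num)]; linarith
  have hinvx0 : 0 < 1 / x := by positivity
  have hal : a ≤ 1 + 5 / 2 * l := by
    have : 5 / 2 * (2 / 5 / x) = 1 / x := by field_simp
    linarith
  have hbound : ∀ z : ℂ, 1 - l / 2 ≤ z.re → z.re ≤ a → |z.im| ≤ T - 1 → ‖h z‖ ≤ D * T := by
    intro z hz1 hz2 hz3
    refine (norm_continuation_le hl0 hl10 hM hhd hgrow hz1 (hz2.trans hal) hz3).trans ?_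
    have h1 : (1 + l + z.im * Complex.I : ℂ).re = 1 + l := by simp
    have h2 : (1 + l + z.im * Complex.I : ℂ) ∈ halfStrip 1 T := by
      refine ⟨by rw [h1]; linarith, ?_⟩
      simp
      linarith
    rw [hhP _ h2]
    have h3 := hP q χ (1 + l + z.im * Complex.I) (by rw [h1]; linarith) (by rw [h1]; linarith)
    rw [h1] at h3
    have h4 : C_P / (1 + l - 1) ≤ 5 / 2 * C_P * x := by
      rw [add_sub_cancel_left, div_le_iff₀ hl0]
      have : 2 / 5 ≤ l * x := by rwa [div_le_iff₀ hx0] at hlx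
      nlinarith
    have h5 : 7 * (5 / 2 * C_P * x) ≤ T := by
      have : 0 ≤ C_P * x := by positivity
      linarith
    calc _ ≤ 6 * ((2 * d + 1) * T) + 7 * (5 / 2 * C_P * x) := by gcongr; exact h3.trans h4
      _ ≤ _ := by rw [hD]; linarith
  clear_value a
  obtain ⟨T', hT'⟩ : ∃ T' : ℝ, T' = T - 1 := ⟨_, rfl⟩
  have hT'T : T / 2 ≤ T' := by linarith
  have hmem : ∀ z ∈ Set.Icc (1 - l / 2) a ×ℂ Set.Icc (-T') T',
      1 - l / 2 ≤ z.re ∧ z.re ≤ a ∧ |z.im| ≤ T - 1 := by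
    rw [← hT']
    exact fun z hz ↦ ⟨hz.1.1, hz.1.2, abs_le.2 hz.2⟩
  have hv0 : 0 ≤ v := le_trans (by positivity) hv1
  have hre : ∀ y ∈ Set.Icc (1 - l / 2) a, 1 / 4 ≤ |y - s.re| ∧ |y - s.re| ≤ 2 := by
    intro y hy
    have h1 := hy.1
    have h2 := hy.2
    rcases hs with hs | hs
    · rw [hs, abs_of_pos (by linarith)]
      constructor <;> linarith
    · rw [hs, abs_of_neg (by linarith)]
      constructor <;> linarith
  have hPa : ∀ y : ℝ, ‖F.primeSeries χ (a + y * Complex.I)‖ ≤ C_P * x := by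
    intro y
    have h1 : (a + y * Complex.I : ℂ).re = a := by simp
    have h3 := hP q χ (a + y * Complex.I) (by rw [h1]; linarith) (by rw [h1]; linarith)
    rw [h1] at h3
    refine h3.trans (le_of_eq ?_)
    rw [ha, add_sub_cancel_left]
    field_simp
  have hPc : Continuous fun y : ℝ ↦ F.primeSeries χ (a + y * Complex.I) := by
    rw [continuous_iff_continuousAt]
    intro y
    have h1 : (a + y * Complex.I : ℂ) ∈ {s : ℂ | 1 < s.re} := by
      simp only [Set.mem_ofPred_eq]
      simp
      linarith
    have h2 := ((hA.differentiableOn_primeSeries χ).differentiableAt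
      ((isOpen_lt_re 1).mem_nhds h1)).continuousAt
    exact ContinuousAt.comp (f := fun y : ℝ ↦ (a + y * Complex.I : ℂ)) h2
      (by fun_prop)
  have hE : Real.exp (v * (a - 1)) ≤ 3 := by
    have h1 : v * (a - 1) ≤ 1 := by
      rw [ha, add_sub_cancel_left, mul_one_div, div_le_one hx0]
      exact hv2
    exact (Real.exp_le_exp.2 h1).trans (by linarith [Real.exp_one_lt_d9])
  have hmain := norm_integral_windowKernel_le (P := F.primeSeries χ) (h := h) (a := a)
    (b := 1 - l / 2) (T := T') (v := v) (B := D * T) (P₀ := C_P * x) (E := 3) (s := s)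
    (by linarith) (by linarith) (by linarith) (by linarith) hv0 hre
    (hhd.mono fun z hz ↦ by
      obtain ⟨h1, h2, h3⟩ := hmem z hz
      exact ⟨by linarith, by linarith⟩)
    (fun y hy ↦ hhP _ ⟨by simp; linarith, by
      have := abs_le.2 hy
      simp
      linarith⟩)
    (fun z hz ↦ by
      obtain ⟨h1, h2, h3⟩ := hmem z hz
      exact hbound z h1 h2 h3) hPa hPc hE
  rw [← hA.primeWindow_eq_integral (by linarith)
    (hre a ⟨by linarith, le_rfl⟩).1 (hre a ⟨by linarith, le_rfl⟩).2 hS hSv] at hmain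
  have h2pi : ‖F.primeWindow χ S v s‖ ≤ ‖2 * (Real.pi : ℂ) * F.primeWindow χ S v s‖ := by
    rw [norm_mul, norm_mul, Complex.norm_ofNat, Complex.norm_real,
      Real.norm_of_nonneg Real.pi_pos.le]
    have := norm_nonneg (F.primeWindow χ S v s)
    nlinarith [Real.pi_gt_three]
  refine h2pi.trans (hmain.trans ?_)
  have hx90 : (0:ℝ) < x ^ 90 := by positivity
  -- The zero free region saves `exp (-v l / 2) ≤ log^{-200} q`.
  have hsave : Real.exp (-(v * (1 - (1 - l / 2)))) ≤ 1 / x ^ 200 := by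
    have h1 : 200 * Real.log x ≤ v * (l / 2) := by
      have h2 : x ^ β' * l ≤ v * l := by gcongr
      linarith
    have h3 : (x ^ 200 : ℝ) = Real.exp (200 * Real.log x) := by
      have : (200:ℝ) * Real.log x = ((200:ℕ):ℝ) * Real.log x := by norm_num
      rw [this, Real.exp_nat_mul, Real.exp_log hx0]
    rw [h3, one_div, ← Real.exp_neg, Real.exp_le_exp]
    linarith
  have hx1 : (1:ℝ) ≤ x := by linarith
  have t1 : 1200 * 3 * (C_P * x) / T' ≤ 7200 * C_P / K₁ / x ^ 90 := by
    calc _ ≤ 1200 * 3 * (C_P * x) / (T / 2) := by gcongr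
      _ = 7200 * C_P / K₁ / x ^ 99 := by rw [hT]; field_simp; ring
      _ ≤ _ := by gcongr; first | exact hx1 | norm_num
  have t2 : 2400 * 3 * (D * T) / T' ^ 2 ≤ 28800 * D / K₁ / x ^ 90 := by
    calc _ ≤ 2400 * 3 * (D * T) / (T / 2) ^ 2 := by gcongr
      _ = 28800 * D / K₁ / x ^ 100 := by rw [hT]; field_simp; ring
      _ ≤ _ := by gcongr; first | exact hx1 | norm_num
  have t3 : 1200 * (D * T) * Real.exp (-(v * (1 - (1 - l / 2)))) ≤ 1200 * D * K₁ / x ^ 90 := by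
    calc _ ≤ 1200 * (D * T) * (1 / x ^ 200) := by gcongr
      _ = 1200 * D * K₁ / x ^ 100 := by rw [hT]; field_simp
      _ ≤ _ := by gcongr; first | exact hx1 | norm_num
  calc _ ≤ Real.exp (v * (1 - s.re)) * (7200 * C_P / K₁ / x ^ 90 + 28800 * D / K₁ / x ^ 90 +
        1200 * D * K₁ / x ^ 90) := by gcongr
    _ = _ := by ring

end LData

/-! ### Integrals on vertical lines -/

theorem integrable_exp_neg_abs : MeasureTheory.Integrable fun y : ℝ ↦ Real.exp (-|y|) := by
  have h1 : MeasureTheory.IntegrableOn (fun y : ℝ ↦ Real.exp (-|y|)) (Set.Ioi 0) := by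
    refine (integrableOn_exp_neg_Ioi 0).congr_fun (fun y hy ↦ ?_) measurableSet_Ioi
    simp only [abs_of_pos (Set.mem_Ioi.1 hy)]
  have h2 : MeasureTheory.IntegrableOn (fun y : ℝ ↦ Real.exp (-|y|)) (Set.Iic 0) := by
    refine (integrableOn_exp_Iic 0).congr_fun (fun y hy ↦ ?_) measurableSet_Iic
    simp only [abs_of_nonpos (Set.mem_Iic.1 hy), neg_neg]
  have := h2.union h1
  rwa [Set.Iic_union_Ioi, MeasureTheory.integrableOn_univ] at this

theorem integral_exp_neg_abs : ∫ y : ℝ, Real.exp (-|y|) = 2 := by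
  rw [integral_comp_abs (f := fun y ↦ Real.exp (-y)), integral_exp_neg_Ioi_zero, mul_one]

/-- Moving a vertical line of integration across a strip in which the integrand is holomorphic and
decays exponentially. -/
theorem integral_vertical_eq_of_norm_le {f : ℂ → ℂ} {a b C : ℝ} (hab : a ≤ b)
    (hf : DifferentiableOn ℂ f {s : ℂ | a ≤ s.re ∧ s.re ≤ b})
    (hC : ∀ s : ℂ, a ≤ s.re → s.re ≤ b → ‖f s‖ ≤ C * Real.exp (-|s.im|)) :
    ∫ y : ℝ, f (a + y * Complex.I) = ∫ y : ℝ, f (b + y * Complex.I) := by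
  have hint : ∀ c : ℝ, a ≤ c → c ≤ b →
      MeasureTheory.Integrable fun y : ℝ ↦ f (c + y * Complex.I) := by
    intro c h1 h2
    refine (integrable_exp_neg_abs.const_mul C).mono' ?_ (Eventually.of_forall fun y ↦ ?_)
    · refine Continuous.aestronglyMeasurable ?_
      refine hf.continuousOn.comp_continuous (by fun_prop) fun y ↦ ?_
      simp [h1, h2]
    · have := hC (c + y * Complex.I) (by simpa using h1) (by simpa using h2)
      simpa using this
  have hlim := fun c h1 h2 ↦ MeasureTheory.intervalIntegral_tendsto_integral (hint c h1 h2)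
    tendsto_neg_atTop_atBot tendsto_id
  have hhor : ∀ y₀ : ℝ, ‖∫ x in a..b, f (x + y₀ * Complex.I)‖ ≤
      C * Real.exp (-|y₀|) * |b - a| := by
    intro y₀
    refine intervalIntegral.norm_integral_le_of_norm_le_const fun x hx ↦ ?_
    rw [Set.uIoc_of_le hab] at hx
    have := hC (x + y₀ * Complex.I) (by simpa using hx.1.le) (by simpa using hx.2)
    simpa using this
  have hrect : ∀ T : ℝ, 0 ≤ T → ‖(∫ y in (-T)..T, f (b + y * Complex.I)) -
      ∫ y in (-T)..T, f (a + y * Complex.I)‖ ≤ 2 * (C * |b - a|) * Real.exp (-T) := by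
    intro T hT
    have h := Complex.integral_boundary_rect_eq_zero_of_differentiableOn f ⟨a, -T⟩ ⟨b, T⟩
      (hf.mono fun z hz ↦ by
        have := hz.1
        simpa [Set.uIcc_of_le hab] using this)
    simp only at h
    have h1 : Complex.I * ((∫ y in (-T)..T, f (b + y * Complex.I)) -
        ∫ y in (-T)..T, f (a + y * Complex.I)) =
        (∫ x in a..b, f (x + (T:ℝ) * Complex.I)) -
          ∫ x in a..b, f (x + ((-T:ℝ) : ℂ) * Complex.I) := by
      simp only [smul_eq_mul] at h
      linear_combination h
    have h2 := congrArg norm h1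
    rw [norm_mul, Complex.norm_I, one_mul] at h2
    rw [h2]
    refine (norm_sub_le _ _).trans ((add_le_add (hhor T) (hhor (-T))).trans (le_of_eq ?_))
    rw [abs_neg, abs_of_nonneg hT]
    ring
  have hzero : Tendsto (fun T : ℝ ↦ (∫ y in (-T)..T, f (b + y * Complex.I)) -
      ∫ y in (-T)..T, f (a + y * Complex.I)) atTop (𝓝 0) := by
    refine squeeze_zero_norm' ((eventually_ge_atTop 0).mono hrect) ?_
    have := Real.tendsto_exp_neg_atTop_nhds_zero.const_mul (2 * (C * |b - a|))
    simpa using this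
  have h := tendsto_nhds_unique hzero ((hlim b hab le_rfl).sub (hlim a le_rfl hab))
  exact (sub_eq_zero.1 h.symm).symm

/-- The integral of `e^{s²} / s` on a vertical line is half of `2π` by symmetry; here it is computed
from `1 / s = ∫₀^∞ e^{-sx} dx`. -/
theorem integral_exp_sq_div_vertical :
    ∫ y : ℝ, Complex.exp ((2 + y * Complex.I) ^ 2) / (2 + y * Complex.I) = Real.pi := by
  set f : ℝ → ℝ → ℂ := fun y x ↦ Complex.exp ((2 + y * Complex.I) ^ 2) *
    Complex.exp (-(2 + y * Complex.I) * x) with hf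
  have h1 : ∀ y : ℝ, ∫ x in Set.Ioi (0:ℝ), f y x =
      Complex.exp ((2 + y * Complex.I) ^ 2) / (2 + y * Complex.I) := by
    intro y
    simp only [hf]
    have := integral_exp_mul_complex_Ioi (a := -(2 + y * Complex.I)) (by simp) 0
    rw [MeasureTheory.integral_const_mul, this]
    simp [div_eq_mul_inv, neg_inv]
  have hnorm : ∀ y x : ℝ, ‖f y x‖ = (Real.exp 4 * Real.exp (-1 * y ^ 2)) * Real.exp (-2 * x) := by
    intro y x
    simp only [hf]
    rw [norm_mul, Complex.norm_exp, Complex.norm_exp, ← Real.exp_add, ← Real.exp_add,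
      ← Real.exp_add]
    congr 1
    simp [pow_two]
    ring
  have hg : MeasureTheory.Integrable (fun y : ℝ ↦ Real.exp 4 * Real.exp (-1 * y ^ 2)) :=
    (integrable_exp_neg_mul_sq one_pos).const_mul _
  have he : MeasureTheory.IntegrableOn (fun x : ℝ ↦ Real.exp (-2 * x)) (Set.Ioi 0) :=
    integrableOn_exp_mul_Ioi (by norm_num) 0
  have hint : MeasureTheory.Integrable (Function.uncurry f)
      (MeasureTheory.volume.prod (MeasureTheory.volume.restrict (Set.Ioi 0))) := by
    refine (hg.mul_prod he).mono' ?_ (Eventually.of_forall fun z ↦ ?_)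
    · refine Continuous.aestronglyMeasurable ?_
      simp only [hf, Function.uncurry_def]
      fun_prop
    · exact (hnorm z.1 z.2).le
  have hswap := MeasureTheory.integral_integral_swap hint
  simp_rw [h1] at hswap
  rw [hswap]
  have h2 : ∀ x : ℝ, ∫ y : ℝ, f y x =
      ((Real.sqrt Real.pi * Real.exp (-(1 / 4) * x ^ 2) : ℝ) : ℂ) := by
    intro x
    have h3 := integral_cexp_quadratic (b := -1) (by simp) ((4 - x) * Complex.I) (4 - 2 * x)
    have h4 : ∀ y : ℝ, f y x =
        Complex.exp (-1 * (y:ℂ) ^ 2 + (4 - x) * Complex.I * y + (4 - 2 * x)) := by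
      intro y
      simp only [hf]
      rw [← Complex.exp_add]
      congr 1
      linear_combination ((y:ℂ) ^ 2) * Complex.I_sq
    simp_rw [h4]
    rw [h3]
    have h5 : ((Real.pi : ℂ) / - -1) ^ (1 / 2 : ℂ) = Real.sqrt Real.pi := by
      rw [neg_neg, div_one, Real.sqrt_eq_rpow, Complex.ofReal_cpow Real.pi_pos.le]
      norm_num
    rw [h5]
    push_cast
    congr 2
    linear_combination (1 / 4 * (4 - (x:ℂ)) ^ 2) * Complex.I_sq
  simp_rw [h2]
  rw [integral_complex_ofReal, MeasureTheory.integral_const_mul, integral_gaussian_Ioi]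
  congr 1
  have h3 : Real.sqrt (Real.pi / (1 / 4)) = 2 * Real.sqrt Real.pi := by
    rw [show Real.pi / (1 / 4) = 2 ^ 2 * Real.pi by ring, Real.sqrt_mul (by positivity),
      Real.sqrt_sq (by norm_num)]
  rw [h3]
  have := Real.mul_self_sqrt Real.pi_pos.le
  linarith

/-! ### The approximate functional equation -/

/-- The Gaussian factor beats any exponential growth in a strip. -/
theorem norm_exp_sq_mul_exp_le (k : ℝ) {s : ℂ} (hs : |s.re| ≤ 2) :
    ‖Complex.exp (s ^ 2)‖ * Real.exp (k * |s.im|) ≤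
      Real.exp (4 + (k + 1) ^ 2 / 4) * Real.exp (-|s.im|) := by
  rw [Complex.norm_exp, ← Real.exp_add, ← Real.exp_add, Real.exp_le_exp]
  have h1 : (s ^ 2).re = s.re ^ 2 - s.im ^ 2 := by rw [pow_two, Complex.mul_re]; ring
  have h2 : s.re ^ 2 ≤ 4 := by
    rw [← sq_abs]
    nlinarith [abs_nonneg s.re]
  rw [h1, ← sq_abs s.im]
  nlinarith [sq_nonneg (|s.im| - (k + 1) / 2)]

theorem norm_add_le_mul_exp (a : ℂ) {s : ℂ} (hs : |s.re| ≤ 2) :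
    ‖a + s‖ ≤ (3 + ‖a‖) * Real.exp |s.im| ∧ ‖a - s‖ ≤ (3 + ‖a‖) * Real.exp |s.im| := by
  have h1 := Complex.norm_le_abs_re_add_abs_im s
  have h2 := Real.add_one_le_exp |s.im|
  have h3 : ‖a‖ + ‖s‖ ≤ (3 + ‖a‖) * Real.exp |s.im| := by
    nlinarith [norm_nonneg a, abs_nonneg s.im]
  exact ⟨(norm_add_le _ _).trans h3, (norm_sub_le _ _).trans h3⟩

namespace LData

variable {d : ℕ} {F : LData d} {q : ℕ} {χ : DirichletCharacter ℂ q}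

/-- A polynomial that cancels the first pole of each `Γ_ℝ(1/2 + μ_j + s)`, the only one that may have real part
at least `0`. The second factor makes it compatible with the functional equation. -/
noncomputable def symmPoly (F : LData d) (ε s : ℂ) : ℂ :=
  ∏ j, ((1 / 2 + F.μ ε j + s) * (1 / 2 + conj (F.μ ε j) - s))

/-- The product of the factor at infinity at `1/2 + s`, of `symmPoly` and of `e^{s²} / s`, written without
the poles that cancel. -/
noncomputable def afeKernel (F : LData d) (ε s : ℂ) : ℂ :=
  (∏ j, (2 * Real.pi * Complex.Gammaℝ (5 / 2 + F.μ ε j + s) * (1 / 2 + conj (F.μ ε j) - s))) *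
    (Complex.exp (s ^ 2) / s)

theorem gammaInf_mul_symmPoly {ε s : ℂ} (h : ∀ j, 1 / 2 + F.μ ε j + s ≠ 0) :
    F.gammaInf ε (1 / 2 + s) * F.symmPoly ε s * (Complex.exp (s ^ 2) / s) = F.afeKernel ε s := by
  rw [gammaInf, symmPoly, afeKernel, ← Finset.prod_mul_distrib]
  congr 1
  refine Finset.prod_congr rfl fun j _ ↦ ?_
  have h1 := Complex.Gammaℝ_add_two (h j)
  have hpi : (Real.pi : ℂ) ≠ 0 := by exact_mod_cast Real.pi_ne_zero
  rw [show 5 / 2 + F.μ ε j + s = 1 / 2 + F.μ ε j + s + 2 by ring, h1,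
    show 1 / 2 + s + F.μ ε j = 1 / 2 + F.μ ε j + s by ring]
  field_simp

theorem symmPoly_neg_conj (ε s : ℂ) : F.symmPoly ε (-conj s) = conj (F.symmPoly ε s) := by
  rw [symmPoly, symmPoly, map_prod]
  refine Finset.prod_congr rfl fun j _ ↦ ?_
  simp only [map_mul, map_add, map_sub, Complex.conj_conj, map_div₀, map_one, Complex.conj_ofNat]
  ring

theorem exists_norm_symmPoly_le (F : LData d) (ε : ℂ) :
    ∃ C : ℝ, 0 < C ∧ ∀ s : ℂ, |s.re| ≤ 2 → ‖F.symmPoly ε s‖ ≤ C * Real.exp (2 * d * |s.im|) := by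
  refine ⟨∏ j, ((3 + ‖1 / 2 + F.μ ε j‖) * (3 + ‖1 / 2 + conj (F.μ ε j)‖)),
    Finset.prod_pos fun j _ ↦ by positivity, fun s hs ↦ ?_⟩
  have h3 : Real.exp (2 * d * |s.im|) = ∏ _j : Fin d, (Real.exp |s.im| * Real.exp |s.im|) := by
    rw [Finset.prod_const, Finset.card_univ, Fintype.card_fin, ← Real.exp_add, ← Real.exp_nat_mul]
    congr 1
    ring
  rw [symmPoly, norm_prod, h3, ← Finset.prod_mul_distrib]
  refine Finset.prod_le_prod (fun _ _ ↦ norm_nonneg _) fun j _ ↦ ?_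
  rw [norm_mul]
  calc _ ≤ _ := mul_le_mul (norm_add_le_mul_exp (1 / 2 + F.μ ε j) hs).1
        (norm_add_le_mul_exp (1 / 2 + conj (F.μ ε j)) hs).2 (norm_nonneg _) (by positivity)
    _ = _ := by ring

theorem exists_norm_afeKernel_le (F : LData d) {ε : ℂ} (hμ : ∀ j, -1 < (F.μ ε j).re) :
    ∃ C : ℝ, 0 < C ∧ ∀ s : ℂ, 1 / 10 ≤ s.re → s.re ≤ 2 →
      ‖F.afeKernel ε s‖ ≤ C * Real.exp (-|s.im|) := by
  choose C hC h using fun j ↦ Complex.exists_norm_Gammaℝ_le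
    (a := 5 / 2 + 1 / 10 + (F.μ ε j).re) (by linarith [hμ j]) (5 / 2 + 2 + (F.μ ε j).re)
  refine ⟨(∏ j, (2 * Real.pi * C j * (3 + ‖1 / 2 + conj (F.μ ε j)‖))) *
    (Real.exp (4 + (d + 1) ^ 2 / 4) * 10), ?_, fun s h1 h2 ↦ ?_⟩
  · refine mul_pos (Finset.prod_pos fun j _ ↦ ?_) (by positivity)
    have := hC j
    positivity
  have hs2 : |s.re| ≤ 2 := abs_le.2 ⟨by linarith, h2⟩
  have h3 : Real.exp (d * |s.im|) = ∏ _j : Fin d, Real.exp |s.im| := by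
    rw [Finset.prod_const, Finset.card_univ, Fintype.card_fin, ← Real.exp_nat_mul]
  have h4 : ‖∏ j, (2 * Real.pi * Complex.Gammaℝ (5 / 2 + F.μ ε j + s) *
      (1 / 2 + conj (F.μ ε j) - s))‖ ≤
      (∏ j, (2 * Real.pi * C j * (3 + ‖1 / 2 + conj (F.μ ε j)‖))) * Real.exp (d * |s.im|) := by
    rw [norm_prod, h3, ← Finset.prod_mul_distrib]
    refine Finset.prod_le_prod (fun _ _ ↦ norm_nonneg _) fun j _ ↦ ?_
    have h5 := h j (5 / 2 + F.μ ε j + s) (by simp; linarith) (by simp; linarith)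
    have h6 := (norm_add_le_mul_exp (1 / 2 + conj (F.μ ε j)) hs2).2
    have h7 := hC j
    rw [norm_mul, norm_mul, norm_mul, Complex.norm_ofNat, Complex.norm_real,
      Real.norm_of_nonneg Real.pi_pos.le]
    calc _ ≤ 2 * Real.pi * C j * ((3 + ‖1 / 2 + conj (F.μ ε j)‖) * Real.exp |s.im|) := by gcongr
      _ = _ := by ring
  have h5 : ‖s‖⁻¹ ≤ 10 := by
    have : 1 / 10 ≤ ‖s‖ := h1.trans (Complex.re_le_norm s)
    rw [inv_le_comm₀ (by linarith) (by norm_num)]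
    linarith
  have h6 : 0 ≤ ∏ j, (2 * Real.pi * C j * (3 + ‖1 / 2 + conj (F.μ ε j)‖)) :=
    Finset.prod_nonneg fun j _ ↦ by
      have := hC j
      positivity
  rw [afeKernel, norm_mul, norm_div, div_eq_mul_inv ‖Complex.exp (s ^ 2)‖]
  calc _ ≤ ((∏ j, (2 * Real.pi * C j * (3 + ‖1 / 2 + conj (F.μ ε j)‖))) * Real.exp (d * |s.im|)) *
        (‖Complex.exp (s ^ 2)‖ * 10) := by gcongr
    _ = (∏ j, (2 * Real.pi * C j * (3 + ‖1 / 2 + conj (F.μ ε j)‖))) *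
        (‖Complex.exp (s ^ 2)‖ * Real.exp (d * |s.im|)) * 10 := by ring
    _ ≤ (∏ j, (2 * Real.pi * C j * (3 + ‖1 / 2 + conj (F.μ ε j)‖))) *
        (Real.exp (4 + (d + 1) ^ 2 / 4) * Real.exp (-|s.im|)) * 10 := by
        exact mul_le_mul_of_nonneg_right
          (mul_le_mul_of_nonneg_left (norm_exp_sq_mul_exp_le d hs2) h6) (by norm_num)
    _ = _ := by ring

theorem differentiableOn_afeKernel (F : LData d) {ε : ℂ} (hμ : ∀ j, -1 < (F.μ ε j).re) :
    DifferentiableOn ℂ (F.afeKernel ε) {s : ℂ | 0 < s.re} := by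
  intro s hs
  have hs0 : 0 < s.re := hs
  have hsne : s ≠ 0 := fun h ↦ by simp [h] at hs0
  refine DifferentiableAt.differentiableWithinAt ?_
  unfold afeKernel
  refine DifferentiableAt.mul (DifferentiableAt.fun_finsetProd fun j _ ↦ ?_)
    (by fun_prop (disch := assumption))
  refine DifferentiableAt.mul ((differentiableAt_const _).mul ?_) (by fun_prop)
  suffices h : DifferentiableAt ℂ Complex.Gammaℝ (5 / 2 + F.μ ε j + s) from
    DifferentiableAt.comp (f := fun s ↦ 5 / 2 + F.μ ε j + s) s h (by fun_prop)
  have h1 : 0 < (5 / 2 + F.μ ε j + s).re := by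
    have := hμ j
    simp
    linarith
  have h2 := (Complex.differentiable_Gammaℝ_inv (5 / 2 + F.μ ε j + s)).inv
    (inv_ne_zero (Complex.Gammaℝ_ne_zero_of_re_pos h1))
  refine h2.congr_of_eventuallyEq (Eventually.of_forall fun z ↦ ?_)
  simp

/-- The completed function centred at `1/2`, made to decay in vertical strips by the factor `e^{s²}`, and with
the factor at infinity freed from its poles in `Re s ≥ 0`. -/
noncomputable def smoothedL (F : LData d) (χ : DirichletCharacter ℂ q) (s : ℂ) : ℂ :=
  F.completedL χ (1 / 2 + s) * F.symmPoly (χ (-1)) s * Complex.exp (s ^ 2)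

theorem Axioms.differentiable_smoothedL (hF : F.Axioms) (hq : 2 ≤ q) (hχ : χ.IsPrimitive) :
    Differentiable ℂ (F.smoothedL χ) := by
  have h := (hF.isEntireExtension hq hχ).1
  have h2 : Differentiable ℂ (F.symmPoly (χ (-1))) :=
    Differentiable.fun_finsetProd fun j _ ↦ by fun_prop
  unfold smoothedL
  fun_prop

theorem Axioms.exists_norm_smoothedL_le (hF : F.Axioms) (hq : 2 ≤ q) (hχ : χ.IsPrimitive) :
    ∃ C : ℝ, ∀ s : ℂ, |s.re| ≤ 2 → ‖F.smoothedL χ s‖ ≤ C * Real.exp (-|s.im|) := by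
  obtain ⟨C₁, hC₁, h₁⟩ := hF.exists_norm_normalizedL_le (χ (-1))
  obtain ⟨C₂, hC₂, h₂⟩ := F.exists_norm_symmPoly_le (χ (-1))
  have hN := hF.conductor_pos q hq
  refine ⟨C₁ * (1 + F.N q) ^ 3 * Real.exp (|Real.log (F.N q)| * 2) * C₂ *
    Real.exp (4 + (2 * d + 1) ^ 2 / 4), fun s hs ↦ ?_⟩
  have hs' := abs_le.1 hs
  have hre : (1 / 2 + s : ℂ).re = 1 / 2 + s.re := by simp
  have h3 : ‖F.completedL χ (1 / 2 + s)‖ ≤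
      C₁ * (1 + F.N q) ^ 3 * Real.exp (|Real.log (F.N q)| * 2) := by
    have h4 : F.completedL χ (1 / 2 + s) =
        F.normalizedL χ (1 / 2 + s) * (F.N q : ℂ) ^ ((1 / 2 + s) / 2) := by
      rw [normalizedL, mul_assoc, ← Complex.cpow_add _ _ (by exact_mod_cast hN.ne'),
        neg_add_cancel, Complex.cpow_zero, mul_one]
    have h5 : ((1 / 2 + s) / 2 : ℂ).re = (1 / 2 + s.re) / 2 := by
      rw [← hre]
      simp
    rw [h4, norm_mul, norm_conductor_cpow hN, h5, Real.rpow_def_of_pos hN]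
    have h6 := h₁ q χ hq hχ rfl (1 / 2 + s) (by rw [hre]; linarith) (by rw [hre]; linarith)
    refine mul_le_mul h6 (Real.exp_le_exp.2 ?_) (Real.exp_pos _).le (by positivity)
    refine (le_abs_self _).trans ?_
    rw [abs_mul]
    gcongr
    rw [abs_le]
    constructor <;> linarith
  rw [smoothedL, norm_mul, norm_mul]
  calc _ ≤ C₁ * (1 + F.N q) ^ 3 * Real.exp (|Real.log (F.N q)| * 2) *
        (C₂ * Real.exp (2 * d * |s.im|)) * ‖Complex.exp (s ^ 2)‖ := by
        gcongr
        exact h₂ s hs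
    _ = C₁ * (1 + F.N q) ^ 3 * Real.exp (|Real.log (F.N q)| * 2) * C₂ *
        (‖Complex.exp (s ^ 2)‖ * Real.exp (2 * d * |s.im|)) := by ring
    _ ≤ C₁ * (1 + F.N q) ^ 3 * Real.exp (|Real.log (F.N q)| * 2) * C₂ *
        (Real.exp (4 + (2 * d + 1) ^ 2 / 4) * Real.exp (-|s.im|)) := by
        exact mul_le_mul_of_nonneg_left (norm_exp_sq_mul_exp_le (2 * d) hs) (by positivity)
    _ = _ := by ring

theorem Axioms.exists_smoothedL_eq_conj (hF : F.Axioms) (hq : 2 ≤ q) (hχ : χ.IsPrimitive) :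
    ∃ κ : ℂ, ‖κ‖ = 1 ∧ ∀ s, F.smoothedL χ (-conj s) = κ * conj (F.smoothedL χ s) := by
  obtain ⟨κ, hκ, h⟩ := hF.exists_completedL_eq_conj hq hχ
  refine ⟨κ, hκ, fun s ↦ ?_⟩
  have h1 : 1 - conj (1 / 2 + -conj s) = 1 / 2 + s := by
    simp [Complex.conj_ofNat]
    ring
  rw [smoothedL, smoothedL, h, h1, symmPoly_neg_conj, map_mul, map_mul, ← Complex.exp_conj, map_pow,
    neg_sq]
  ring

end LData

/-- For an entire function that vanishes at `0`, the quotient by `s` has no pole between the two lines. -/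
theorem integral_div_sub_integral_div {g : ℂ → ℂ} (hg : Differentiable ℂ g) {C : ℝ}
    (hC : ∀ s : ℂ, |s.re| ≤ 2 → ‖g s‖ ≤ C * Real.exp (-|s.im|)) (h0 : g 0 = 0) :
    ∫ y : ℝ, g ((-2 : ℝ) + y * Complex.I) / ((-2 : ℝ) + y * Complex.I) =
      ∫ y : ℝ, g ((2 : ℝ) + y * Complex.I) / ((2 : ℝ) + y * Complex.I) := by
  have hslope : ∀ s : ℂ, s ≠ 0 → dslope g 0 s = g s / s := by
    intro s hs
    rw [dslope_of_ne _ hs, slope_def_field, h0, sub_zero, sub_zero]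
  have hd : Differentiable ℂ (dslope g 0) := by
    rw [← differentiableOn_univ, Complex.differentiableOn_dslope univ_mem]
    exact hg.differentiableOn
  have hC0 : 0 ≤ C := by
    have h := (norm_nonneg _).trans (hC 0 (by simp))
    simpa using h
  obtain ⟨M, hM⟩ := (isCompact_Icc (a := (-2:ℝ)) (b := 2)).reProdIm
    (isCompact_Icc (a := (-1:ℝ)) (b := 1)) |>.exists_bound_of_continuousOn
      hd.continuous.continuousOn
  have hM0 : 0 ≤ M := (norm_nonneg _).trans (hM 0 (by simp [Complex.mem_reProdIm]))
  have key := integral_vertical_eq_of_norm_le (f := dslope g 0) (a := -2) (b := 2)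
    (C := C + M * Real.exp 1) (by norm_num) hd.differentiableOn (fun s h1 h2 ↦ by
      rcases le_total 1 |s.im| with h | h
      · have hs : s ≠ 0 := fun h' ↦ by
          rw [h', Complex.zero_im, abs_zero] at h
          norm_num at h
        rw [hslope s hs, norm_div]
        have h3 : 1 ≤ ‖s‖ := h.trans (Complex.abs_im_le_norm s)
        calc _ ≤ ‖g s‖ := div_le_self (norm_nonneg _) h3
          _ ≤ C * Real.exp (-|s.im|) := hC s (abs_le.2 ⟨h1, h2⟩)
          _ ≤ _ := by
            gcongr
            have := Real.exp_pos 1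
            nlinarith
      · refine (hM s ⟨⟨h1, h2⟩, abs_le.1 h⟩).trans ?_
        have h3 : 1 ≤ Real.exp 1 * Real.exp (-|s.im|) := by
          rw [← Real.exp_add]
          exact Real.one_le_exp (by linarith)
        have h4 := Real.exp_pos (-|s.im|)
        nlinarith)
  have hne : ∀ c : ℝ, c ≠ 0 → ∀ y : ℝ, (c + y * Complex.I : ℂ) ≠ 0 := fun c hc y h ↦ hc (by
    simpa using congrArg Complex.re h)
  simp_rw [hslope _ (hne (-2) (by norm_num) _), hslope _ (hne 2 (by norm_num) _)] at key
  exact key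

namespace LData

variable {d : ℕ} {F : LData d} {q : ℕ} {χ : DirichletCharacter ℂ q}

/-- The central value is bounded by an integral in the half plane of absolute convergence: by the functional
equation the integrals of `Φ(s) / s` on `Re s = 2` and `Re s = -2` are conjugate up to a factor of
absolute value one, and their difference is the residue at `0`. -/
theorem Axioms.pi_mul_norm_smoothedL_zero_le (hF : F.Axioms) (hq : 2 ≤ q) (hχ : χ.IsPrimitive) :
    Real.pi * ‖F.smoothedL χ 0‖ ≤
      ‖∫ y : ℝ, F.smoothedL χ (2 + y * Complex.I) / (2 + y * Complex.I)‖ := by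
  obtain ⟨C, hC⟩ := hF.exists_norm_smoothedL_le hq hχ
  obtain ⟨κ, hκ, hconj⟩ := hF.exists_smoothedL_eq_conj hq hχ
  have hd := hF.differentiable_smoothedL hq hχ
  set Φ := F.smoothedL χ with hΦ
  set c := Φ 0 with hc
  have hE : ∀ s : ℂ, |s.re| ≤ 2 → ‖Complex.exp (s ^ 2)‖ ≤
      Real.exp (4 + (0 + 1) ^ 2 / 4) * Real.exp (-|s.im|) := by
    intro s hs
    have := norm_exp_sq_mul_exp_le 0 hs
    simpa using this
  -- Subtracting `Φ(0) e^{s²}` removes the residue; its integrals on both lines are explicit.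
  have key := integral_div_sub_integral_div (g := fun s ↦ Φ s - c * Complex.exp (s ^ 2))
    (by fun_prop) (C := C + ‖c‖ * Real.exp (4 + (0 + 1) ^ 2 / 4)) (fun s hs ↦ by
      refine (norm_sub_le _ _).trans ?_
      rw [norm_mul, add_mul, mul_assoc]
      gcongr
      · exact hC s hs
      · exact hE s hs) (by simp [hc])
  have hI : ∀ (r : ℝ), 1 ≤ |r| → |r| ≤ 2 → ∀ f : ℂ → ℂ, Continuous f → ∀ C : ℝ,
      (∀ s : ℂ, |s.re| ≤ 2 → ‖f s‖ ≤ C * Real.exp (-|s.im|)) →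
      MeasureTheory.Integrable fun y : ℝ ↦ f (r + y * Complex.I) / (r + y * Complex.I) := by
    intro r hr1 hr2 f hf C hfC
    have hne : ∀ y : ℝ, (r + y * Complex.I : ℂ) ≠ 0 := fun y h ↦ by
      have : r = 0 := by simpa using congrArg Complex.re h
      rw [this, abs_zero] at hr1
      norm_num at hr1
    refine (integrable_exp_neg_abs.const_mul C).mono'
      (Continuous.aestronglyMeasurable ?_) (Eventually.of_forall fun y ↦ ?_)
    · exact Continuous.div (by fun_prop) (by fun_prop) hne
    · have h1 := hfC (r + y * Complex.I) (by simpa using hr2)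
      have h2 : 1 ≤ ‖(r + y * Complex.I : ℂ)‖ := by
        have := Complex.abs_re_le_norm (r + y * Complex.I : ℂ)
        simp only [Complex.add_re, Complex.ofReal_re, Complex.mul_re, Complex.I_re, mul_zero,
          Complex.ofReal_im, Complex.I_im, mul_one, sub_self, add_zero] at this
        linarith
      rw [norm_div]
      refine (div_le_self (norm_nonneg _) h2).trans (h1.trans_eq ?_)
      simp
  have hsplit : ∀ r : ℝ, 1 ≤ |r| → |r| ≤ 2 →
      ∫ y : ℝ, (Φ (r + y * Complex.I) - c * Complex.exp ((r + y * Complex.I) ^ 2)) /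
        (r + y * Complex.I) = (∫ y : ℝ, Φ (r + y * Complex.I) / (r + y * Complex.I)) -
        c * ∫ y : ℝ, Complex.exp ((r + y * Complex.I) ^ 2) / (r + y * Complex.I) := by
    intro r h1 h2
    rw [← MeasureTheory.integral_const_mul, ← MeasureTheory.integral_sub
      (hI r h1 h2 Φ hd.continuous C hC)
      ((hI r h1 h2 (fun s ↦ Complex.exp (s ^ 2)) (by fun_prop) _ hE).const_mul c)]
    refine MeasureTheory.integral_congr_ae (Eventually.of_forall fun y ↦ ?_)
    simp only
    ring
  rw [hsplit (-2) (by norm_num) (by norm_num), hsplit 2 (by norm_num) (by norm_num)] at key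
  have hrefl : ∀ y : ℝ, ((-2 : ℝ) + y * Complex.I : ℂ) = -conj ((2:ℝ) + y * Complex.I) := by
    intro y
    apply Complex.ext <;> simp
  set I₂ := ∫ y : ℝ, Φ ((2:ℝ) + y * Complex.I) / ((2:ℝ) + y * Complex.I) with hI₂
  have hleft : ∫ y : ℝ, Φ ((-2 : ℝ) + y * Complex.I) / ((-2 : ℝ) + y * Complex.I) =
      -κ * conj I₂ := by
    rw [hI₂, ← integral_conj, ← MeasureTheory.integral_const_mul]
    refine MeasureTheory.integral_congr_ae (Eventually.of_forall fun y ↦ ?_)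
    simp only
    rw [hrefl, hconj, map_div₀, div_neg]
    ring
  have hJ2 : ∫ y : ℝ, Complex.exp (((2:ℝ) + y * Complex.I) ^ 2) / ((2:ℝ) + y * Complex.I) =
      Real.pi := by
    rw [← integral_exp_sq_div_vertical]
    norm_num
  have hJ : ∫ y : ℝ, Complex.exp (((-2 : ℝ) + y * Complex.I) ^ 2) / ((-2 : ℝ) + y * Complex.I) =
      -Real.pi := by
    have h1 : -(Real.pi : ℂ) = -conj (Real.pi : ℂ) := by rw [Complex.conj_ofReal]
    rw [h1, ← hJ2, ← integral_conj, ← MeasureTheory.integral_neg]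
    refine MeasureTheory.integral_congr_ae (Eventually.of_forall fun y ↦ ?_)
    simp only
    rw [hrefl, map_div₀, div_neg, ← Complex.exp_conj, map_pow, neg_sq]
  rw [hleft, hJ, hJ2] at key
  have h1 : 2 * Real.pi * c = I₂ + κ * conj I₂ := by linear_combination key
  have h2 : 2 * Real.pi * ‖c‖ ≤ ‖I₂‖ + ‖I₂‖ := by
    have h3 := congrArg norm h1
    rw [norm_mul, norm_mul, Complex.norm_ofNat, Complex.norm_real,
      Real.norm_of_nonneg Real.pi_pos.le] at h3
    rw [h3]
    refine (norm_add_le _ _).trans ?_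
    rw [norm_mul, hκ, one_mul, RCLike.norm_conj]
  have h3 : I₂ = ∫ y : ℝ, Φ (2 + y * Complex.I) / (2 + y * Complex.I) := by
    rw [hI₂]
    norm_num
  rw [← h3]
  linarith

/-- A form of the approximate functional equation. The kernel `K` depends only on the parity of `χ`, and
the sum behind the integral has length about the square root of the conductor. -/
theorem Axioms.exists_norm_L_half_le (hF : F.Axioms) (ε : ℂ) :
    ∃ (K : ℂ → ℂ) (C : ℝ), 0 < C ∧ DifferentiableOn ℂ K {s : ℂ | 0 < s.re} ∧
      (∀ s : ℂ, 1 / 10 ≤ s.re → s.re ≤ 2 → ‖K s‖ ≤ C * Real.exp (-|s.im|)) ∧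
      ∀ (q : ℕ) (χ : DirichletCharacter ℂ q), 2 ≤ q → χ.IsPrimitive → χ (-1) = ε →
        ‖F.L χ (1 / 2)‖ ≤ ‖∫ y : ℝ, K (2 + y * Complex.I) *
          ((F.N q : ℂ) ^ ((2 + y * Complex.I) / 2) *
            LSeries (F.twistedCoeff χ) (1 / 2 + (2 + y * Complex.I)))‖ := by
  by_cases hex : ∃ (q : ℕ) (χ : DirichletCharacter ℂ q), 2 ≤ q ∧ χ.IsPrimitive ∧ χ (-1) = ε
  swap
  · refine ⟨0, 1, one_pos, differentiableOn_const 0, fun s _ _ ↦ ?_,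
      fun q χ h1 h2 h3 ↦ (hex ⟨q, χ, h1, h2, h3⟩).elim⟩
    simp [(Real.exp_pos _).le]
  have hμ : ∀ j, -1 < (F.μ ε j).re := by
    obtain ⟨q, χ, h1, h2, h3⟩ := hex
    obtain ⟨θ, hθ, -, h⟩ := hF.param_infinity
    intro j
    have h4 := h q χ h1 h2 j
    rw [h3] at h4
    have : 0 ≤ 1 / (2 * (d : ℝ)) := by positivity
    linarith
  obtain ⟨C, hC, hK⟩ := F.exists_norm_afeKernel_le hμ
  set a : ℂ := F.gammaInf ε (1 / 2) * F.symmPoly ε 0 with ha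
  set D : ℂ := ((Real.pi * ‖a‖ : ℝ) : ℂ) with hD
  refine ⟨fun s ↦ D⁻¹ * F.afeKernel ε s, (‖D⁻¹‖ + 1) * C, by positivity,
    (F.differentiableOn_afeKernel hμ).const_mul _, fun s h1 h2 ↦ ?_, fun q χ hq hχ hχε ↦ ?_⟩
  · rw [norm_mul, mul_assoc]
    refine mul_le_mul (by linarith) (hK s h1 h2) (norm_nonneg _) (by positivity)
  have hN := hF.conductor_pos q hq
  have hNne : (F.N q : ℂ) ≠ 0 := by exact_mod_cast hN.ne'
  -- If a factor `Γ_ℝ` has a pole at the central point, the central value vanishes. (At a pole, the value of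
  -- `Γ_ℝ` is `0` by convention.)
  by_cases hγ : F.gammaInf ε (1 / 2) = 0
  · rw [L, gammaFactor_eq, hχε, hγ, mul_zero, div_zero, norm_zero]
    exact norm_nonneg _
  have hpole : ∀ j, 1 / 2 + F.μ ε j ≠ 0 := by
    intro j hj
    refine hγ (Finset.prod_eq_zero (Finset.mem_univ j) ?_)
    rw [hj, Complex.Gammaℝ_def]
    simp
  have hsymm : F.symmPoly ε 0 ≠ 0 := by
    refine Finset.prod_ne_zero_iff.2 fun j _ ↦ ?_
    rw [add_zero, sub_zero]
    refine mul_ne_zero (hpole j) ?_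
    have h := (map_ne_zero (starRingEnd ℂ)).2 (hpole j)
    simpa [Complex.conj_ofNat] using h
  have ha0 : 0 < ‖a‖ := norm_pos_iff.2 (mul_ne_zero hγ hsymm)
  clear_value a D
  have hmain := hF.pi_mul_norm_smoothedL_zero_le hq hχ
  have hzero : F.smoothedL χ 0 = (F.N q : ℂ) ^ (1 / 4 : ℂ) * (a * F.L χ (1 / 2)) := by
    rw [smoothedL, add_zero, hχε, L, gammaFactor_eq, hχε, ha]
    have h1 : ((1:ℂ) / 2 / 2) = 1 / 4 := by norm_num
    have h2 : (F.N q : ℂ) ^ (1 / 4 : ℂ) ≠ 0 := by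
      rw [Complex.cpow_def_of_ne_zero hNne]
      exact Complex.exp_ne_zero _
    rw [h1]
    field_simp
    simp
  have hline : ∀ y : ℝ, F.smoothedL χ (2 + y * Complex.I) / (2 + y * Complex.I) =
      (F.N q : ℂ) ^ (1 / 4 : ℂ) * (D * (D⁻¹ * F.afeKernel ε (2 + y * Complex.I) *
          ((F.N q : ℂ) ^ ((2 + y * Complex.I) / 2) *
            LSeries (F.twistedCoeff χ) (1 / 2 + (2 + y * Complex.I))))) := by
    intro y
    have hD0 : D ≠ 0 := by
      rw [hD]
      exact_mod_cast (by positivity : Real.pi * ‖a‖ ≠ 0)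
    have h1 : 1 < (1 / 2 + (2 + y * Complex.I) : ℂ).re := by
      simp
      norm_num
    have h2 : ∀ j, 1 / 2 + F.μ ε j + (2 + y * Complex.I) ≠ 0 := fun j h ↦ by
      have h3 := congrArg Complex.re h
      have := hμ j
      simp at h3
      linarith
    rw [smoothedL, (hF.isEntireExtension hq hχ).2 _ h1, gammaFactor_eq, hχε, ← mul_assoc D,
      ← mul_assoc D, mul_inv_cancel₀ hD0, one_mul, ← gammaInf_mul_symmPoly h2]
    have h3 : ((1 / 2 + (2 + y * Complex.I)) / 2 : ℂ) = 1 / 4 + (2 + y * Complex.I) / 2 := by ring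
    rw [h3, Complex.cpow_add _ _ hNne]
    ring
  simp_rw [hline] at hmain
  rw [MeasureTheory.integral_const_mul, MeasureTheory.integral_const_mul, hzero,
    norm_mul _ (a * _), norm_mul a, norm_mul, norm_mul D] at hmain
  have hN4 : 0 < ‖(F.N q : ℂ) ^ (1 / 4 : ℂ)‖ := by
    rw [norm_conductor_cpow hN]
    positivity
  have hDn : ‖D‖ = Real.pi * ‖a‖ := by
    rw [hD, Complex.norm_real, Real.norm_of_nonneg (by positivity)]
  rw [hDn] at hmain
  beta_reduce
  refine le_of_mul_le_mul_left ?_ (mul_pos hN4 (mul_pos Real.pi_pos ha0))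
  linarith

end LData

/-! ### Smoothed sums as vectors over the characters -/

section CharacterVectors

variable {q : ℕ}

/-- The vector of the values at `n` of the characters of a finite set. -/
noncomputable def charVec (𝓕 : Finset (DirichletCharacter ℂ q)) (n : ℕ) : EuclideanSpace ℂ 𝓕 :=
  WithLp.toLp 2 fun χ ↦ χ.1 (n : ZMod q)

theorem charVec_mul (𝓕 : Finset (DirichletCharacter ℂ q)) (m n : ℕ) (χ : 𝓕) :
    charVec 𝓕 (m * n) χ = charVec 𝓕 m χ * charVec 𝓕 n χ := by
  simp [charVec]

theorem norm_sum_charVec_sq_le [NeZero q] (𝓕 : Finset (DirichletCharacter ℂ q)) {S : Finset ℕ}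
    {A X : ℕ} (hS : S ⊆ Finset.Ico A (A + X)) (a : ℕ → ℂ) :
    ‖∑ n ∈ S, a n • charVec 𝓕 n‖ ^ 2 ≤ (X + q) * ∑ n ∈ S, ‖a n‖ ^ 2 := by
  refine le_trans (le_of_eq ?_) (DirichletCharacter.sum_norm_sum_sq_le 𝓕 hS a)
  rw [EuclideanSpace.norm_sq_eq, ← Finset.sum_coe_sort 𝓕]
  refine Finset.sum_congr rfl fun χ _ ↦ ?_
  congr 2
  simp [charVec]

theorem norm_charVec_sq_le [NeZero q] (𝓕 : Finset (DirichletCharacter ℂ q)) (n : ℕ) :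
    ‖charVec 𝓕 n‖ ^ 2 ≤ 1 + q := by
  have h := norm_sum_charVec_sq_le 𝓕 (S := {n}) (A := n) (X := 1) (by simp) (fun _ ↦ 1)
  simpa using h

theorem card_le_of_characters [NeZero q] (𝓕 : Finset (DirichletCharacter ℂ q)) :
    (𝓕.card : ℝ) ≤ 1 + q := by
  have h := norm_charVec_sq_le 𝓕 1
  rw [EuclideanSpace.norm_sq_eq] at h
  simpa [charVec] using h

end CharacterVectors

/-- A holomorphic kernel on `Re s > 0` that decays exponentially on `1/10 ≤ Re s ≤ 2`. -/
structure AdmissibleKernel (K : ℂ → ℂ) (C : ℝ) : Prop where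
  pos : 0 < C
  differentiableOn : DifferentiableOn ℂ K {s : ℂ | 0 < s.re}
  norm_le : ∀ s : ℂ, 1 / 10 ≤ s.re → s.re ≤ 2 → ‖K s‖ ≤ C * Real.exp (-|s.im|)

/-- The inverse Mellin transform of the kernel at `n / √N`. -/
noncomputable def mellinWeight (K : ℂ → ℂ) (N : ℝ) (n : ℕ) : ℂ :=
  ∫ y : ℝ, K ((2 : ℝ) + y * Complex.I) * ((N : ℂ) ^ (((2 : ℝ) + y * Complex.I) / 2) *
    (n : ℂ) ^ (-((2 : ℝ) + y * Complex.I)))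

namespace AdmissibleKernel

variable {K : ℂ → ℂ} {C : ℝ}

theorem continuous_vertical (hK : AdmissibleKernel K C) {σ : ℝ} (hσ : 0 < σ) :
    Continuous fun y : ℝ ↦ K (σ + y * Complex.I) :=
  hK.differentiableOn.continuousOn.comp_continuous (by fun_prop) fun y ↦ by simpa using hσ

theorem norm_vertical_le (hK : AdmissibleKernel K C) {σ : ℝ} (h1 : 1 / 10 ≤ σ) (h2 : σ ≤ 2)
    (y : ℝ) : ‖K (σ + y * Complex.I)‖ ≤ C * Real.exp (-|y|) := by
  have := hK.norm_le (σ + y * Complex.I) (by simpa using h1) (by simpa using h2)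
  simpa using this

theorem norm_natCast_cpow_neg {n : ℕ} (hn : 1 ≤ n) (s : ℂ) : ‖(n : ℂ) ^ (-s)‖ = (n : ℝ) ^ (-s.re) := by
  rw [Complex.norm_natCast_cpow_of_pos hn, Complex.neg_re]

theorem norm_cpow_half_le {N Y : ℝ} (hN : 0 < N) (hY : 0 < Y) (hNY : N ≤ Y ^ 2) {s : ℂ}
    (hs : 0 ≤ s.re) : ‖(N : ℂ) ^ (s / 2)‖ ≤ Y ^ s.re := by
  have h : (s / 2).re = s.re / 2 := by simp
  rw [Complex.norm_cpow_eq_rpow_re_of_pos hN, h]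
  calc N ^ (s.re / 2) ≤ (Y ^ 2) ^ (s.re / 2) := Real.rpow_le_rpow hN.le hNY (by linarith)
    _ = Y ^ s.re := by
      rw [← Real.rpow_natCast, ← Real.rpow_mul hY.le]
      congr 1
      push_cast
      ring

theorem norm_cpow_mul_cpow_le {N Y : ℝ} (hN : 0 < N) (hY : 0 < Y) (hNY : N ≤ Y ^ 2) {n : ℕ}
    (hn : 1 ≤ n) {s : ℂ} (hs : 0 ≤ s.re) :
    ‖(N : ℂ) ^ (s / 2) * (n : ℂ) ^ (-s)‖ ≤ (Y / n) ^ s.re := by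
  have hn0 : (0:ℝ) < n := by exact_mod_cast hn
  rw [norm_mul, norm_natCast_cpow_neg hn, Real.div_rpow hY.le hn0.le, Real.rpow_neg hn0.le,
    div_eq_mul_inv]
  exact mul_le_mul_of_nonneg_right (norm_cpow_half_le hN hY hNY hs) (by positivity)

/-- The line of integration may be anywhere in `1/10 ≤ Re s ≤ 2`. -/
theorem mellinWeight_eq (hK : AdmissibleKernel K C) {N : ℝ} (hN : 0 < N) {n : ℕ} (hn : 1 ≤ n)
    {σ : ℝ} (h1 : 1 / 10 ≤ σ) (h2 : σ ≤ 2) :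
    mellinWeight K N n = ∫ y : ℝ, K (σ + y * Complex.I) * ((N : ℂ) ^ ((σ + y * Complex.I) / 2) *
      (n : ℂ) ^ (-(σ + y * Complex.I))) := by
  have hn0 : (n : ℂ) ≠ 0 := by exact_mod_cast (by omega : n ≠ 0)
  have hN0 : (N : ℂ) ≠ 0 := by exact_mod_cast hN.ne'
  have hnr : (0:ℝ) < n := by exact_mod_cast hn
  set D : ℝ := Real.exp (|Real.log (Real.sqrt N / n)| * 2) with hD
  refine (integral_vertical_eq_of_norm_le (f := fun s ↦ K s * ((N : ℂ) ^ (s / 2) *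
    (n : ℂ) ^ (-s))) (C := C * D) h2 ?_ fun s h3 h4 ↦ ?_).symm
  · refine (hK.differentiableOn.mono fun s hs ↦ ?_).mul (Differentiable.differentiableOn ?_)
    · have : σ ≤ s.re := hs.1
      exact lt_of_lt_of_le (by linarith) this
    · exact ((differentiable_id.div_const 2).const_cpow (Or.inl hN0)).mul
        (differentiable_id.neg.const_cpow (Or.inl hn0))
  · have h5 := norm_cpow_mul_cpow_le hN (Real.sqrt_pos.2 hN) (Real.sq_sqrt hN.le).ge hn
      (s := s) (by linarith)
    have h6 : (Real.sqrt N / n) ^ s.re ≤ D := by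
      rw [Real.rpow_def_of_pos (div_pos (Real.sqrt_pos.2 hN) hnr), hD, Real.exp_le_exp]
      refine (le_abs_self _).trans ?_
      rw [abs_mul]
      gcongr
      exact abs_le.2 ⟨by linarith, h4⟩
    rw [norm_mul]
    calc _ ≤ C * Real.exp (-|s.im|) * D :=
          mul_le_mul (hK.norm_le s (by linarith) h4) (h5.trans h6) (norm_nonneg _)
            (mul_nonneg hK.pos.le (Real.exp_pos _).le)
      _ = _ := by ring

theorem norm_mellinWeight_le (hK : AdmissibleKernel K C) {N Y : ℝ} (hN : 0 < N) (hY : 0 < Y)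
    (hNY : N ≤ Y ^ 2) {n : ℕ} (hn : 1 ≤ n) {σ : ℝ} (h1 : 1 / 10 ≤ σ) (h2 : σ ≤ 2) :
    ‖mellinWeight K N n‖ ≤ 2 * C * (Y / n) ^ σ := by
  rw [hK.mellinWeight_eq hN hn h1 h2]
  refine (MeasureTheory.norm_integral_le_of_norm_le
    ((integrable_exp_neg_abs.const_mul C).mul_const ((Y / n) ^ σ))
    (Eventually.of_forall fun y ↦ ?_)).trans (le_of_eq ?_)
  · rw [norm_mul]
    have h3 := norm_cpow_mul_cpow_le hN hY hNY hn (s := σ + y * Complex.I) (by simp; linarith)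
    refine mul_le_mul (hK.norm_vertical_le h1 h2 y) (h3.trans_eq (by simp)) (norm_nonneg _)
      (mul_nonneg hK.pos.le (Real.exp_pos _).le)
  · rw [MeasureTheory.integral_mul_const, MeasureTheory.integral_const_mul, integral_exp_neg_abs]
    ring

/-- Integrating a Dirichlet series against the kernel term by term. -/
theorem integral_mul_LSeries (hK : AdmissibleKernel K C) {N : ℝ} (hN : 0 < N) {a : ℕ → ℂ}
    (ha : LSeriesSummable a ((5 / 2 : ℝ) : ℂ)) :
    HasSum (fun n : ℕ ↦ LSeries.term a (1 / 2) n * mellinWeight K N n)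
      (∫ y : ℝ, K (2 + y * Complex.I) * ((N : ℂ) ^ ((2 + y * Complex.I) / 2) *
        LSeries a (1 / 2 + (2 + y * Complex.I)))) := by
  have hN0 : (N : ℂ) ≠ 0 := by exact_mod_cast hN.ne'
  set f : ℕ → ℝ → ℂ := fun n y ↦ K ((2:ℝ) + y * Complex.I) *
    ((N : ℂ) ^ (((2:ℝ) + y * Complex.I) / 2) *
      LSeries.term a (1 / 2 + ((2:ℝ) + y * Complex.I)) n) with hf
  have hre : ∀ y : ℝ, (1 / 2 + ((2:ℝ) + y * Complex.I) : ℂ).re = 5 / 2 := fun y ↦ by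
    simp
    norm_num
  have hterm : ∀ (n : ℕ) (y : ℝ), ‖LSeries.term a (1 / 2 + ((2:ℝ) + y * Complex.I)) n‖ =
      ‖LSeries.term a ((5 / 2 : ℝ) : ℂ) n‖ := by
    intro n y
    rw [LSeries.norm_term_eq, LSeries.norm_term_eq, hre, Complex.ofReal_re]
  have hfn : ∀ n y, ‖f n y‖ ≤ C * Real.exp (-|y|) *
      (Real.sqrt N ^ (2:ℝ) * ‖LSeries.term a ((5 / 2 : ℝ) : ℂ) n‖) := by
    intro n y
    simp only [hf]
    rw [norm_mul, norm_mul, hterm]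
    have h1 := norm_cpow_half_le hN (Real.sqrt_pos.2 hN) (Real.sq_sqrt hN.le).ge
      (s := (2:ℝ) + y * Complex.I) (by simp)
    have h2 : ((2:ℝ) + y * Complex.I : ℂ).re = 2 := by simp
    rw [h2] at h1
    refine mul_le_mul (hK.norm_vertical_le (by norm_num) le_rfl y)
      (mul_le_mul_of_nonneg_right h1 (norm_nonneg _)) (by positivity)
      (mul_nonneg hK.pos.le (Real.exp_pos _).le)
  have hfc : ∀ n, Continuous (f n) := by
    intro n
    refine (hK.continuous_vertical (σ := 2) (by norm_num)).mul (Continuous.mul ?_ ?_)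
    · exact Continuous.const_cpow (by fun_prop) (Or.inl hN0)
    · rcases eq_or_ne n 0 with rfl | hn
      · simp only [LSeries.term_zero]
        exact continuous_const
      · simp only [LSeries.term_of_ne_zero hn]
        refine continuous_const.div (Continuous.const_cpow (by fun_prop) (Or.inl ?_)) fun y ↦ ?_
        · exact_mod_cast hn
        · rw [Complex.cpow_def_of_ne_zero (by exact_mod_cast hn)]
          exact Complex.exp_ne_zero _
  have hfi : ∀ n, MeasureTheory.Integrable (f n) := fun n ↦
    ((integrable_exp_neg_abs.const_mul C).mul_const _).mono' (hfc n).aestronglyMeasurable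
      (Eventually.of_forall (hfn n))
  have hsum : Summable fun n ↦ ∫ y, ‖f n y‖ := by
    refine Summable.of_nonneg_of_le (fun n ↦ MeasureTheory.integral_nonneg fun y ↦ norm_nonneg _)
      (fun n ↦ (MeasureTheory.integral_mono (hfi n).norm
        ((integrable_exp_neg_abs.const_mul C).mul_const _) (hfn n)).trans_eq
        (MeasureTheory.integral_mul_const _ _)) ?_
    exact (ha.norm.mul_left _).mul_left _
  have hmain := MeasureTheory.hasSum_integral_of_summable_integral_norm hfi hsum
  convert! hmain using 1
  · funext n
    rcases eq_or_ne n 0 with rfl | hn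
    · simp [hf]
    rw [mellinWeight, ← MeasureTheory.integral_const_mul]
    refine MeasureTheory.integral_congr_ae (Eventually.of_forall fun y ↦ ?_)
    simp only [hf]
    rw [LSeries.term_of_ne_zero hn, LSeries.term_of_ne_zero hn, Complex.cpow_add _ _
      (by exact_mod_cast hn), Complex.cpow_neg]
    field_simp
  · refine MeasureTheory.integral_congr_ae (Eventually.of_forall fun y ↦ ?_)
    simp only [hf]
    rw [tsum_mul_left, tsum_mul_left, LSeries]
    norm_num

end AdmissibleKernel

section Geometric

/-- A two-sided geometric series, bounded by telescoping `t ↦ t / (g + t)` along `t = ρ^k`. -/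
theorem sum_min_div_pow_le {ρ g : ℝ} (hρ : 1 < ρ) (hg : 0 < g) (n : ℕ) :
    ∑ k ∈ Finset.range n, min (ρ ^ k / g) (g / ρ ^ k) ≤ 4 * ρ / (ρ - 1) := by
  have hρ0 : 0 < ρ := by linarith
  have hterm : ∀ k : ℕ, min (ρ ^ k / g) (g / ρ ^ k) ≤
      4 * ρ / (ρ - 1) * (ρ ^ (k + 1) / (g + ρ ^ (k + 1)) - ρ ^ k / (g + ρ ^ k)) := by
    intro k
    have ht : 0 < ρ ^ k := by positivity
    set t := ρ ^ k with ht'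
    have h1 : min (t / g) (g / t) ≤ 4 * (g * t / (g + t) ^ 2) := by
      rcases le_total t g with h | h
      · refine (min_le_left _ _).trans ?_
        rw [← mul_div_assoc, div_le_div_iff₀ hg (by positivity)]
        have h2 : (g + t) ^ 2 ≤ 4 * g ^ 2 := by nlinarith
        calc t * (g + t) ^ 2 ≤ t * (4 * g ^ 2) := by gcongr
          _ = _ := by ring
      · refine (min_le_right _ _).trans ?_
        rw [← mul_div_assoc, div_le_div_iff₀ ht (by positivity)]
        have h2 : (g + t) ^ 2 ≤ 4 * t ^ 2 := by nlinarith
        calc g * (g + t) ^ 2 ≤ g * (4 * t ^ 2) := by gcongr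
          _ = _ := by ring
    have h2 : ρ ^ (k + 1) / (g + ρ ^ (k + 1)) - t / (g + t) =
        (ρ - 1) * (g * t) / ((g + ρ * t) * (g + t)) := by
      rw [pow_succ, ← ht', div_sub_div _ _ (by positivity) (by positivity)]
      congr 1 <;> ring
    rw [h2]
    refine h1.trans ?_
    have h3 : (g + ρ * t) * (g + t) ≤ ρ * (g + t) ^ 2 := by
      have : 0 ≤ (g + t) * ((ρ - 1) * g) :=
        mul_nonneg (by linarith) (mul_nonneg (by linarith) hg.le)
      nlinarith
    have hρ1 : 0 < ρ - 1 := by linarith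
    calc 4 * (g * t / (g + t) ^ 2) = 4 * ρ * (g * t) / (ρ * (g + t) ^ 2) := by field_simp
      _ ≤ 4 * ρ * (g * t) / ((g + ρ * t) * (g + t)) := by gcongr
      _ = _ := by field_simp
  calc _ ≤ ∑ k ∈ Finset.range n,
        4 * ρ / (ρ - 1) * (ρ ^ (k + 1) / (g + ρ ^ (k + 1)) - ρ ^ k / (g + ρ ^ k)) :=
      Finset.sum_le_sum fun k _ ↦ hterm k
    _ = 4 * ρ / (ρ - 1) * (ρ ^ n / (g + ρ ^ n) - ρ ^ 0 / (g + ρ ^ 0)) := by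
      rw [← Finset.mul_sum, Finset.sum_range_sub (fun k ↦ ρ ^ k / (g + ρ ^ k))]
    _ ≤ 4 * ρ / (ρ - 1) * 1 := by
      have hρ1 : 0 < ρ - 1 := by linarith
      gcongr
      have h1 : ρ ^ n / (g + ρ ^ n) ≤ 1 := by
        rw [div_le_one (by positivity)]
        linarith
      have h2 : 0 ≤ ρ ^ 0 / (g + ρ ^ 0) := by positivity
      linarith
    _ = _ := mul_one _

/-- The exponent on the `k`-th dyadic block: `1/10` up to the length `G` of the sum, and `2` beyond. -/
noncomputable def blockExponent (G : ℝ) (k : ℕ) : ℝ := if (2:ℝ) ^ k ≤ G then 1 / 10 else 2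

theorem blockExponent_mem (G : ℝ) (k : ℕ) : 1 / 10 ≤ blockExponent G k ∧ blockExponent G k ≤ 2 := by
  unfold blockExponent
  split_ifs <;> norm_num

/-- The sum over the dyadic blocks: the terms with `√(2^k)` peak at `2^k ≈ G`, those without it at `2^k = 1`. -/
theorem exists_sum_block_le :
    ∃ C : ℝ, 0 < C ∧ ∀ G : ℝ, 0 < G → ∀ a b : ℝ, 0 ≤ a → 0 ≤ b → ∀ n : ℕ,
      ∑ k ∈ Finset.range n, (a * Real.sqrt (2 ^ k) + b) * (G / 2 ^ k) ^ blockExponent G k ≤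
        C * (a * Real.sqrt G + b * G ^ (1 / 10 : ℝ)) := by
  set ρ : ℝ := 2 ^ (2 / 5 : ℝ) with hρ
  have hρ1 : 1 < ρ := Real.one_lt_rpow (by norm_num) (by norm_num)
  set τ : ℝ := 2 ^ (-(1 / 10) : ℝ) with hτ
  have hτ0 : 0 ≤ τ := by positivity
  have hτ1 : τ < 1 := Real.rpow_lt_one_of_one_lt_of_neg (by norm_num) (by norm_num)
  have hρ2 : 0 < ρ - 1 := by linarith
  have hτ2 : 0 < 1 - τ := by linarith
  refine ⟨4 * ρ / (ρ - 1) + (1 - τ)⁻¹, by positivity, fun G hG a b ha hb n ↦ ?_⟩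
  have hpow : ∀ (r : ℝ) (k : ℕ), ((2:ℝ) ^ r) ^ k = ((2:ℝ) ^ k) ^ r := by
    intro r k
    rw [← Real.rpow_natCast, ← Real.rpow_natCast, ← Real.rpow_mul (by norm_num),
      ← Real.rpow_mul (by norm_num), mul_comm]
  have h1 : ∀ k : ℕ, Real.sqrt (2 ^ k) * (G / 2 ^ k) ^ blockExponent G k ≤
      Real.sqrt G * min (ρ ^ k / G ^ (2 / 5 : ℝ)) (G ^ (2 / 5 : ℝ) / ρ ^ k) := by
    intro k
    have ht : (0:ℝ) < 2 ^ k := by positivity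
    rw [hρ, hpow]
    set t : ℝ := 2 ^ k with ht'
    rw [← Real.div_rpow ht.le hG.le, ← Real.div_rpow hG.le ht.le]
    have hsq : Real.sqrt t = Real.sqrt G * (G / t) ^ (-(1 / 2) : ℝ) := by
      rw [Real.sqrt_eq_rpow, Real.sqrt_eq_rpow, Real.div_rpow hG.le ht.le, Real.rpow_neg hG.le,
        Real.rpow_neg ht.le]
      field_simp
    have hGt : 0 < G / t := by positivity
    have hinv : t / G = (G / t)⁻¹ := by rw [inv_div]
    rw [hsq, mul_assoc, ← Real.rpow_add hGt, hinv, Real.inv_rpow hGt.le, ← Real.rpow_neg hGt.le]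
    refine mul_le_mul_of_nonneg_left ?_ (Real.sqrt_nonneg _)
    unfold blockExponent
    split_ifs with h
    · have h2 : 1 ≤ G / t := by rwa [le_div_iff₀ ht, one_mul]
      refine le_min ?_ ?_ <;> refine Real.rpow_le_rpow_of_exponent_le h2 ?_ <;> norm_num
    · have h2 : G / t ≤ 1 := by
        rw [div_le_one ht]
        exact (not_le.1 h).le
      refine le_min ?_ ?_ <;> refine Real.rpow_le_rpow_of_exponent_ge hGt h2 ?_ <;> norm_num
  have h2 : ∀ k : ℕ, (G / 2 ^ k) ^ blockExponent G k ≤ G ^ (1 / 10 : ℝ) * τ ^ k := by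
    intro k
    have ht : (0:ℝ) < 2 ^ k := by positivity
    rw [hτ, hpow]
    set t : ℝ := 2 ^ k with ht'
    have hGt : 0 < G / t := by positivity
    rw [Real.rpow_neg ht.le, ← div_eq_mul_inv, ← Real.div_rpow hG.le ht.le]
    unfold blockExponent
    split_ifs with h
    · exact le_rfl
    · have h2 : G / t ≤ 1 := by
        rw [div_le_one ht]
        exact (not_le.1 h).le
      exact Real.rpow_le_rpow_of_exponent_ge hGt h2 (by norm_num)
  have h3 : ∑ k ∈ Finset.range n, τ ^ k ≤ (1 - τ)⁻¹ := by
    rw [← tsum_geometric_of_lt_one hτ0 hτ1]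
    exact (summable_geometric_of_lt_one hτ0 hτ1).sum_le_tsum _ fun k _ ↦ pow_nonneg hτ0 k
  have hm := sum_min_div_pow_le hρ1 (g := G ^ (2 / 5 : ℝ)) (by positivity) n
  calc _ ≤ ∑ k ∈ Finset.range n, (a * (Real.sqrt G *
        min (ρ ^ k / G ^ (2 / 5 : ℝ)) (G ^ (2 / 5 : ℝ) / ρ ^ k)) +
          b * (G ^ (1 / 10 : ℝ) * τ ^ k)) := by
        refine Finset.sum_le_sum fun k _ ↦ ?_
        rw [add_mul, mul_assoc]
        exact add_le_add (mul_le_mul_of_nonneg_left (h1 k) ha)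
          (mul_le_mul_of_nonneg_left (h2 k) hb)
    _ = a * Real.sqrt G * (∑ k ∈ Finset.range n,
        min (ρ ^ k / G ^ (2 / 5 : ℝ)) (G ^ (2 / 5 : ℝ) / ρ ^ k)) +
          b * G ^ (1 / 10 : ℝ) * ∑ k ∈ Finset.range n, τ ^ k := by
        rw [Finset.sum_add_distrib, Finset.mul_sum, Finset.mul_sum]
        congr 1 <;> refine Finset.sum_congr rfl fun k _ ↦ ?_ <;> ring
    _ ≤ a * Real.sqrt G * (4 * ρ / (ρ - 1)) + b * G ^ (1 / 10 : ℝ) * (1 - τ)⁻¹ := by gcongr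
    _ ≤ _ := by
        have h4 : 0 ≤ a * Real.sqrt G * (1 - τ)⁻¹ := by positivity
        have h5 : 0 ≤ b * G ^ (1 / 10 : ℝ) * (4 * ρ / (ρ - 1)) := by positivity
        linarith

end Geometric

section Dyadic

variable {q : ℕ}

/-- The vector attached to `n` in the smoothed central values. -/
noncomputable def weightVec (K : ℂ → ℂ) (N : ℝ) (𝓕 : Finset (DirichletCharacter ℂ q)) (n : ℕ) :
    EuclideanSpace ℂ 𝓕 :=
  ((n : ℂ) ^ (-(1 / 2) : ℂ) * mellinWeight K N n) • charVec 𝓕 n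

theorem norm_natCast_cpow_neg_half {n : ℕ} (hn : 1 ≤ n) :
    ‖(n : ℂ) ^ (-(1 / 2) : ℂ)‖ = (n : ℝ) ^ (-(1 / 2) : ℝ) := by
  rw [AdmissibleKernel.norm_natCast_cpow_neg hn]
  norm_num

theorem norm_natCast_cpow_neg_half_sq {n : ℕ} (hn : 1 ≤ n) :
    ‖(n : ℂ) ^ (-(1 / 2) : ℂ)‖ ^ 2 = (n : ℝ)⁻¹ := by
  have hn0 : (0:ℝ) ≤ n := Nat.cast_nonneg n
  rw [norm_natCast_cpow_neg_half hn, ← Real.rpow_natCast, ← Real.rpow_mul hn0]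
  norm_num
  rw [Real.rpow_neg_one]

theorem AdmissibleKernel.norm_weightVec_le [NeZero q] {K : ℂ → ℂ} {C N Y : ℝ}
    (hK : AdmissibleKernel K C) (hN : 0 < N) (hY : 0 < Y) (hNY : N ≤ Y ^ 2)
    (𝓕 : Finset (DirichletCharacter ℂ q)) {n : ℕ} (hn : 1 ≤ n) :
    ‖weightVec K N 𝓕 n‖ ≤ 2 * C * Y ^ 2 * Real.sqrt (1 + q) * (n : ℝ) ^ (-(5 / 2) : ℝ) := by
  have hn0 : (0:ℝ) < n := by exact_mod_cast hn
  have h1 := hK.norm_mellinWeight_le hN hY hNY hn (σ := 2) (by norm_num) le_rfl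
  have h2 : ‖charVec 𝓕 n‖ ≤ Real.sqrt (1 + q) := Real.le_sqrt_of_sq_le (norm_charVec_sq_le 𝓕 n)
  rw [weightVec, norm_smul, norm_mul, norm_natCast_cpow_neg_half hn]
  have hC := hK.pos
  calc _ ≤ (n : ℝ) ^ (-(1 / 2) : ℝ) * (2 * C * (Y / n) ^ (2:ℝ)) * Real.sqrt (1 + q) := by gcongr
    _ = 2 * C * Y ^ 2 * Real.sqrt (1 + q) * ((n : ℝ) ^ (-(1 / 2) : ℝ) * (n:ℝ) ^ (-(2:ℝ))) := by
        rw [Real.div_rpow hY.le hn0.le, Real.rpow_neg hn0.le 2, Real.rpow_two]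
        field_simp
    _ = _ := by
        rw [← Real.rpow_add hn0]
        norm_num

/-- The mean value theorem on dyadic blocks: a mean square bound for the coefficients gives a bound for
the smoothed sum of length `Y`. -/
theorem exists_norm_sum_weightVec_le {K : ℂ → ℂ} {C : ℝ} (hK : AdmissibleKernel K C) :
    ∃ D : ℝ, 0 < D ∧ ∀ (q : ℕ), 1 ≤ q → ∀ (𝓕 : Finset (DirichletCharacter ℂ q)) (N Y : ℝ), 0 < N →
      0 < Y → N ≤ Y ^ 2 → ∀ (b : ℕ → ℂ) (Z : ℕ) (B H : ℝ), 0 ≤ B → 0 ≤ H →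
      (∀ M : ℕ, M ≤ Z → ∑ n ∈ Finset.Icc 1 M, ‖b n‖ ^ 2 ≤ B * M + H) →
      ‖∑ n ∈ Finset.Icc 1 Z, b n • weightVec K N 𝓕 n‖ ≤
        D * (Real.sqrt B * Real.sqrt Y + Real.sqrt (q * (B + H)) * Y ^ (1 / 10 : ℝ)) := by
  obtain ⟨D₀, hD₀, hsum⟩ := exists_sum_block_le
  have hC := hK.pos
  refine ⟨2 * C * Real.sqrt 2 * D₀, by positivity,
    fun q hq 𝓕 N Y hN hY hNY b Z B H hB hH hbd ↦ ?_⟩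
  have : NeZero q := ⟨by omega⟩
  have hq1 : (1:ℝ) ≤ q := by exact_mod_cast hq
  set J := Nat.log 2 Z + 1 with hJ
  have hmaps : ∀ n ∈ Finset.Icc 1 Z, Nat.log 2 n ∈ Finset.range J := fun n hn ↦ by
    rw [Finset.mem_range, hJ, Nat.lt_succ_iff]
    exact Nat.log_mono_right (Finset.mem_Icc.1 hn).2
  rw [← Finset.sum_fiberwise_of_maps_to hmaps]
  -- On the block `2^k ≤ n < 2^{k+1}` the weight is bounded on the line of real part `blockExponent Y k`.
  have hblock : ∀ k : ℕ, ‖∑ n ∈ Finset.Icc 1 Z with Nat.log 2 n = k, b n • weightVec K N 𝓕 n‖ ≤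
      2 * C * ((Real.sqrt (2 * B) * Real.sqrt (2 ^ k) + Real.sqrt (2 * (q * (B + H)))) *
        (Y / 2 ^ k) ^ blockExponent Y k) := by
    intro k
    set σ := blockExponent Y k with hσ
    obtain ⟨hσ1, hσ2⟩ := blockExponent_mem Y k
    set S := (Finset.Icc 1 Z).filter (fun n ↦ Nat.log 2 n = k) with hS
    have hSk : ∀ n ∈ S, 1 ≤ n ∧ n ≤ Z ∧ 2 ^ k ≤ n ∧ n < 2 ^ (k + 1) := by
      intro n hn
      rw [hS, Finset.mem_filter, Finset.mem_Icc] at hn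
      refine ⟨hn.1.1, hn.1.2, ?_, ?_⟩
      · rw [← hn.2]
        exact Nat.pow_log_le_self 2 (by omega)
      · rw [← hn.2]
        exact Nat.lt_pow_succ_log_self (by norm_num) n
    have hsub : S ⊆ Finset.Ico (2 ^ k) (2 ^ k + 2 ^ k) := by
      intro n hn
      obtain ⟨-, -, h1, h2⟩ := hSk n hn
      rw [pow_succ] at h2
      exact Finset.mem_Ico.2 ⟨h1, by omega⟩
    have hmv := norm_sum_charVec_sq_le 𝓕 hsub
      (fun n ↦ b n * ((n : ℂ) ^ (-(1 / 2) : ℂ) * mellinWeight K N n))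
    have hcongr : ∑ n ∈ S, b n • weightVec K N 𝓕 n =
        ∑ n ∈ S, (b n * ((n : ℂ) ^ (-(1 / 2) : ℂ) * mellinWeight K N n)) • charVec 𝓕 n := by
      refine Finset.sum_congr rfl fun n _ ↦ ?_
      rw [weightVec, smul_smul]
    rw [hcongr]
    have ht : (0:ℝ) < 2 ^ k := by positivity
    set w : ℝ := 2 * C * (Y / 2 ^ k) ^ σ with hw
    have hw0 : 0 ≤ w := by positivity
    have hterm : ∀ n ∈ S, ‖b n * ((n : ℂ) ^ (-(1 / 2) : ℂ) * mellinWeight K N n)‖ ^ 2 ≤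
        w ^ 2 / 2 ^ k * ‖b n‖ ^ 2 := by
      intro n hn
      obtain ⟨h1, -, h2, -⟩ := hSk n hn
      have h2' : (2:ℝ) ^ k ≤ n := by exact_mod_cast h2
      have h3 : ‖mellinWeight K N n‖ ≤ w := by
        refine (hK.norm_mellinWeight_le hN hY hNY h1 hσ1 hσ2).trans ?_
        rw [hw]
        gcongr
      rw [norm_mul, norm_mul, mul_pow, mul_pow, norm_natCast_cpow_neg_half_sq h1]
      have h4 : (n:ℝ)⁻¹ ≤ (2 ^ k)⁻¹ := inv_anti₀ ht h2'
      calc _ ≤ ‖b n‖ ^ 2 * ((2 ^ k)⁻¹ * w ^ 2) := by gcongr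
        _ = _ := by ring
    have hbS : ∑ n ∈ S, ‖b n‖ ^ 2 ≤ B * (2 * 2 ^ k) + H := by
      have h1 : S ⊆ Finset.Icc 1 (min Z (2 ^ (k + 1))) := by
        intro n hn
        obtain ⟨h1, h2, -, h3⟩ := hSk n hn
        exact Finset.mem_Icc.2 ⟨h1, le_min h2 h3.le⟩
      refine (Finset.sum_le_sum_of_subset_of_nonneg h1 fun _ _ _ ↦ by positivity).trans
        ((hbd _ (min_le_left _ _)).trans ?_)
      gcongr
      have : ((min Z (2 ^ (k + 1)) : ℕ) : ℝ) ≤ ((2 ^ (k + 1) : ℕ) : ℝ) := by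
        exact_mod_cast min_le_right _ _
      refine this.trans (le_of_eq ?_)
      push_cast
      ring
    have ht1 : (1:ℝ) ≤ 2 ^ k := one_le_pow₀ (by norm_num)
    have hsq : ‖∑ n ∈ S, (b n * ((n : ℂ) ^ (-(1 / 2) : ℂ) * mellinWeight K N n)) •
        charVec 𝓕 n‖ ^ 2 ≤ w ^ 2 * (2 * B * 2 ^ k + 2 * (q * (B + H))) := by
      refine hmv.trans ?_
      calc _ ≤ (((2 ^ k : ℕ) : ℝ) + q) * ∑ n ∈ S, w ^ 2 / 2 ^ k * ‖b n‖ ^ 2 := by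
            gcongr with n hn
            exact hterm n hn
        _ ≤ (2 ^ k + q) * (w ^ 2 / 2 ^ k * (B * (2 * 2 ^ k) + H)) := by
            rw [← Finset.mul_sum]
            push_cast
            gcongr
        _ = w ^ 2 * (2 * B * 2 ^ k + (2 * (q * B) + H * (1 + q / 2 ^ k))) := by
            field_simp
            ring
        _ ≤ _ := by
            have h1 : (q:ℝ) / 2 ^ k ≤ q := div_le_self (by linarith) ht1
            have h2 : H * (1 + q / 2 ^ k) ≤ H * (2 * q) := by
              gcongr
              linarith
            gcongr
            linarith
    have h5 := Real.le_sqrt_of_sq_le hsq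
    refine h5.trans ?_
    rw [Real.sqrt_mul (by positivity), Real.sqrt_sq hw0]
    have h6 : Real.sqrt (2 * B * 2 ^ k + 2 * (q * (B + H))) ≤
        Real.sqrt (2 * B) * Real.sqrt (2 ^ k) + Real.sqrt (2 * (q * (B + H))) := by
      rw [← Real.sqrt_mul (by positivity)]
      rw [Real.sqrt_le_left (by positivity), add_sq, Real.sq_sqrt (by positivity),
        Real.sq_sqrt (by positivity)]
      have := mul_nonneg (Real.sqrt_nonneg (2 * B * 2 ^ k))
        (Real.sqrt_nonneg (2 * (q * (B + H))))
      linarith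
    calc _ ≤ w * (Real.sqrt (2 * B) * Real.sqrt (2 ^ k) + Real.sqrt (2 * (q * (B + H)))) := by
          gcongr
      _ = _ := by rw [hw]; ring
  refine (norm_sum_le _ _).trans ((Finset.sum_le_sum fun k _ ↦ hblock k).trans ?_)
  rw [← Finset.mul_sum]
  have h7 := hsum Y hY (Real.sqrt (2 * B)) (Real.sqrt (2 * (q * (B + H)))) (Real.sqrt_nonneg _)
    (Real.sqrt_nonneg _) J
  rw [Real.sqrt_mul (by norm_num) B, Real.sqrt_mul (by norm_num) (q * (B + H))] at h7 ⊢
  calc _ ≤ 2 * C * (D₀ * (Real.sqrt 2 * Real.sqrt B * Real.sqrt Y +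
        Real.sqrt 2 * Real.sqrt (q * (B + H)) * Y ^ (1 / 10 : ℝ))) := by gcongr
    _ = _ := by ring

end Dyadic

/-! ### Bilinear sums over a prime and an integer -/

theorem integrable_exp_neg_half_abs : MeasureTheory.Integrable fun y : ℝ ↦ Real.exp (-(|y| / 2)) := by
  have h := integrable_exp_neg_abs.comp_mul_left' (R := 1 / 2) (by norm_num)
  refine h.congr (Eventually.of_forall fun y ↦ ?_)
  simp only [abs_mul]
  rw [abs_of_pos (by norm_num : (0:ℝ) < 1 / 2)]
  congr 2
  ring

theorem integral_exp_neg_half_abs : ∫ y : ℝ, Real.exp (-(|y| / 2)) = 4 := by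
  have h := MeasureTheory.Measure.integral_comp_mul_left (fun y : ℝ ↦ Real.exp (-|y|)) (1 / 2)
  rw [integral_exp_neg_abs] at h
  have h2 : (fun y : ℝ ↦ Real.exp (-(|y| / 2))) = fun y : ℝ ↦ Real.exp (-|1 / 2 * y|) := by
    funext y
    rw [abs_mul, abs_of_pos (by norm_num : (0:ℝ) < 1 / 2)]
    congr 2
    ring
  rw [h2, h]
  norm_num

namespace LData

variable {d : ℕ} {F : LData d} {q : ℕ}

/-- The trivial bound for a window of the prime sum. -/
theorem RamanujanBound.norm_primeWindow_le (hA : F.RamanujanBound) (χ : DirichletCharacter ℂ q)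
    {S : Finset ℕ} (hS : ∀ p ∈ S, p.Prime) (v : ℝ) {s : ℂ} (hs0 : 0 ≤ s.re) (hs : s.re ≤ 3) :
    ‖F.primeWindow χ S v s‖ ≤ 2 ^ d * Real.exp 4 * Real.exp (v * (1 - s.re)) := by
  classical
  set S' := S.filter fun p : ℕ ↦ tri (Real.log p - v) ≠ 0 with hS'
  have hmem : ∀ p ∈ S', p.Prime ∧ Real.exp (v - 1) ≤ p ∧ (p : ℝ) ≤ Real.exp (v + 1) := by
    intro p hp
    rw [hS', Finset.mem_filter] at hp
    have hp0 : (0:ℝ) < p := by exact_mod_cast (hS p hp.1).pos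
    have h1 : |Real.log p - v| < 1 := by
      by_contra! h
      exact hp.2 (tri_eq_zero h)
    rw [abs_lt] at h1
    refine ⟨hS p hp.1, ?_, ?_⟩
    · rw [← Real.le_log_iff_exp_le hp0]
      linarith
    · rw [← Real.log_le_iff_le_exp hp0]
      linarith
  have hsum : F.primeWindow χ S v s =
      ∑ p ∈ S', (tri (Real.log p - v) : ℂ) * (F.coeff p * χ (p : ZMod q) * (p : ℂ) ^ (-s)) := by
    rw [primeWindow, hS', Finset.sum_filter]
    refine Finset.sum_congr rfl fun p _ ↦ ?_
    split_ifs with h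
    · rfl
    · rw [not_not.1 h]
      simp
  have hcard : (S'.card : ℝ) ≤ Real.exp (v + 1) := by
    have h1 : S' ⊆ Finset.Icc 1 ⌊Real.exp (v + 1)⌋₊ := fun p hp ↦ by
      obtain ⟨h1, -, h2⟩ := hmem p hp
      exact Finset.mem_Icc.2 ⟨h1.one_le, Nat.le_floor h2⟩
    have h2 := Finset.card_le_card h1
    rw [Nat.card_Icc, Nat.add_sub_cancel] at h2
    exact (Nat.cast_le.2 h2).trans (Nat.floor_le (Real.exp_pos _).le)
  have hterm : ∀ p ∈ S', ‖(tri (Real.log p - v) : ℂ) *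
      (F.coeff p * χ (p : ZMod q) * (p : ℂ) ^ (-s))‖ ≤
        2 ^ d * Real.exp (-((v - 1) * s.re)) := by
    intro p hp
    obtain ⟨h1, h2, -⟩ := hmem p hp
    have hp0 : (0:ℝ) < p := by exact_mod_cast h1.pos
    rw [norm_mul, norm_mul, norm_mul, Complex.norm_real, Real.norm_of_nonneg (tri_nonneg _),
      AdmissibleKernel.norm_natCast_cpow_neg h1.one_le]
    have h3 : (p : ℝ) ^ (-s.re) ≤ Real.exp (-((v - 1) * s.re)) := by
      rw [Real.rpow_def_of_pos hp0, Real.exp_le_exp]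
      have h4 : v - 1 ≤ Real.log p := (Real.le_log_iff_exp_le hp0).2 h2
      nlinarith
    calc _ ≤ 1 * (2 ^ d * 1 * Real.exp (-((v - 1) * s.re))) := by
          gcongr
          · exact tri_le_one _
          · exact hA.norm_coeff_prime_le h1
          · exact χ.norm_le_one _
      _ = _ := by ring
  rw [hsum]
  refine (norm_sum_le_of_le _ hterm).trans ?_
  rw [Finset.sum_const, nsmul_eq_mul]
  calc _ ≤ Real.exp (v + 1) * (2 ^ d * Real.exp (-((v - 1) * s.re))) := by gcongr
    _ = 2 ^ d * Real.exp (1 + s.re + v * (1 - s.re)) := by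
        rw [mul_left_comm, ← Real.exp_add]
        congr 2
        ring
    _ ≤ 2 ^ d * Real.exp (4 + v * (1 - s.re)) := by
        gcongr
        linarith
    _ = _ := by rw [Real.exp_add]; ring

/-- One dyadic block of the bilinear sum over primes in a window and integers, as an integral of the
product of the two Dirichlet polynomials. -/
theorem norm_bilinear_block_le [NeZero q] {K : ℂ → ℂ} {C : ℝ} (hK : AdmissibleKernel K C)
    {𝓕 : Finset (DirichletCharacter ℂ q)} {N Y : ℝ} (hN : 0 < N) (hY : 0 < Y) (hNY : N ≤ Y ^ 2)
    {S : Finset ℕ} (hS : ∀ p ∈ S, p.Prime) {v σ E : ℝ} (h1 : 1 / 10 ≤ σ) (h2 : σ ≤ 2) (hE : 0 ≤ E)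
    (hPW : ∀ χ ∈ 𝓕, ∀ y : ℝ, Real.exp (-|y|) *
      ‖F.primeWindow χ S v (1 / 2 + (σ + y * Complex.I))‖ ≤ E * Real.exp (-(|y| / 2)))
    {B : Finset ℕ} {k : ℕ} (hB : B ⊆ Finset.Ico (2 ^ k) (2 ^ k + 2 ^ k)) {a : ℕ → ℂ} {A : ℝ}
    (ha : ∑ m ∈ B, ‖a m‖ ^ 2 ≤ A * 2 ^ k) :
    ‖∑ p ∈ S, ∑ m ∈ B, ((tri (Real.log p - v) : ℂ) * F.coeff p * a m) • weightVec K N 𝓕 (p * m)‖ ≤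
      4 * (C * Y ^ σ * E * (Real.sqrt A * (Real.sqrt (2 ^ k) + Real.sqrt q) * ((2:ℝ) ^ k) ^ (-σ))) := by
  have hB1 : ∀ m ∈ B, 1 ≤ m := fun m hm ↦
    Nat.one_le_two_pow.trans (Finset.mem_Ico.1 (hB hm)).1
  have hC := hK.pos
  have hN0 : (N : ℂ) ≠ 0 := by exact_mod_cast hN.ne'
  have ht : (0:ℝ) < 2 ^ k := by positivity
  set kern : ℕ → ℝ → ℂ := fun n y ↦ K (σ + y * Complex.I) *
    ((N : ℂ) ^ ((σ + y * Complex.I) / 2) * (n : ℂ) ^ (-(σ + y * Complex.I))) with hkern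
  have hkint : ∀ n : ℕ, 1 ≤ n → MeasureTheory.Integrable (kern n) := by
    intro n hn
    refine ((integrable_exp_neg_abs.const_mul C).mul_const ((Y / n) ^ σ)).mono'
      (Continuous.aestronglyMeasurable ?_) (Eventually.of_forall fun y ↦ ?_)
    · refine (hK.continuous_vertical (by linarith)).mul (Continuous.mul ?_ ?_)
      · exact Continuous.const_cpow (by fun_prop) (Or.inl hN0)
      · refine Continuous.const_cpow (by fun_prop) (Or.inl ?_)
        exact_mod_cast (by omega : n ≠ 0)
    · simp only [hkern]
      rw [norm_mul]
      have h3 := AdmissibleKernel.norm_cpow_mul_cpow_le hN hY hNY hn (s := σ + y * Complex.I)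
        (by simp; linarith)
      refine mul_le_mul (hK.norm_vertical_le h1 h2 y) (h3.trans_eq (by simp)) (norm_nonneg _)
        (mul_nonneg hC.le (Real.exp_pos _).le)
  set c : ℕ → ℕ → ℂ := fun p m ↦ (tri (Real.log p - v) : ℂ) * F.coeff p * a m with hc
  set G : ℝ → EuclideanSpace ℂ 𝓕 := fun y ↦ ∑ p ∈ S, ∑ m ∈ B,
    kern (p * m) y • ((c p m * ((p * m : ℕ) : ℂ) ^ (-(1 / 2) : ℂ)) • charVec 𝓕 (p * m)) with hG
  have hident : ∑ p ∈ S, ∑ m ∈ B, c p m • weightVec K N 𝓕 (p * m) = ∫ y, G y := by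
    have h3 : ∀ p ∈ S, ∀ m ∈ B, MeasureTheory.Integrable fun y ↦ kern (p * m) y •
        ((c p m * ((p * m : ℕ) : ℂ) ^ (-(1 / 2) : ℂ)) • charVec 𝓕 (p * m)) := by
      intro p hp m hm
      refine (hkint (p * m) ?_).smul_const _
      exact Nat.one_le_iff_ne_zero.2 (mul_ne_zero (hS p hp).ne_zero
        (Nat.one_le_iff_ne_zero.1 (hB1 m hm)))
    rw [hG, MeasureTheory.integral_finsetSum _ fun p hp ↦
      MeasureTheory.integrable_finsetSum _ fun m hm ↦ h3 p hp m hm]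
    refine Finset.sum_congr rfl fun p hp ↦ ?_
    rw [MeasureTheory.integral_finsetSum _ fun m hm ↦ h3 p hp m hm]
    refine Finset.sum_congr rfl fun m hm ↦ ?_
    rw [integral_smul_const, weightVec, hK.mellinWeight_eq hN (Nat.one_le_iff_ne_zero.2
      (mul_ne_zero (hS p hp).ne_zero (Nat.one_le_iff_ne_zero.1 (hB1 m hm)))) h1 h2, smul_smul,
      smul_smul]
    congr 1
    simp only [hkern]
    ring
  rw [hident]
  -- The integrand factors into a product of two Dirichlet polynomials for every character.
  set D : ℝ → EuclideanSpace ℂ 𝓕 := fun y ↦ ∑ m ∈ B,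
    (a m * (m : ℂ) ^ (-(1 / 2 + (σ + y * Complex.I)))) • charVec 𝓕 m with hD
  have hGD : ∀ (y : ℝ) (χ : 𝓕), G y χ = K (σ + y * Complex.I) *
      (N : ℂ) ^ ((σ + y * Complex.I) / 2) *
        F.primeWindow χ.1 S v (1 / 2 + (σ + y * Complex.I)) * D y χ := by
    intro y χ
    have h3 : ∀ n : ℕ, n ≠ 0 → (n : ℂ) ^ (-(1 / 2 + (σ + y * Complex.I))) =
        (n : ℂ) ^ (-(1 / 2) : ℂ) * (n : ℂ) ^ (-(σ + y * Complex.I)) := by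
      intro n hn
      rw [← Complex.cpow_add _ _ (by exact_mod_cast hn)]
      congr 1
      ring
    simp only [hG, hD, primeWindow, WithLp.ofLp_sum, Finset.sum_apply, PiLp.smul_apply, smul_eq_mul]
    rw [Finset.sum_comm, Finset.mul_sum]
    refine Finset.sum_congr rfl fun m hm ↦ ?_
    rw [Finset.mul_sum, Finset.sum_mul]
    refine Finset.sum_congr rfl fun p hp ↦ ?_
    have hp0 := (hS p hp).ne_zero
    have hm0 := Nat.one_le_iff_ne_zero.1 (hB1 m hm)
    rw [charVec_mul, h3 m hm0, h3 p hp0]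
    simp only [hkern, hc]
    rw [Nat.cast_mul, Complex.natCast_mul_natCast_cpow, Complex.natCast_mul_natCast_cpow]
    have h4 : charVec 𝓕 p χ = χ.1 (p : ZMod q) := rfl
    rw [h4]
    ring
  set Dn : ℝ := Real.sqrt A * (Real.sqrt (2 ^ k) + Real.sqrt q) * ((2:ℝ) ^ k) ^ (-σ) with hDn
  have hDbd : ∀ y, ‖D y‖ ≤ Dn := by
    intro y
    have hmv := norm_sum_charVec_sq_le 𝓕 hB
      (fun m ↦ a m * (m : ℂ) ^ (-(1 / 2 + (σ + y * Complex.I))))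
    have hterm : ∀ m ∈ B, ‖a m * (m : ℂ) ^ (-(1 / 2 + (σ + y * Complex.I)))‖ ^ 2 ≤
        (((2:ℝ) ^ k) ^ (-σ)) ^ 2 / 2 ^ k * ‖a m‖ ^ 2 := by
      intro m hm
      have hm1 := hB1 m hm
      have hm2 : (2:ℝ) ^ k ≤ m := by exact_mod_cast (Finset.mem_Ico.1 (hB hm)).1
      have hre : (1 / 2 + (σ + y * Complex.I) : ℂ).re = 1 / 2 + σ := by simp
      rw [norm_mul, AdmissibleKernel.norm_natCast_cpow_neg hm1, hre, mul_pow]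
      have h3 : ((m:ℝ) ^ (-(1 / 2 + σ))) ^ 2 ≤ (((2:ℝ) ^ k) ^ (-(1 / 2 + σ))) ^ 2 := by
        refine pow_le_pow_left₀ (by positivity) ?_ 2
        exact Real.rpow_le_rpow_of_nonpos ht hm2 (by linarith)
      have h4 : (((2:ℝ) ^ k) ^ (-(1 / 2 + σ))) ^ 2 = (((2:ℝ) ^ k) ^ (-σ)) ^ 2 / 2 ^ k := by
        have h5 : ((2:ℝ) ^ k) ^ (-(1 / 2 + σ)) =
            ((2:ℝ) ^ k) ^ (-σ) * ((2:ℝ) ^ k) ^ (-(1 / 2) : ℝ) := by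
          rw [← Real.rpow_add ht]
          congr 1
          ring
        rw [h5, mul_pow, ← Real.rpow_natCast (((2:ℝ) ^ k) ^ (-(1 / 2) : ℝ)), ← Real.rpow_mul ht.le]
        norm_num
        rw [Real.rpow_neg_one, div_eq_mul_inv]
      rw [h4] at h3
      calc _ ≤ ‖a m‖ ^ 2 * ((((2:ℝ) ^ k) ^ (-σ)) ^ 2 / 2 ^ k) := by gcongr
        _ = _ := by ring
    have hsq : ‖D y‖ ^ 2 ≤ A * (2 ^ k + q) * (((2:ℝ) ^ k) ^ (-σ)) ^ 2 := by
      refine hmv.trans ?_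
      calc _ ≤ (((2 ^ k : ℕ) : ℝ) + q) * ∑ m ∈ B, (((2:ℝ) ^ k) ^ (-σ)) ^ 2 / 2 ^ k * ‖a m‖ ^ 2 := by
            gcongr with m hm
            exact hterm m hm
        _ ≤ (2 ^ k + q) * ((((2:ℝ) ^ k) ^ (-σ)) ^ 2 / 2 ^ k * (A * 2 ^ k)) := by
            rw [← Finset.mul_sum]
            push_cast
            gcongr
        _ = _ := by field_simp
    have hA0 : 0 ≤ A := by
      have h3 : 0 ≤ A * 2 ^ k := (Finset.sum_nonneg fun _ _ ↦ by positivity).trans ha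
      exact nonneg_of_mul_nonneg_left h3 ht
    refine (Real.le_sqrt_of_sq_le hsq).trans ?_
    rw [Real.sqrt_mul (by positivity), Real.sqrt_sq (by positivity), Real.sqrt_mul hA0, hDn]
    gcongr
    rw [Real.sqrt_le_left (by positivity), add_sq, Real.sq_sqrt (by positivity),
      Real.sq_sqrt (by positivity)]
    have := mul_nonneg (Real.sqrt_nonneg (2 ^ k)) (Real.sqrt_nonneg (q:ℝ))
    linarith
  have hGbd : ∀ y, ‖G y‖ ≤ C * Y ^ σ * E * Dn * Real.exp (-(|y| / 2)) := by
    intro y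
    set M : ℝ := C * Y ^ σ * (E * Real.exp (-(|y| / 2))) with hM'
    have hM0 : 0 ≤ M := by positivity
    have hcoef : ∀ χ : 𝓕, ‖G y χ‖ ≤ M * ‖D y χ‖ := by
      intro χ
      rw [hGD, norm_mul, norm_mul, norm_mul]
      refine mul_le_mul_of_nonneg_right ?_ (norm_nonneg _)
      have h3 := AdmissibleKernel.norm_cpow_half_le hN hY hNY (s := σ + y * Complex.I)
        (by simp; linarith)
      have h4 : (σ + y * Complex.I : ℂ).re = σ := by simp
      rw [h4] at h3
      calc _ ≤ C * Real.exp (-|y|) * Y ^ σ *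
            ‖F.primeWindow χ.1 S v (1 / 2 + (σ + y * Complex.I))‖ := by
            gcongr
            exact hK.norm_vertical_le h1 h2 y
        _ = C * Y ^ σ * (Real.exp (-|y|) *
            ‖F.primeWindow χ.1 S v (1 / 2 + (σ + y * Complex.I))‖) := by ring
        _ ≤ _ := by
            rw [hM']
            exact mul_le_mul_of_nonneg_left (hPW χ.1 χ.2 y) (by positivity)
    have hsq : ‖G y‖ ^ 2 ≤ (M * ‖D y‖) ^ 2 := by
      rw [mul_pow, EuclideanSpace.norm_sq_eq, EuclideanSpace.norm_sq_eq, Finset.mul_sum]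
      refine Finset.sum_le_sum fun χ _ ↦ ?_
      rw [← mul_pow]
      exact pow_le_pow_left₀ (norm_nonneg _) (hcoef χ) 2
    have h3 := (le_abs_self _).trans (abs_le_of_sq_le_sq hsq (by positivity))
    calc _ ≤ M * ‖D y‖ := h3
      _ ≤ M * Dn := by
          gcongr
          exact hDbd y
      _ = _ := by rw [hM']; ring
  refine (MeasureTheory.norm_integral_le_of_norm_le
    (integrable_exp_neg_half_abs.const_mul _) (Eventually.of_forall hGbd)).trans (le_of_eq ?_)
  rw [MeasureTheory.integral_const_mul, integral_exp_neg_half_abs]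
  ring

/-- The bilinear sum over the primes of one window and all integers up to `Z`, once the window has been
shown to save a power of `log q`. -/
theorem SieveBound.exists_norm_bilinear_le (hA1 : F.RamanujanBound) (hA3 : F.SieveBound)
    {K : ℂ → ℂ} {C : ℝ} (hK : AdmissibleKernel K C) {C_W : ℝ} (hC_W : 0 < C_W) :
    ∃ D : ℝ, 0 < D ∧ ∀ (q : ℕ), 1 ≤ q → 1 ≤ Real.log q →
      Real.log q ^ 90 ≤ Real.exp (Real.log q / 2) →
      ∀ (𝓕 : Finset (DirichletCharacter ℂ q)) (N Y : ℝ), 0 < N → 0 < Y → N ≤ Y ^ 2 →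
      ∀ (S : Finset ℕ) (v : ℝ), (∀ p ∈ S, p.Prime) →
      (∀ χ ∈ 𝓕, ∀ s : ℂ, (s.re = 3 / 5 ∨ s.re = 5 / 2) → |s.im| ≤ Real.log q →
        ‖F.primeWindow χ S v s‖ ≤ C_W * Real.exp (v * (1 - s.re)) / Real.log q ^ 90) →
      ∀ (f : ℕ → ℂ), (∀ m, ‖f m‖ ≤ 1) → ∀ Z : ℕ,
      ‖∑ p ∈ S, ∑ m ∈ Finset.Icc 1 Z, ((tri (Real.log p - v) : ℂ) * F.coeff p * (F.coeff m * f m)) •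
        weightVec K N 𝓕 (p * m)‖ ≤
        D / Real.log q ^ 90 *
          (Real.sqrt Y + Real.sqrt q * Real.exp (2 / 5 * v) * Y ^ (1 / 10 : ℝ)) := by
  obtain ⟨D₀, hD₀, hsum⟩ := exists_sum_block_le
  obtain ⟨A, hA, hAM⟩ := hA3.exists_secondMoment_le
  have hC := hK.pos
  refine ⟨4 * C * (C_W + 2 ^ d * Real.exp 4) * Real.sqrt (2 * A) * D₀, by positivity,
    fun q hq hx1 hx 𝓕 N Y hN hY hNY S v hS hPW f hf Z ↦ ?_⟩
  have : NeZero q := ⟨by omega⟩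
  set x := Real.log q with hxdef
  have hx90 : 0 < x ^ 90 := by positivity
  set J := Nat.log 2 Z + 1 with hJ
  have hmaps : ∀ n ∈ Finset.Icc 1 Z, Nat.log 2 n ∈ Finset.range J := fun n hn ↦ by
    rw [Finset.mem_range, hJ, Nat.lt_succ_iff]
    exact Nat.log_mono_right (Finset.mem_Icc.1 hn).2
  -- As `p ≈ e^v`, the sum over `m` has length `Y e^{-v}`.
  set G := Y * Real.exp (-v) with hG
  have hG0 : 0 < G := by positivity
  set E₁ := C_W + 2 ^ d * Real.exp 4 with hE₁
  have hE₁0 : 0 < E₁ := by positivity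
  have hblock : ∀ k : ℕ, ‖∑ p ∈ S, ∑ m ∈ Finset.Icc 1 Z with Nat.log 2 m = k,
      ((tri (Real.log p - v) : ℂ) * F.coeff p * (F.coeff m * f m)) • weightVec K N 𝓕 (p * m)‖ ≤
      4 * C * E₁ * Real.sqrt (2 * A) / x ^ 90 * Real.exp (v / 2) *
        ((1 * Real.sqrt (2 ^ k) + Real.sqrt q) * (G / 2 ^ k) ^ blockExponent G k) := by
    intro k
    set σ := blockExponent G k with hσ
    obtain ⟨hσ1, hσ2⟩ := blockExponent_mem G k
    have hσ' : σ = 1 / 10 ∨ σ = 2 := by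
      rw [hσ, blockExponent]
      split_ifs
      · exact Or.inl rfl
      · exact Or.inr rfl
    set B := (Finset.Icc 1 Z).filter (fun n ↦ Nat.log 2 n = k) with hB
    have hBk : ∀ n ∈ B, 1 ≤ n ∧ 2 ^ k ≤ n ∧ n < 2 ^ (k + 1) := by
      intro n hn
      rw [hB, Finset.mem_filter, Finset.mem_Icc] at hn
      refine ⟨hn.1.1, ?_, ?_⟩
      · rw [← hn.2]
        exact Nat.pow_log_le_self 2 (by omega)
      · rw [← hn.2]
        exact Nat.lt_pow_succ_log_self (by norm_num) n
    have hsub : B ⊆ Finset.Ico (2 ^ k) (2 ^ k + 2 ^ k) := by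
      intro n hn
      obtain ⟨-, h1, h2⟩ := hBk n hn
      rw [pow_succ] at h2
      exact Finset.mem_Ico.2 ⟨h1, by omega⟩
    have ha : ∑ m ∈ B, ‖F.coeff m * f m‖ ^ 2 ≤ 2 * A * 2 ^ k := by
      have h1 : B ⊆ Finset.Icc 1 (2 ^ (k + 1)) := fun n hn ↦ by
        obtain ⟨h1, -, h2⟩ := hBk n hn
        exact Finset.mem_Icc.2 ⟨h1, h2.le⟩
      calc _ ≤ ∑ m ∈ B, ‖F.coeff m‖ ^ 2 := by
            refine Finset.sum_le_sum fun m _ ↦ ?_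
            rw [norm_mul]
            exact pow_le_pow_left₀ (by positivity)
              (mul_le_of_le_one_right (norm_nonneg _) (hf m)) 2
        _ ≤ ∑ m ∈ Finset.Icc 1 (2 ^ (k + 1)), ‖F.coeff m‖ ^ 2 :=
            Finset.sum_le_sum_of_subset_of_nonneg h1 fun _ _ _ ↦ by positivity
        _ ≤ A * ((2 ^ (k + 1) : ℕ) : ℝ) := hAM _
        _ = _ := by
            push_cast
            ring
    have hE : ∀ χ ∈ 𝓕, ∀ y : ℝ, Real.exp (-|y|) *
        ‖F.primeWindow χ S v (1 / 2 + (σ + y * Complex.I))‖ ≤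
          E₁ / x ^ 90 * Real.exp (v * (1 / 2 - σ)) * Real.exp (-(|y| / 2)) := by
      intro χ hχ y
      have hre : (1 / 2 + (σ + y * Complex.I) : ℂ).re = 1 / 2 + σ := by simp
      have him : (1 / 2 + (σ + y * Complex.I) : ℂ).im = y := by simp
      have hv : v * (1 - (1 / 2 + σ)) = v * (1 / 2 - σ) := by ring
      have hsplit : Real.exp (-|y|) = Real.exp (-(|y| / 2)) * Real.exp (-(|y| / 2)) := by
        rw [← Real.exp_add]
        congr 1
        ring
      -- For `|y| ≤ log q` the saving of the window is available; beyond, the decay of the kernel makes up for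
      -- it.
      rcases le_or_gt |y| x with h | h
      · have h3 := hPW χ hχ (1 / 2 + (σ + y * Complex.I)) (by
          rw [hre]
          rcases hσ' with h | h <;> rw [h] <;> norm_num) (by rwa [him])
        rw [hre, hv] at h3
        have h4 : Real.exp (-(|y| / 2)) ≤ 1 := Real.exp_le_one_iff.2 (by
          have := abs_nonneg y
          linarith)
        calc _ ≤ Real.exp (-|y|) * (C_W * Real.exp (v * (1 / 2 - σ)) / x ^ 90) := by gcongr
          _ ≤ Real.exp (-(|y| / 2)) * 1 * (E₁ * Real.exp (v * (1 / 2 - σ)) / x ^ 90) := by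
              rw [hsplit]
              gcongr
              rw [hE₁]
              linarith [(by positivity : 0 < 2 ^ d * Real.exp 4)]
          _ = _ := by ring
      · have h3 := hA1.norm_primeWindow_le χ hS v (s := 1 / 2 + (σ + y * Complex.I))
          (by rw [hre]; linarith) (by rw [hre]; linarith)
        rw [hre, hv] at h3
        have h4 : Real.exp (-(|y| / 2)) ≤ 1 / x ^ 90 := by
          rw [Real.exp_neg, inv_eq_one_div]
          refine one_div_le_one_div_of_le hx90 (hx.trans (Real.exp_le_exp.2 ?_))
          linarith
        calc _ ≤ Real.exp (-|y|) * (2 ^ d * Real.exp 4 * Real.exp (v * (1 / 2 - σ))) := by gcongr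
          _ ≤ Real.exp (-(|y| / 2)) * (1 / x ^ 90) * (E₁ * Real.exp (v * (1 / 2 - σ))) := by
              rw [hsplit]
              gcongr
              rw [hE₁]
              linarith
          _ = _ := by ring
    have h := norm_bilinear_block_le hK (𝓕 := 𝓕) hN hY hNY hS (v := v) hσ1 hσ2 (by positivity) hE
      hsub ha
    refine h.trans (le_of_eq ?_)
    have ht : (0:ℝ) < 2 ^ k := by positivity
    have h5 : Real.exp (v / 2) * (G / 2 ^ k) ^ σ =
        Real.exp (v * (1 / 2 - σ)) * Y ^ σ * ((2:ℝ) ^ k) ^ (-σ) := by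
      rw [hG, Real.div_rpow (by positivity) ht.le, Real.mul_rpow hY.le (Real.exp_pos _).le,
        ← Real.exp_mul, Real.rpow_neg ht.le]
      have h6 : v * (1 / 2 - σ) = v / 2 + -v * σ := by ring
      rw [h6, Real.exp_add]
      field_simp
    linear_combination (-(4 * C * E₁ * Real.sqrt (2 * A) / x ^ 90 *
      (Real.sqrt (2 ^ k) + Real.sqrt q))) * h5
  have hsplit : ∑ p ∈ S, ∑ m ∈ Finset.Icc 1 Z,
      ((tri (Real.log p - v) : ℂ) * F.coeff p * (F.coeff m * f m)) • weightVec K N 𝓕 (p * m) =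
      ∑ k ∈ Finset.range J, ∑ p ∈ S, ∑ m ∈ Finset.Icc 1 Z with Nat.log 2 m = k,
      ((tri (Real.log p - v) : ℂ) * F.coeff p * (F.coeff m * f m)) • weightVec K N 𝓕 (p * m) := by
    symm
    rw [Finset.sum_comm]
    refine Finset.sum_congr rfl fun p _ ↦ ?_
    rw [Finset.sum_fiberwise_of_maps_to hmaps]
  rw [hsplit]
  refine (norm_sum_le _ _).trans ((Finset.sum_le_sum fun k _ ↦ hblock k).trans ?_)
  rw [← Finset.mul_sum]
  have h7 := hsum G hG0 1 (Real.sqrt q) zero_le_one (Real.sqrt_nonneg _) J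
  have h8 : Real.exp (v / 2) * Real.sqrt G = Real.sqrt Y := by
    have h9 : Real.exp (v / 2) = Real.sqrt (Real.exp v) := by rw [Real.exp_half]
    rw [h9, ← Real.sqrt_mul (Real.exp_pos _).le, hG, mul_left_comm, ← Real.exp_add]
    simp
  have h9 : Real.exp (v / 2) * G ^ (1 / 10 : ℝ) = Real.exp (2 / 5 * v) * Y ^ (1 / 10 : ℝ) := by
    rw [hG, Real.mul_rpow hY.le (Real.exp_pos _).le, ← Real.exp_mul, mul_left_comm, ← Real.exp_add,
      mul_comm]
    congr 2
    ring
  calc _ ≤ 4 * C * E₁ * Real.sqrt (2 * A) / x ^ 90 * Real.exp (v / 2) *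
        (D₀ * (1 * Real.sqrt G + Real.sqrt q * G ^ (1 / 10 : ℝ))) := by gcongr
    _ = 4 * C * E₁ * Real.sqrt (2 * A) * D₀ / x ^ 90 * (Real.exp (v / 2) * Real.sqrt G +
        Real.sqrt q * (Real.exp (v / 2) * G ^ (1 / 10 : ℝ))) := by ring
    _ = _ := by rw [h8, h9]; ring

end LData

/-! ### The sieve flow -/

section Windows

/-- A trapezoid: the sum of the unit triangles centred at the integers of `[a, b]`. -/
noncomputable def windowSum (a b : ℕ) (y : ℝ) : ℝ := ∑ v ∈ Finset.Icc a b, tri (y - v)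

theorem windowSum_nonneg (a b : ℕ) (y : ℝ) : 0 ≤ windowSum a b y :=
  Finset.sum_nonneg fun _ _ ↦ tri_nonneg _

theorem tri_of_mem_Icc {t : ℝ} (h0 : 0 ≤ t) (h1 : t ≤ 1) : tri t = 1 - t := by
  rw [tri, abs_of_nonneg h0, max_eq_right (by linarith)]

theorem tri_sub_natCast_eq_zero {y : ℝ} (hy : 0 ≤ y) {v : ℕ} (h1 : v ≠ ⌊y⌋₊) (h2 : v ≠ ⌊y⌋₊ + 1) :
    tri (y - v) = 0 := by
  have h3 := Nat.floor_le hy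
  have h4 := Nat.lt_floor_add_one y
  refine tri_eq_zero ?_
  rcases Nat.lt_or_gt_of_ne h1 with h | h
  · have : (v : ℝ) + 1 ≤ ⌊y⌋₊ := by exact_mod_cast h
    rw [abs_of_nonneg (by linarith)]
    linarith
  · have : (⌊y⌋₊ : ℝ) + 2 ≤ v := by exact_mod_cast (by omega : ⌊y⌋₊ + 2 ≤ v)
    rw [abs_of_nonpos (by linarith)]
    linarith

theorem tri_sub_floor_add {y : ℝ} (hy : 0 ≤ y) :
    tri (y - ⌊y⌋₊) + tri (y - (⌊y⌋₊ + 1 : ℕ)) = 1 := by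
  have h3 := Nat.floor_le hy
  have h4 := Nat.lt_floor_add_one y
  rw [tri_of_mem_Icc (by linarith) (by linarith), ← tri_neg,
    tri_of_mem_Icc (by push_cast; linarith) (by push_cast; linarith)]
  push_cast
  ring

theorem windowSum_le_one (a b : ℕ) {y : ℝ} (hy : 0 ≤ y) : windowSum a b y ≤ 1 := by
  have h1 : windowSum a b y ≤ ∑ v ∈ Finset.Icc a b ∪ {⌊y⌋₊, ⌊y⌋₊ + 1}, tri (y - v) :=
    Finset.sum_le_sum_of_subset_of_nonneg Finset.subset_union_left fun _ _ _ ↦ tri_nonneg _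
  have h2 : ∑ v ∈ ({⌊y⌋₊, ⌊y⌋₊ + 1} : Finset ℕ), tri (y - v) =
      ∑ v ∈ Finset.Icc a b ∪ {⌊y⌋₊, ⌊y⌋₊ + 1}, tri (y - v) := by
    refine Finset.sum_subset Finset.subset_union_right fun v _ hv ↦ ?_
    rw [Finset.mem_insert, Finset.mem_singleton, not_or] at hv
    exact tri_sub_natCast_eq_zero hy hv.1 hv.2
  rw [← h2, Finset.sum_pair (by omega), tri_sub_floor_add hy] at h1
  exact h1

theorem windowSum_eq_one {a b : ℕ} {y : ℝ} (ha : (a : ℝ) ≤ y) (hb : y ≤ b) :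
    windowSum a b y = 1 := by
  have hy : 0 ≤ y := (Nat.cast_nonneg a).trans ha
  have h1 : a ≤ ⌊y⌋₊ := Nat.le_floor ha
  have h2 : ⌊y⌋₊ ≤ b := Nat.floor_le_of_le hb
  rw [← tri_sub_floor_add hy, windowSum]
  rcases h2.lt_or_eq with h | h
  · rw [← Finset.sum_pair (f := fun v : ℕ ↦ tri (y - v)) (by omega : ⌊y⌋₊ ≠ ⌊y⌋₊ + 1)]
    symm
    refine Finset.sum_subset ?_ fun v _ hv ↦ ?_
    · intro v hv
      rw [Finset.mem_insert, Finset.mem_singleton] at hv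
      rw [Finset.mem_Icc]
      omega
    · rw [Finset.mem_insert, Finset.mem_singleton, not_or] at hv
      exact tri_sub_natCast_eq_zero hy hv.1 hv.2
  · have h3 : y = ⌊y⌋₊ := le_antisymm (by rw [h]; exact hb) (Nat.floor_le hy)
    have h4 : tri (y - (⌊y⌋₊ + 1 : ℕ)) = 0 := by
      refine tri_eq_zero ?_
      nth_rewrite 1 [h3]
      push_cast
      simp
    rw [h4, add_zero]
    refine Finset.sum_eq_single_of_mem _ (Finset.mem_Icc.2 ⟨h1, h2⟩) fun v hv hv' ↦ ?_
    refine tri_sub_natCast_eq_zero hy hv' ?_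
    have := (Finset.mem_Icc.1 hv).2
    omega

end Windows

section Flow

/-- The primes that divide `n` exactly once. -/
def exactPrimes (n : ℕ) : Finset ℕ := n.primeFactors.filter fun p ↦ ¬ p ^ 2 ∣ n

theorem mem_exactPrimes {n p : ℕ} (hn : n ≠ 0) :
    p ∈ exactPrimes n ↔ p.Prime ∧ p ∣ n ∧ ¬ p ^ 2 ∣ n := by
  rw [exactPrimes, Finset.mem_filter, Nat.mem_primeFactors]
  tauto

theorem exactPrimes_div {n p : ℕ} (hn : n ≠ 0) (hp : p ∈ exactPrimes n) :
    exactPrimes (n / p) = (exactPrimes n).erase p := by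
  rw [mem_exactPrimes hn] at hp
  obtain ⟨hpp, ⟨m, rfl⟩, hp2⟩ := hp
  have hm0 : m ≠ 0 := fun h ↦ hn (by rw [h, mul_zero])
  have hpm : ¬ p ∣ m := fun ⟨c, hc⟩ ↦ hp2 ⟨c, by rw [hc]; ring⟩
  rw [Nat.mul_div_cancel_left m hpp.pos]
  ext r
  rw [Finset.mem_erase, mem_exactPrimes hm0, mem_exactPrimes hn]
  constructor
  · rintro ⟨h1, h2, h3⟩
    have hne : r ≠ p := fun h ↦ hpm (h ▸ h2)
    refine ⟨hne, h1, h2.mul_left p, fun h ↦ h3 ?_⟩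
    exact (Nat.Coprime.dvd_mul_left (((Nat.coprime_primes h1 hpp).2 hne).pow_left 2)).1 h
  · rintro ⟨hne, h1, h2, h3⟩
    refine ⟨h1, ?_, fun h ↦ h3 (h.mul_left p)⟩
    exact (Nat.Coprime.dvd_mul_left ((Nat.coprime_primes h1 hpp).2 hne)).1 h2

/-- A sieve weight that interpolates between `1` at `x = 0` and, at `x = 1`, a weight that vanishes when
`n` is exactly divisible by a prime of weight one. -/
noncomputable def sieveFlow (w : ℕ → ℝ) (x : ℝ) (n : ℕ) : ℝ := ∏ p ∈ exactPrimes n, (1 - x * w p)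

theorem sieveFlow_zero (w : ℕ → ℝ) (n : ℕ) : sieveFlow w 0 n = 1 := by simp [sieveFlow]

theorem abs_sieveFlow_le {w : ℕ → ℝ} (hw : ∀ p : ℕ, p.Prime → 0 ≤ w p ∧ w p ≤ 1) {x : ℝ}
    (hx : x ∈ Set.Icc (0:ℝ) 1) (n : ℕ) : |sieveFlow w x n| ≤ 1 := by
  rw [sieveFlow, Finset.abs_prod]
  refine Finset.prod_le_one (fun _ _ ↦ abs_nonneg _) fun p hp ↦ ?_
  obtain ⟨h1, h2⟩ := hw p (Nat.prime_of_mem_primeFactors (Finset.mem_filter.1 hp).1)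
  have h3 : x * w p ≤ 1 := mul_le_one₀ hx.2 h1 h2
  have h4 : 0 ≤ x * w p := mul_nonneg hx.1 h1
  exact abs_le.2 ⟨by linarith, by linarith⟩

/-- Removing the factor of `p` from the product gives the sieve weight of `n / p`, as `p` divides `n` exactly
once. -/
theorem hasDerivAt_sieveFlow (w : ℕ → ℝ) (x : ℝ) {n : ℕ} (hn : n ≠ 0) :
    HasDerivAt (fun x ↦ sieveFlow w x n)
      (-∑ p ∈ exactPrimes n, w p * sieveFlow w x (n / p)) x := by
  have h := HasDerivAt.fun_finsetProd (u := exactPrimes n) (f := fun p x ↦ 1 - x * w p)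
    (f' := fun p ↦ -w p) (x := x) fun p _ ↦ by
      simpa using ((hasDerivAt_id x).mul_const (w p)).const_sub 1
  refine h.congr_deriv ?_
  rw [← Finset.sum_neg_distrib]
  refine Finset.sum_congr rfl fun p hp ↦ ?_
  rw [sieveFlow, exactPrimes_div hn hp, smul_eq_mul]
  ring

end Flow

section BilinearRearrangement

variable {E : Type*} [NormedAddCommGroup E] [NormedSpace ℂ E]

/-- Collecting the terms `n = p m` of a bilinear sum with `m ≤ Z`; those with `p m > Z` are left over. -/
theorem sum_sum_mul_eq (S : Finset ℕ) (hS : ∀ p ∈ S, p.Prime) (Z : ℕ) (g : ℕ → ℕ → ℂ) (T : ℕ → E) :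
    ∑ p ∈ S, ∑ m ∈ Finset.Icc 1 Z, g p m • T (p * m) =
      ∑ n ∈ Finset.Icc 1 Z, (∑ p ∈ S with p ∣ n, g p (n / p)) • T n +
        ∑ p ∈ S, ∑ m ∈ Finset.Icc 1 Z with Z < p * m, g p m • T (p * m) := by
  have h1 : ∀ p ∈ S, ∑ m ∈ Finset.Icc 1 Z, g p m • T (p * m) =
      ∑ n ∈ Finset.Icc 1 Z with p ∣ n, g p (n / p) • T n +
        ∑ m ∈ Finset.Icc 1 Z with Z < p * m, g p m • T (p * m) := by
    intro p hp
    have hp0 := (hS p hp).pos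
    rw [← Finset.sum_filter_not_add_sum_filter (Finset.Icc 1 Z) (fun m ↦ Z < p * m)]
    congr 1
    refine Finset.sum_nbij' (fun m ↦ p * m) (fun n ↦ n / p) ?_ ?_ ?_ ?_ ?_
    · intro m hm
      rw [Finset.mem_filter, Finset.mem_Icc] at hm ⊢
      exact ⟨⟨Nat.mul_pos hp0 hm.1.1, not_lt.1 hm.2⟩, dvd_mul_right _ _⟩
    · intro n hn
      rw [Finset.mem_filter, Finset.mem_Icc] at hn ⊢
      obtain ⟨⟨h1, h2⟩, c, rfl⟩ := hn
      rw [Nat.mul_div_cancel_left c hp0]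
      refine ⟨⟨Nat.pos_of_ne_zero fun h ↦ by simp [h] at h1, ?_⟩, not_lt.2 h2⟩
      exact (Nat.le_mul_of_pos_left c hp0).trans h2
    · intro m _
      exact Nat.mul_div_cancel_left m hp0
    · intro n hn
      exact Nat.mul_div_cancel' (Finset.mem_filter.1 hn).2
    · intro m _
      rw [Nat.mul_div_cancel_left m hp0]
  rw [Finset.sum_congr rfl h1, Finset.sum_add_distrib]
  congr 1
  simp_rw [Finset.sum_filter, Finset.sum_smul]
  rw [Finset.sum_comm]
  refine Finset.sum_congr rfl fun n _ ↦ Finset.sum_congr rfl fun p _ ↦ ?_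
  split_ifs <;> simp

namespace LData

variable {d : ℕ} {F : LData d}

/-- Removing the integers exactly divisible by a prime of weight one: the sieve weight is moved from
`x = 0` to `x = 1`, and its derivative is a bilinear sum over a prime and an integer, up to the terms
with a square factor and the terms beyond the end of the sum. -/
theorem norm_sum_le_of_sieveFlow {S : Finset ℕ} (hS : ∀ p ∈ S, p.Prime) {w : ℕ → ℝ}
    (hwS : ∀ p : ℕ, p.Prime → w p ≠ 0 → p ∈ S) (Z : ℕ) (T : ℕ → E) {D₁ D₂ D₃ : ℝ}
    (h₁ : ∀ x ∈ Set.Icc (0:ℝ) 1, ‖∑ p ∈ S, ∑ m ∈ Finset.Icc 1 Z,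
      ((w p : ℂ) * F.coeff p * (F.coeff m * sieveFlow w x m)) • T (p * m)‖ ≤ D₁)
    (h₂ : ∀ x ∈ Set.Icc (0:ℝ) 1, ‖∑ n ∈ Finset.Icc 1 Z, (∑ p ∈ S with p ^ 2 ∣ n,
      ((w p : ℂ) * F.coeff p * (F.coeff (n / p) * sieveFlow w x (n / p)))) • T n‖ ≤ D₂)
    (h₃ : ∀ x ∈ Set.Icc (0:ℝ) 1, ‖∑ p ∈ S, ∑ m ∈ Finset.Icc 1 Z with Z < p * m,
      ((w p : ℂ) * F.coeff p * (F.coeff m * sieveFlow w x m)) • T (p * m)‖ ≤ D₃) :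
    ‖∑ n ∈ Finset.Icc 1 Z, F.coeff n • T n‖ ≤
      ‖∑ n ∈ Finset.Icc 1 Z, (F.coeff n * sieveFlow w 1 n) • T n‖ + (D₁ + D₂ + D₃) := by
  let _ : NormedSpace ℝ E := NormedSpace.restrictScalars ℝ ℂ E
  set u : ℝ → E := fun x ↦ ∑ n ∈ Finset.Icc 1 Z, (F.coeff n * sieveFlow w x n) • T n with hu
  set g : ℝ → ℕ → ℕ → ℂ := fun x p m ↦
    (w p : ℂ) * F.coeff p * (F.coeff m * sieveFlow w x m) with hg
  have hderiv : ∀ x : ℝ, HasDerivAt u (∑ n ∈ Finset.Icc 1 Z,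
      (F.coeff n * ((-∑ p ∈ exactPrimes n, w p * sieveFlow w x (n / p) : ℝ) : ℂ)) • T n) x := by
    intro x
    refine HasDerivAt.fun_sum fun n hn ↦ ?_
    have hn0 : n ≠ 0 := Nat.one_le_iff_ne_zero.1 (Finset.mem_Icc.1 hn).1
    exact (((hasDerivAt_sieveFlow w x hn0).ofReal_comp).const_mul (F.coeff n)).smul_const (T n)
  -- The exact prime factors of `n` are all its prime factors up to those whose square divides `n`; for them
  -- `λ_F(n) = λ_F(p) λ_F(n / p)`.
  have hexact : ∀ x : ℝ, ∀ n ∈ Finset.Icc 1 Z,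
      F.coeff n * ((-∑ p ∈ exactPrimes n, w p * sieveFlow w x (n / p) : ℝ) : ℂ) =
        (∑ p ∈ S with p ^ 2 ∣ n, g x p (n / p)) - ∑ p ∈ S with p ∣ n, g x p (n / p) := by
    intro x n hn
    have hn0 : n ≠ 0 := Nat.one_le_iff_ne_zero.1 (Finset.mem_Icc.1 hn).1
    have h4 : ∑ p ∈ S with p ∣ n, g x p (n / p) = (∑ p ∈ S with p ^ 2 ∣ n, g x p (n / p)) +
        ∑ p ∈ S with p ∈ exactPrimes n, g x p (n / p) := by
      rw [← Finset.sum_filter_add_sum_filter_not (S.filter fun p ↦ p ∣ n) (fun p ↦ p ^ 2 ∣ n),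
        Finset.filter_filter, Finset.filter_filter]
      congr 1
      · refine Finset.sum_congr (Finset.filter_congr fun p _ ↦ ?_) fun _ _ ↦ rfl
        exact ⟨fun h ↦ h.2, fun h ↦ ⟨(dvd_pow_self p two_ne_zero).trans h, h⟩⟩
      · refine Finset.sum_congr (Finset.filter_congr fun p hp ↦ ?_) fun _ _ ↦ rfl
        rw [mem_exactPrimes hn0]
        exact ⟨fun h ↦ ⟨hS p hp, h⟩, fun h ↦ h.2⟩
    have h5 : ∑ p ∈ S with p ∈ exactPrimes n, g x p (n / p) =
        ∑ p ∈ exactPrimes n, g x p (n / p) := by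
      refine Finset.sum_subset (fun p hp ↦ (Finset.mem_filter.1 hp).2) fun p hp hp' ↦ ?_
      have h6 : w p = 0 := by
        by_contra h
        exact hp' (Finset.mem_filter.2 ⟨hwS p ((mem_exactPrimes hn0).1 hp).1 h, hp⟩)
      simp only [hg]
      rw [h6]
      simp
    have h6 : ∀ p ∈ exactPrimes n, g x p (n / p) =
        F.coeff n * ((w p * sieveFlow w x (n / p) : ℝ) : ℂ) := by
      intro p hp
      obtain ⟨hp1, ⟨c, rfl⟩, hp3⟩ := (mem_exactPrimes hn0).1 hp
      have hc : ¬ p ∣ c := fun ⟨e, he⟩ ↦ hp3 ⟨e, by rw [he]; ring⟩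
      simp only [hg]
      rw [Nat.mul_div_cancel_left c hp1.pos,
        F.coeff_mul_of_coprime ((Nat.Prime.coprime_iff_not_dvd hp1).2 hc)]
      push_cast
      ring
    rw [h4, h5, Finset.sum_congr rfl h6, ← Finset.mul_sum]
    push_cast
    ring
  have hbound : ∀ x ∈ Set.Icc (0:ℝ) 1, ‖∑ n ∈ Finset.Icc 1 Z,
      (F.coeff n * ((-∑ p ∈ exactPrimes n, w p * sieveFlow w x (n / p) : ℝ) : ℂ)) • T n‖ ≤
        D₁ + D₂ + D₃ := by
    intro x hx
    have h4 : ∑ n ∈ Finset.Icc 1 Z,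
        (F.coeff n * ((-∑ p ∈ exactPrimes n, w p * sieveFlow w x (n / p) : ℝ) : ℂ)) • T n =
        ∑ n ∈ Finset.Icc 1 Z, (∑ p ∈ S with p ^ 2 ∣ n, g x p (n / p)) • T n -
          ∑ p ∈ S, ∑ m ∈ Finset.Icc 1 Z, g x p m • T (p * m) +
          ∑ p ∈ S, ∑ m ∈ Finset.Icc 1 Z with Z < p * m, g x p m • T (p * m) := by
      rw [sum_sum_mul_eq S hS Z (g x) T, Finset.sum_congr rfl fun n hn ↦ by rw [hexact x n hn]]
      simp_rw [sub_smul]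
      rw [Finset.sum_sub_distrib]
      abel
    rw [h4]
    have h5 := (norm_add_le _ _).trans (add_le_add ((norm_sub_le _ _).trans
      (add_le_add (h₂ x hx) (h₁ x hx))) (h₃ x hx))
    refine h5.trans (le_of_eq (by ring))
  have hmv := norm_image_sub_le_of_norm_deriv_le_segment_01' (f := u)
    (fun x _ ↦ (hderiv x).hasDerivWithinAt) (fun x hx ↦ hbound x ⟨hx.1, hx.2.le⟩)
  have hu0 : u 0 = ∑ n ∈ Finset.Icc 1 Z, F.coeff n • T n := by
    simp only [hu, sieveFlow_zero]
    simp
  rw [← hu0]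
  calc ‖u 0‖ = ‖u 1 - (u 1 - u 0)‖ := by rw [sub_sub_cancel]
    _ ≤ ‖u 1‖ + ‖u 1 - u 0‖ := norm_sub_le _ _
    _ ≤ _ := by gcongr

end LData

end BilinearRearrangement

/-! ### Mean squares of sieved coefficients, and truncation -/

theorem sum_inv_sq_le {S : Finset ℕ} {P : ℝ} (hP : 1 ≤ P) (hS : ∀ p ∈ S, P ≤ p) :
    ∑ p ∈ S, ((p : ℝ) ^ 2)⁻¹ ≤ 2 / P := by
  have h1 : 1 ≤ ⌈P⌉₊ := Nat.one_le_ceil_iff.2 (by linarith)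
  have hsub : S ⊆ Finset.Ioo (⌈P⌉₊ - 1) (S.sup id + 1) := fun p hp ↦ by
    have h2 : ⌈P⌉₊ ≤ p := Nat.ceil_le.2 (hS p hp)
    have h3 : p ≤ S.sup id := Finset.le_sup (f := id) hp
    rw [Finset.mem_Ioo]
    omega
  refine (Finset.sum_le_sum_of_subset_of_nonneg hsub fun _ _ _ ↦ by positivity).trans
    ((sum_Ioo_inv_sq_le _ _).trans ?_)
  have h2 : P ≤ ⌈P⌉₊ := Nat.le_ceil P
  have h3 : ((⌈P⌉₊ - 1 : ℕ) : ℝ) + 1 = ⌈P⌉₊ := by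
    rw [Nat.cast_sub h1]
    push_cast
    ring
  rw [h3]
  gcongr

theorem card_filter_prime_dvd_le {S : Finset ℕ} (hS : ∀ p ∈ S, p.Prime) {n : ℕ} (hn : n ≠ 0) :
    (S.filter fun p ↦ p ^ 2 ∣ n).card ≤ Nat.log 2 n := by
  have hsub : S.filter (fun p ↦ p ^ 2 ∣ n) ⊆ n.primeFactors := fun p hp ↦ by
    rw [Finset.mem_filter] at hp
    exact Nat.mem_primeFactors.2 ⟨hS p hp.1, (dvd_pow_self p two_ne_zero).trans hp.2, hn⟩
  refine (Finset.card_le_card hsub).trans (Nat.le_log_of_pow_le (by norm_num) ?_)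
  refine (Finset.pow_card_le_prod _ (fun p ↦ p) 2 fun p hp ↦
    (Nat.prime_of_mem_primeFactors hp).two_le).trans ?_
  exact Nat.le_of_dvd (Nat.pos_of_ne_zero hn) (Nat.prod_primeFactors_dvd n)

namespace LData

variable {d : ℕ} {F : LData d}

/-- The mean square of the coefficients weighted by the sieve weight at `x = 1`: an integer with nonzero
weight is either coprime to the primes of `[P₁, P₂]`, or divisible by the square of one of them. -/
theorem SieveBound.exists_secondMoment_sieveFlow_le (hA1 : F.RamanujanBound) (hA3 : F.SieveBound) :
    ∃ C : ℝ, 0 < C ∧ ∀ (P₁ P₂ : ℝ), 2 ≤ P₁ → P₁ ≤ P₂ → ∀ w : ℕ → ℝ,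
      (∀ p : ℕ, p.Prime → 0 ≤ w p ∧ w p ≤ 1) →
      (∀ p : ℕ, p.Prime → P₁ ≤ p → (p : ℝ) ≤ P₂ → w p = 1) → ∀ M : ℕ,
      ∑ n ∈ Finset.Icc 1 M, ‖F.coeff n * sieveFlow w 1 n‖ ^ 2 ≤
        C * (Real.log P₁ / Real.log P₂ + 1 / P₁) * M + C * P₂ := by
  classical
  obtain ⟨A, hA, hAM⟩ := hA3.exists_secondMoment_le
  obtain ⟨C₂, hC₂, hmult⟩ := exists_secondMoment_multiples_le hA1 hA3 2
  obtain ⟨K, hK⟩ := hA3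
  refine ⟨A + |K| + 2 * C₂, by positivity, fun P₁ P₂ hP₁ hP₁₂ w hw hw1 M ↦ ?_⟩
  have hlog₁ : 0 < Real.log P₁ := Real.log_pos (by linarith)
  have hP₂ : 0 < P₂ := by linarith
  have hlog₂ : 0 < Real.log P₂ := Real.log_pos (by linarith)
  have hflow : ∀ n, ‖F.coeff n * sieveFlow w 1 n‖ ^ 2 ≤ ‖F.coeff n‖ ^ 2 := by
    intro n
    rw [norm_mul, Complex.norm_real, Real.norm_eq_abs]
    exact pow_le_pow_left₀ (by positivity) (mul_le_of_le_one_right (norm_nonneg _)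
      (abs_sieveFlow_le hw ⟨zero_le_one, le_rfl⟩ n)) 2
  have hM0 : (0:ℝ) ≤ M := Nat.cast_nonneg M
  rcases lt_or_ge (M : ℝ) P₂ with hM | hM
  · calc _ ≤ ∑ n ∈ Finset.Icc 1 M, ‖F.coeff n‖ ^ 2 := Finset.sum_le_sum fun n _ ↦ hflow n
      _ ≤ A * M := hAM M
      _ ≤ A * P₂ := by gcongr
      _ ≤ (A + |K| + 2 * C₂) * P₂ := by
          have : 0 ≤ |K| := abs_nonneg K
          exact mul_le_mul_of_nonneg_right (by linarith) (by linarith)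
      _ ≤ _ := by
          have : 0 ≤ (A + |K| + 2 * C₂) * (Real.log P₁ / Real.log P₂ + 1 / P₁) * M := by positivity
          linarith
  set Q : Finset ℕ := (Finset.Icc ⌈P₁⌉₊ ⌊P₂⌋₊).filter Nat.Prime with hQ
  have hQmem : ∀ p ∈ Q, p.Prime ∧ P₁ ≤ p ∧ (p : ℝ) ≤ P₂ := by
    intro p hp
    rw [hQ, Finset.mem_filter, Finset.mem_Icc] at hp
    exact ⟨hp.2, Nat.ceil_le.1 hp.1.1, (Nat.le_floor_iff (by linarith)).1 hp.1.2⟩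
  -- If a prime of `Q` divides `n` exactly once, the sieve weight vanishes at `n`.
  have hpoint : ∀ n ∈ Finset.Icc 1 M, ‖F.coeff n * sieveFlow w 1 n‖ ^ 2 ≤
      (if n.Coprime (∏ p ∈ Q, p) then ‖F.coeff n‖ ^ 2 else 0) +
        ∑ p ∈ Q, if p ^ 2 ∣ n then ‖F.coeff n‖ ^ 2 else 0 := by
    intro n hn
    have hn0 : n ≠ 0 := Nat.one_le_iff_ne_zero.1 (Finset.mem_Icc.1 hn).1
    have hnn : 0 ≤ ∑ p ∈ Q, if p ^ 2 ∣ n then ‖F.coeff n‖ ^ 2 else 0 :=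
      Finset.sum_nonneg fun p _ ↦ by split_ifs <;> positivity
    by_cases hcop : n.Coprime (∏ p ∈ Q, p)
    · rw [if_pos hcop]
      linarith [hflow n]
    rw [if_neg hcop, zero_add]
    rw [Nat.coprime_prod_right_iff] at hcop
    push Not at hcop
    obtain ⟨p, hpQ, hpn⟩ := hcop
    obtain ⟨hp, hp1, hp2⟩ := hQmem p hpQ
    have hdvd : p ∣ n := by
      by_contra h
      exact hpn ((Nat.Prime.coprime_iff_not_dvd hp).2 h).symm
    by_cases hsq : p ^ 2 ∣ n
    · refine (hflow n).trans ?_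
      have h1 := Finset.single_le_sum (f := fun p ↦ if p ^ 2 ∣ n then ‖F.coeff n‖ ^ 2 else 0)
        (fun p _ ↦ by split_ifs <;> positivity) hpQ
      simpa only [if_pos hsq] using h1
    · have h1 : sieveFlow w 1 n = 0 :=
        Finset.prod_eq_zero ((mem_exactPrimes hn0).2 ⟨hp, hdvd, hsq⟩) (by
          rw [hw1 p hp hp1 hp2]
          ring)
      rw [h1]
      simpa using hnn
  have hcopr : ∑ n ∈ Finset.Icc 1 M with n.Coprime (∏ p ∈ Q, p), ‖F.coeff n‖ ^ 2 ≤
      |K| * (M * (Real.log P₁ / Real.log P₂)) := by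
    have h1 := hK M P₁ P₂ hP₁ hP₁₂ hM
    rw [Nat.floor_natCast] at h1
    refine h1.trans ?_
    gcongr
    exact le_abs_self K
  calc _ ≤ ∑ n ∈ Finset.Icc 1 M, ((if n.Coprime (∏ p ∈ Q, p) then ‖F.coeff n‖ ^ 2 else 0) +
        ∑ p ∈ Q, if p ^ 2 ∣ n then ‖F.coeff n‖ ^ 2 else 0) := Finset.sum_le_sum hpoint
    _ = ∑ n ∈ Finset.Icc 1 M with n.Coprime (∏ p ∈ Q, p), ‖F.coeff n‖ ^ 2 +
        ∑ p ∈ Q, ∑ n ∈ Finset.Icc 1 M with p ^ 2 ∣ n, ‖F.coeff n‖ ^ 2 := by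
        rw [Finset.sum_add_distrib, Finset.sum_comm]
        congr 1
        · exact (Finset.sum_filter _ _).symm
        · exact Finset.sum_congr rfl fun p _ ↦ (Finset.sum_filter _ _).symm
    _ ≤ |K| * (M * (Real.log P₁ / Real.log P₂)) + ∑ p ∈ Q, C₂ * (M / (p:ℝ) ^ 2) :=
        add_le_add hcopr (Finset.sum_le_sum fun p hp ↦ hmult p (hQmem p hp).1 M)
    _ = |K| * (M * (Real.log P₁ / Real.log P₂)) + C₂ * M * ∑ p ∈ Q, ((p:ℝ) ^ 2)⁻¹ := by
        rw [Finset.mul_sum]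
        congr 1
        refine Finset.sum_congr rfl fun p _ ↦ ?_
        rw [div_eq_mul_inv]
        ring
    _ ≤ |K| * (M * (Real.log P₁ / Real.log P₂)) + C₂ * M * (2 / P₁) := by
        gcongr
        exact sum_inv_sq_le (by linarith) fun p hp ↦ (hQmem p hp).2.1
    _ ≤ _ := by
        have hr : 0 ≤ M * (Real.log P₁ / Real.log P₂) := by positivity
        have hr' : 0 ≤ (M : ℝ) * (1 / P₁) := by positivity
        have h1 : 0 ≤ (A + 2 * C₂) * (M * (Real.log P₁ / Real.log P₂)) := by positivity
        have h2 : 0 ≤ (A + |K|) * ((M : ℝ) * (1 / P₁)) := by positivity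
        have h3 : 0 ≤ (A + |K| + 2 * C₂) * P₂ := by positivity
        have h4 : C₂ * M * (2 / P₁) = 2 * C₂ * (M * (1 / P₁)) := by ring
        rw [h4]
        linarith

/-- The mean square of the terms with a square factor. -/
theorem SieveBound.exists_secondMoment_square_le (hA1 : F.RamanujanBound) (hA3 : F.SieveBound) :
    ∃ C : ℝ, 0 < C ∧ ∀ (S : Finset ℕ) (P : ℝ), 1 ≤ P → (∀ p ∈ S, p.Prime ∧ P ≤ p) →
      ∀ (w : ℕ → ℝ) (f : ℕ → ℝ), (∀ p ∈ S, |w p| ≤ 1) → (∀ m, |f m| ≤ 1) → ∀ Z M : ℕ, M ≤ Z →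
      ∑ n ∈ Finset.Icc 1 M, ‖∑ p ∈ S with p ^ 2 ∣ n,
        ((w p : ℂ) * F.coeff p * (F.coeff (n / p) * f (n / p)))‖ ^ 2 ≤
        C * Nat.log 2 Z / P * M := by
  classical
  obtain ⟨C₁, hC₁, hmult⟩ := exists_secondMoment_multiples_le hA1 hA3 1
  refine ⟨2 * 4 ^ d * C₁, by positivity, fun S P hP hS w f hw hf Z M hMZ ↦ ?_⟩
  have hterm : ∀ n, ∀ p ∈ S, ‖(w p : ℂ) * F.coeff p * (F.coeff (n / p) * f (n / p))‖ ^ 2 ≤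
      4 ^ d * ‖F.coeff (n / p)‖ ^ 2 := by
    intro n p hp
    have h1 := hA1.norm_coeff_prime_le (hS p hp).1
    rw [norm_mul, norm_mul, norm_mul, Complex.norm_real, Complex.norm_real, Real.norm_eq_abs,
      Real.norm_eq_abs]
    calc _ ≤ (1 * 2 ^ d * (‖F.coeff (n / p)‖ * 1)) ^ 2 := by
          gcongr
          · exact hw p hp
          · exact hf _
      _ = _ := by
          have : (4:ℝ) = 2 ^ 2 := by norm_num
          rw [this, ← pow_mul, mul_comm 2 d, pow_mul]
          ring
  have hpoint : ∀ n ∈ Finset.Icc 1 M, ‖∑ p ∈ S with p ^ 2 ∣ n,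
      ((w p : ℂ) * F.coeff p * (F.coeff (n / p) * f (n / p)))‖ ^ 2 ≤
      Nat.log 2 Z * ∑ p ∈ S with p ^ 2 ∣ n, 4 ^ d * ‖F.coeff (n / p)‖ ^ 2 := by
    intro n hn
    rw [Finset.mem_Icc] at hn
    have hcard : (S.filter fun p ↦ p ^ 2 ∣ n).card ≤ Nat.log 2 Z :=
      (card_filter_prime_dvd_le (fun p hp ↦ (hS p hp).1) (by omega)).trans
        (Nat.log_mono_right (hn.2.trans hMZ))
    calc _ ≤ (∑ p ∈ S with p ^ 2 ∣ n,
          ‖(w p : ℂ) * F.coeff p * (F.coeff (n / p) * f (n / p))‖) ^ 2 := by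
          gcongr
          exact norm_sum_le _ _
      _ ≤ (S.filter fun p ↦ p ^ 2 ∣ n).card * ∑ p ∈ S with p ^ 2 ∣ n,
          ‖(w p : ℂ) * F.coeff p * (F.coeff (n / p) * f (n / p))‖ ^ 2 := sq_sum_le_card_mul_sum_sq
      _ ≤ _ := by
          gcongr with p hp
          exact hterm n p (Finset.mem_filter.1 hp).1
  have hdiv : ∀ p ∈ S, ∑ n ∈ Finset.Icc 1 M with p ^ 2 ∣ n, ‖F.coeff (n / p)‖ ^ 2 ≤
      C₁ * M * ((p:ℝ) ^ 2)⁻¹ := by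
    intro p hp
    have hpp := (hS p hp).1
    have hp0 : (0:ℝ) < p := by exact_mod_cast hpp.pos
    have h1 : ∑ n ∈ Finset.Icc 1 M with p ^ 2 ∣ n, ‖F.coeff (n / p)‖ ^ 2 =
        ∑ m ∈ Finset.Icc 1 (M / p) with p ^ 1 ∣ m, ‖F.coeff m‖ ^ 2 := by
      refine Finset.sum_nbij' (fun n ↦ n / p) (fun m ↦ p * m) ?_ ?_ ?_ ?_ ?_
      · intro n hn
        rw [Finset.mem_filter, Finset.mem_Icc] at hn ⊢
        obtain ⟨⟨h1, h2⟩, c, rfl⟩ := hn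
        have h3 : p ^ 2 * c / p = p * c := by
          rw [pow_two, mul_assoc, Nat.mul_div_cancel_left _ hpp.pos]
        have hc : c ≠ 0 := fun h ↦ by simp [h] at h1
        refine ⟨⟨?_, Nat.div_le_div_right h2⟩, ?_⟩
        · rw [h3]
          exact Nat.mul_pos hpp.pos (Nat.pos_of_ne_zero hc)
        · rw [h3, pow_one]
          exact dvd_mul_right _ _
      · intro m hm
        rw [Finset.mem_filter, Finset.mem_Icc] at hm ⊢
        refine ⟨⟨Nat.mul_pos hpp.pos hm.1.1, ?_⟩, ?_⟩
        · rw [mul_comm]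
          exact (Nat.le_div_iff_mul_le hpp.pos).1 hm.1.2
        · rw [pow_two]
          rw [pow_one] at hm
          exact mul_dvd_mul_left p hm.2
      · intro n hn
        exact Nat.mul_div_cancel' ((dvd_pow_self p two_ne_zero).trans (Finset.mem_filter.1 hn).2)
      · intro m _
        exact Nat.mul_div_cancel_left m hpp.pos
      · intro n _
        rfl
    rw [h1]
    refine (hmult p hpp (M / p)).trans ?_
    have h2 : ((M / p : ℕ) : ℝ) ≤ M / p := Nat.cast_div_le
    calc _ ≤ C₁ * ((M / p) / (p:ℝ) ^ 1) := by gcongr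
      _ = _ := by
        rw [pow_one]
        field_simp
  calc _ ≤ ∑ n ∈ Finset.Icc 1 M, (Nat.log 2 Z : ℝ) *
        ∑ p ∈ S with p ^ 2 ∣ n, 4 ^ d * ‖F.coeff (n / p)‖ ^ 2 := Finset.sum_le_sum hpoint
    _ = Nat.log 2 Z * 4 ^ d * ∑ p ∈ S, ∑ n ∈ Finset.Icc 1 M with p ^ 2 ∣ n,
        ‖F.coeff (n / p)‖ ^ 2 := by
        simp_rw [Finset.sum_filter, Finset.mul_sum]
        rw [Finset.sum_comm]
        refine Finset.sum_congr rfl fun p _ ↦ Finset.sum_congr rfl fun n _ ↦ ?_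
        split_ifs <;> ring
    _ ≤ Nat.log 2 Z * 4 ^ d * ∑ p ∈ S, C₁ * M * ((p:ℝ) ^ 2)⁻¹ := by
        gcongr with p hp
        exact hdiv p hp
    _ ≤ Nat.log 2 Z * 4 ^ d * (C₁ * M * (2 / P)) := by
        rw [← Finset.mul_sum]
        gcongr
        exact sum_inv_sq_le hP fun p hp ↦ (hS p hp).2
    _ = _ := by ring

variable {q : ℕ} {χ : DirichletCharacter ℂ q}

theorem norm_term_half_le {n : ℕ} (hn : 1 ≤ n) :
    ‖LSeries.term (F.twistedCoeff χ) (1 / 2) n‖ ≤ ‖F.coeff n‖ * (n : ℝ) ^ (-(1 / 2) : ℝ) := by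
  have h := norm_term_twistedCoeff_le (F := F) (χ := χ) (1 / 2) n
  have h0 : n ≠ 0 := by omega
  rw [LSeries.norm_term_eq (F.coeff), if_neg h0, Complex.ofReal_re] at h
  refine h.trans (le_of_eq ?_)
  rw [Real.rpow_neg (Nat.cast_nonneg n), div_eq_mul_inv]
  norm_num

/-- Truncation of the smoothed sum at `Z`. -/
theorem norm_tsum_mellinWeight_le (hF : F.Axioms) {K : ℂ → ℂ} {C N Y : ℝ}
    (hK : AdmissibleKernel K C) (hN : 0 < N) (hY : 0 < Y) (hNY : N ≤ Y ^ 2) {Z : ℕ} (hZ : 1 ≤ Z)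
    {I : ℂ} (hI : HasSum (fun n : ℕ ↦
      LSeries.term (F.twistedCoeff χ) (1 / 2) n * mellinWeight K N n) I) :
    ‖I‖ ≤ ‖∑ n ∈ Finset.Icc 1 Z, LSeries.term (F.twistedCoeff χ) (1 / 2) n * mellinWeight K N n‖ +
      2 * C * Y ^ 2 / Z * ∑' n, ‖LSeries.term F.coeff ((3 / 2 : ℝ) : ℂ) n‖ := by
  have hC := hK.pos
  have hZ0 : (0:ℝ) < Z := by exact_mod_cast hZ
  set f : ℕ → ℂ := fun n ↦ LSeries.term (F.twistedCoeff χ) (1 / 2) n * mellinWeight K N n with hf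
  have hsumm := (hF.summable ((3 / 2 : ℝ) : ℂ) (by rw [Complex.ofReal_re]; norm_num)).norm
  have hsub : HasSum (fun n ↦ f n - if n ∈ Finset.Icc 1 Z then f n else 0)
      (I - ∑ n ∈ Finset.Icc 1 Z, f n) := by
    refine hI.sub ?_
    have h : HasSum (fun n ↦ if n ∈ Finset.Icc 1 Z then f n else 0)
        (∑ n ∈ Finset.Icc 1 Z, if n ∈ Finset.Icc 1 Z then f n else 0) :=
      hasSum_sum_of_ne_finset_zero fun n hn ↦ if_neg hn
    rwa [Finset.sum_congr rfl fun n hn ↦ if_pos hn] at h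
  have hbd : ∀ n, ‖f n - if n ∈ Finset.Icc 1 Z then f n else 0‖ ≤
      2 * C * Y ^ 2 / Z * ‖LSeries.term F.coeff ((3 / 2 : ℝ) : ℂ) n‖ := by
    intro n
    split_ifs with h
    · rw [sub_self, norm_zero]
      positivity
    rw [sub_zero]
    rcases Nat.eq_zero_or_pos n with rfl | hn
    · simp [hf]
    have hnZ : (Z : ℝ) ≤ n := by
      rw [Finset.mem_Icc, not_and] at h
      exact_mod_cast (not_le.1 (h hn)).le
    have hn0 : (0:ℝ) < n := by exact_mod_cast hn
    simp only [hf]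
    rw [norm_mul, LSeries.norm_term_eq F.coeff, if_neg (by omega), Complex.ofReal_re]
    have h1 := norm_term_half_le (F := F) (χ := χ) hn
    have h2 := hK.norm_mellinWeight_le hN hY hNY hn (σ := 2) (by norm_num) le_rfl
    have h3 : (n : ℝ) ^ (-(1 / 2) : ℝ) * (n:ℝ)⁻¹ = ((n:ℝ) ^ (3 / 2 : ℝ))⁻¹ := by
      rw [← Real.rpow_neg_one, ← Real.rpow_add hn0, ← Real.rpow_neg hn0.le]
      norm_num
    calc _ ≤ ‖F.coeff n‖ * (n : ℝ) ^ (-(1 / 2) : ℝ) * (2 * C * (Y / n) ^ (2:ℝ)) := by gcongr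
      _ = 2 * C * Y ^ 2 * (n:ℝ)⁻¹ * (‖F.coeff n‖ * ((n : ℝ) ^ (-(1 / 2) : ℝ) * (n:ℝ)⁻¹)) := by
          rw [Real.rpow_two]
          field_simp
      _ ≤ 2 * C * Y ^ 2 * (Z:ℝ)⁻¹ * (‖F.coeff n‖ * ((n : ℝ) ^ (-(1 / 2) : ℝ) * (n:ℝ)⁻¹)) := by
          gcongr
      _ = _ := by
          rw [h3]
          ring
  have h := tsum_of_norm_bounded (hsumm.hasSum.mul_left _) hbd
  rw [hsub.tsum_eq] at h
  calc ‖I‖ = ‖∑ n ∈ Finset.Icc 1 Z, f n + (I - ∑ n ∈ Finset.Icc 1 Z, f n)‖ := by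
        rw [add_sub_cancel]
    _ ≤ _ := (norm_add_le _ _).trans (add_le_add_right h _)

/-- The bilinear terms beyond the end of the sum. -/
theorem norm_bilinear_tail_le [NeZero q] (hF : F.Axioms) (hA : F.RamanujanBound) {K : ℂ → ℂ}
    {C N Y : ℝ} (hK : AdmissibleKernel K C) (hN : 0 < N) (hY : 0 < Y) (hNY : N ≤ Y ^ 2)
    (𝓕 : Finset (DirichletCharacter ℂ q)) {S : Finset ℕ} (hS : ∀ p ∈ S, p.Prime) {w f : ℕ → ℝ}
    (hw : ∀ p ∈ S, |w p| ≤ 1) (hf : ∀ m, |f m| ≤ 1) {Z : ℕ} (hZ : 1 ≤ Z) :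
    ‖∑ p ∈ S, ∑ m ∈ Finset.Icc 1 Z with Z < p * m,
      ((w p : ℂ) * F.coeff p * (F.coeff m * f m)) • weightVec K N 𝓕 (p * m)‖ ≤
      2 ^ d * (2 * C * Y ^ 2 * Real.sqrt (1 + q)) / Z * S.card *
        ∑' n, ‖LSeries.term F.coeff ((3 / 2 : ℝ) : ℂ) n‖ := by
  have hC := hK.pos
  have hZ0 : (0:ℝ) < Z := by exact_mod_cast hZ
  have hsumm := (hF.summable ((3 / 2 : ℝ) : ℂ) (by rw [Complex.ofReal_re]; norm_num)).norm
  set τ := 2 * C * Y ^ 2 * Real.sqrt (1 + q) with hτ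
  have hτ0 : 0 ≤ τ := by positivity
  have hterm : ∀ p ∈ S, ∀ m ∈ (Finset.Icc 1 Z).filter fun m ↦ Z < p * m,
      ‖((w p : ℂ) * F.coeff p * (F.coeff m * f m)) • weightVec K N 𝓕 (p * m)‖ ≤
        2 ^ d * τ / Z * ‖LSeries.term F.coeff ((3 / 2 : ℝ) : ℂ) m‖ := by
    intro p hp m hm
    rw [Finset.mem_filter, Finset.mem_Icc] at hm
    have hm0 : (0:ℝ) < m := by exact_mod_cast hm.1.1
    have hp1 := (hS p hp).one_le
    have hpm : 1 ≤ p * m := Nat.mul_pos hp1 hm.1.1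
    have hpm0 : (0:ℝ) < (p * m : ℕ) := by exact_mod_cast hpm
    have hpmZ : (Z:ℝ) ≤ (p * m : ℕ) := by exact_mod_cast hm.2.le
    have hmpm : (m:ℝ) ≤ (p * m : ℕ) := by exact_mod_cast Nat.le_mul_of_pos_left m hp1
    have h1 := hK.norm_weightVec_le hN hY hNY 𝓕 hpm
    have h2 : ((p * m : ℕ) : ℝ) ^ (-(5 / 2) : ℝ) ≤ (Z:ℝ)⁻¹ * ((m:ℝ) ^ (3 / 2 : ℝ))⁻¹ := by
      have h3 : ((p * m : ℕ) : ℝ) ^ (-(5 / 2) : ℝ) =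
          ((p * m : ℕ) : ℝ)⁻¹ * (((p * m : ℕ) : ℝ) ^ (3 / 2 : ℝ))⁻¹ := by
        rw [← Real.rpow_neg_one, ← Real.rpow_neg hpm0.le, ← Real.rpow_add hpm0]
        norm_num
      rw [h3]
      gcongr
    rw [norm_smul, norm_mul, norm_mul, norm_mul, Complex.norm_real, Complex.norm_real,
      Real.norm_eq_abs, Real.norm_eq_abs, LSeries.norm_term_eq, if_neg (by omega),
      Complex.ofReal_re]
    calc _ ≤ 1 * 2 ^ d * (‖F.coeff m‖ * 1) * (τ * ((Z:ℝ)⁻¹ * ((m:ℝ) ^ (3 / 2 : ℝ))⁻¹)) := by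
          gcongr
          · exact hw p hp
          · exact hA.norm_coeff_prime_le (hS p hp)
          · exact hf m
          · exact h1.trans (by gcongr)
      _ = _ := by ring
  have hp : ∀ p ∈ S, ‖∑ m ∈ Finset.Icc 1 Z with Z < p * m,
      ((w p : ℂ) * F.coeff p * (F.coeff m * f m)) • weightVec K N 𝓕 (p * m)‖ ≤
      2 ^ d * τ / Z * ∑' n, ‖LSeries.term F.coeff ((3 / 2 : ℝ) : ℂ) n‖ := by
    intro p hp
    refine (norm_sum_le_of_le _ (hterm p hp)).trans ?_
    rw [← Finset.mul_sum]
    gcongr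
    exact hsumm.sum_le_tsum _ fun _ _ ↦ norm_nonneg _
  refine (norm_sum_le_of_le _ hp).trans (le_of_eq ?_)
  rw [Finset.sum_const, nsmul_eq_mul]
  ring

end LData

/-! ### Large moduli and the choice of the auxiliary primes -/

/-- The largeness of the modulus that the estimates below use; `β` is the exponent of the start
`exp (log^β q)` of the range of the auxiliary primes. -/
structure IsLarge (β : ℝ) (q : ℕ) : Prop where
  le_log : 40 ≤ Real.log q
  pow_le_exp : Real.log q ^ 90 ≤ Real.exp (Real.log q / 2)
  rpow_add_one_le : Real.log q ^ β + 1 ≤ Real.log q / 20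
  log_le_rpow : 2 * Real.log (Real.log q) ≤ Real.log q ^ β
  le_exp : Real.log q ≤ Real.exp (Real.log q / 20)

theorem eventually_isLarge {β : ℝ} (h0 : 0 < β) (h1 : β < 1) : ∀ᶠ q : ℕ in atTop, IsLarge β q := by
  have hlog : Tendsto (fun q : ℕ ↦ Real.log q) atTop atTop :=
    Real.tendsto_log_atTop.comp tendsto_natCast_atTop_atTop
  have e1 := hlog.eventually_ge_atTop 40
  have e2 : ∀ᶠ x : ℝ in atTop, x ^ 90 ≤ Real.exp (x / 2) := by
    have h := (tendsto_id.atTop_div_const (by norm_num : (0:ℝ) < 2)).eventually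
      (eventually_mul_pow_le_exp (2 ^ 100))
    filter_upwards [h, eventually_ge_atTop 1] with x hx hx1
    simp only [id] at hx
    calc x ^ 90 ≤ x ^ 100 := by gcongr; first | exact hx1 | norm_num
      _ = 2 ^ 100 * (x / 2) ^ 100 := by ring
      _ ≤ _ := hx
  have e3 : ∀ᶠ x : ℝ in atTop, x ^ β + 1 ≤ x / 20 := by
    filter_upwards [(tendsto_rpow_atTop (by linarith : 0 < 1 - β)).eventually_ge_atTop 40,
      eventually_ge_atTop 40] with x hx hx1
    have hx0 : 0 < x := by linarith
    have h : x ^ β * x ^ (1 - β) = x := by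
      rw [← Real.rpow_add hx0, add_sub_cancel, Real.rpow_one]
    nlinarith [Real.rpow_pos_of_pos hx0 β]
  have e4 : ∀ᶠ x : ℝ in atTop, 2 * Real.log x ≤ x ^ β := by
    have h := (isLittleO_log_rpow_atTop h0).bound (c := 1 / 2) (by norm_num)
    filter_upwards [h, eventually_ge_atTop 1] with x hx hx1
    rw [Real.norm_of_nonneg (Real.log_nonneg hx1), Real.norm_of_nonneg (by positivity)] at hx
    linarith
  have e5 : ∀ᶠ x : ℝ in atTop, x ≤ Real.exp (x / 20) := by
    have h := (tendsto_id.atTop_div_const (by norm_num : (0:ℝ) < 20)).eventually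
      (eventually_mul_pow_le_exp 20)
    filter_upwards [h, eventually_ge_atTop 20] with x hx hx1
    simp only [id] at hx
    have h2 : (1:ℝ) ≤ x / 20 := by linarith
    calc x = 20 * (x / 20) ^ 1 := by ring
      _ ≤ 20 * (x / 20) ^ 100 := by gcongr; first | exact h2 | norm_num
      _ ≤ _ := hx
  filter_upwards [e1, hlog.eventually e2, hlog.eventually e3, hlog.eventually e4,
    hlog.eventually e5] with q h1 h2 h3 h4 h5
  exact ⟨h1, h2, h3, h4, h5⟩

/-- The first window of the auxiliary primes; the window `v` consists of the primes `p` with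
`|log p - v| < 1`. -/
noncomputable def firstWindow (β : ℝ) (q : ℕ) : ℕ := ⌈Real.log q ^ β⌉₊

/-- The last window of the auxiliary primes, which therefore go up to about `q^{1/10}`. -/
noncomputable def lastWindow (q : ℕ) : ℕ := ⌊Real.log q / 10⌋₊

/-- A finite set that contains the primes of all windows. -/
noncomputable def windowPrimes (β : ℝ) (q : ℕ) : Finset ℕ :=
  open Classical in
  (Finset.range (q + 1)).filter fun p ↦ p.Prime ∧ Real.exp (firstWindow β q - 1) ≤ p

/-- The total weight of a prime in the windows. -/
noncomputable def windowWeight (β : ℝ) (q p : ℕ) : ℝ :=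
  windowSum (firstWindow β q) (lastWindow q) (Real.log p)

theorem windowWeight_mem {β : ℝ} {q p : ℕ} (hp : p.Prime) :
    0 ≤ windowWeight β q p ∧ windowWeight β q p ≤ 1 :=
  ⟨windowSum_nonneg _ _ _,
    windowSum_le_one _ _ (Real.log_nonneg (by exact_mod_cast hp.one_le))⟩

namespace IsLarge

variable {β : ℝ} {q : ℕ}

theorem pos (h : IsLarge β q) : 0 < q := Nat.pos_of_ne_zero fun h0 ↦ by
  have := h.le_log
  rw [h0, Nat.cast_zero, Real.log_zero] at this
  norm_num at this

theorem log_pos (h : IsLarge β q) : 0 < Real.log q := by linarith [h.le_log]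

theorem exp_log (h : IsLarge β q) : Real.exp (Real.log q) = q :=
  Real.exp_log (by exact_mod_cast h.pos)

theorem le_firstWindow (_h : IsLarge β q) : Real.log q ^ β ≤ firstWindow β q := Nat.le_ceil _

theorem one_le_firstWindow (h : IsLarge β q) : 1 ≤ firstWindow β q :=
  Nat.one_le_iff_ne_zero.2 (Nat.ceil_pos.2 (Real.rpow_pos_of_pos h.log_pos _)).ne'

theorem firstWindow_le (h : IsLarge β q) : (firstWindow β q : ℝ) ≤ Real.log q ^ β + 1 :=
  (Nat.ceil_lt_add_one (Real.rpow_pos_of_pos h.log_pos _).le).le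

theorem lastWindow_le (h : IsLarge β q) : (lastWindow q : ℝ) ≤ Real.log q / 10 :=
  Nat.floor_le (by linarith [h.log_pos])

theorem le_lastWindow (h : IsLarge β q) : Real.log q / 20 ≤ lastWindow q := by
  have h1 := Nat.lt_floor_add_one (Real.log q / 10)
  have h2 := h.le_log
  change Real.log q / 20 ≤ (⌊Real.log q / 10⌋₊ : ℝ)
  linarith

theorem firstWindow_le_lastWindow (h : IsLarge β q) : firstWindow β q ≤ lastWindow q := by
  have := h.firstWindow_le.trans (h.rpow_add_one_le.trans h.le_lastWindow)
  exact_mod_cast this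

theorem one_div_log_le (h : IsLarge β q) (hβ0 : 0 < β) (hβ1 : β < 1) :
    1 / Real.log q ≤ Real.log q ^ (β - 1) ∧ Real.log q ^ (β - 1) ≤ 1 := by
  have h1 : 1 ≤ Real.log q := by linarith [h.le_log]
  constructor
  · rw [one_div, ← Real.rpow_neg_one]
    exact Real.rpow_le_rpow_of_exponent_le h1 (by linarith)
  · exact Real.rpow_le_one_of_one_le_of_nonpos h1 (by linarith)

theorem firstWindow_div_le (h : IsLarge β q) (hβ0 : 0 < β) :
    (firstWindow β q : ℝ) / lastWindow q ≤ 40 * Real.log q ^ (β - 1) := by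
  have hx := h.log_pos
  have h1 : 1 ≤ Real.log q ^ β := Real.one_le_rpow (by linarith [h.le_log]) hβ0.le
  have h2 := h.firstWindow_le
  have h3 := h.le_lastWindow
  calc _ ≤ (2 * Real.log q ^ β) / (Real.log q / 20) := by
        gcongr
        linarith
    _ = _ := by
        rw [Real.rpow_sub hx, Real.rpow_one]
        field_simp
        norm_num

theorem exp_neg_firstWindow_le (h : IsLarge β q) :
    Real.exp (-firstWindow β q) ≤ 1 / Real.log q ^ 2 := by
  have hx := h.log_pos
  have h1 : Real.log q ^ 2 = Real.exp (2 * Real.log (Real.log q)) := by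
    rw [mul_comm, Real.exp_mul, Real.exp_log hx, Real.rpow_two]
  rw [h1, one_div, ← Real.exp_neg, Real.exp_le_exp]
  linarith [h.log_le_rpow, h.le_firstWindow]

theorem mem_windowPrimes {p : ℕ} (hp : p ∈ windowPrimes β q) :
    p.Prime ∧ Real.exp (firstWindow β q - 1) ≤ p := by
  classical
  rw [windowPrimes, Finset.mem_filter] at hp
  exact hp.2

theorem mem_windowPrimes_of_tri_ne_zero (h : IsLarge β q) {v p : ℕ} (hp : p.Prime)
    (hv : v ∈ Finset.Icc (firstWindow β q) (lastWindow q)) (ht : tri (Real.log p - v) ≠ 0) :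
    p ∈ windowPrimes β q := by
  classical
  rw [Finset.mem_Icc] at hv
  have hp0 : (0:ℝ) < p := by exact_mod_cast hp.pos
  have h1 : |Real.log p - v| < 1 := by
    by_contra! h
    exact ht (tri_eq_zero h)
  rw [abs_lt] at h1
  have h2 : (firstWindow β q : ℝ) ≤ v := by exact_mod_cast hv.1
  have h3 : (v : ℝ) ≤ lastWindow q := by exact_mod_cast hv.2
  have h4 := h.lastWindow_le
  have h5 := h.le_log
  rw [windowPrimes, Finset.mem_filter, Finset.mem_range]
  refine ⟨Nat.lt_succ_of_le ?_, hp, ?_⟩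
  · have h6 : (p : ℝ) ≤ q := by
      rw [← h.exp_log, ← Real.log_le_iff_le_exp hp0]
      linarith
    exact_mod_cast h6
  · rw [← Real.le_log_iff_exp_le hp0]
    linarith

theorem mem_windowPrimes_of_windowWeight_ne_zero (h : IsLarge β q) {p : ℕ} (hp : p.Prime)
    (hw : windowWeight β q p ≠ 0) : p ∈ windowPrimes β q := by
  rw [windowWeight, windowSum] at hw
  obtain ⟨v, hv, ht⟩ := Finset.exists_ne_zero_of_sum_ne_zero hw
  exact h.mem_windowPrimes_of_tri_ne_zero hp hv ht

theorem card_windowPrimes_le (h : IsLarge β q) : ((windowPrimes β q).card : ℝ) ≤ 2 * q := by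
  classical
  have h1 : (windowPrimes β q).card ≤ q + 1 := by
    refine (Finset.card_filter_le _ _).trans ?_
    rw [Finset.card_range]
  have h2 := h.pos
  exact_mod_cast (by omega : (windowPrimes β q).card ≤ 2 * q)

theorem windowWeight_eq_one {p : ℕ} (hp : p.Prime) (h1 : Real.exp (firstWindow β q) ≤ p)
    (h2 : (p : ℝ) ≤ Real.exp (lastWindow q)) : windowWeight β q p = 1 := by
  have hp0 : (0:ℝ) < p := by exact_mod_cast hp.pos
  exact windowSum_eq_one ((Real.le_log_iff_exp_le hp0).2 h1) ((Real.log_le_iff_le_exp hp0).2 h2)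

/-- The modulus `q` itself costs less than a power of `q` compared to the length of the sum. This is where
`d ≥ 3` is used. -/
theorem sqrt_mul_rpow_le (h : IsLarge β q) {d : ℕ} (hd : 3 ≤ d) {κ : ℝ} (hκ : 0 < κ) :
    Real.sqrt q * Real.exp (Real.log q / 20) * (κ * (q : ℝ) ^ ((d : ℝ) / 2)) ^ (1 / 10 : ℝ) ≤
      κ ^ (1 / 10 : ℝ) * ((q : ℝ) ^ ((d : ℝ) / 4) / Real.log q) := by
  have hq : (0:ℝ) < q := by exact_mod_cast h.pos
  have hx := h.log_pos
  have hd' : (3:ℝ) ≤ d := by exact_mod_cast hd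
  have hpow : ∀ r : ℝ, (q:ℝ) ^ r = Real.exp (Real.log q * r) := fun r ↦ Real.rpow_def_of_pos hq r
  rw [Real.mul_rpow hκ.le (by positivity), ← Real.rpow_mul hq.le, Real.sqrt_eq_rpow, hpow, hpow, hpow]
  have h1 : Real.exp (Real.log q * (1 / 2)) * Real.exp (Real.log q / 20) *
      Real.exp (Real.log q * ((d : ℝ) / 2 * (1 / 10))) * Real.log q ≤
        Real.exp (Real.log q * ((d : ℝ) / 4)) := by
    calc _ ≤ Real.exp (Real.log q * (1 / 2)) * Real.exp (Real.log q / 20) *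
          Real.exp (Real.log q * ((d : ℝ) / 2 * (1 / 10))) * Real.exp (Real.log q / 20) := by
          gcongr
          exact h.le_exp
      _ ≤ _ := by
          rw [← Real.exp_add, ← Real.exp_add, ← Real.exp_add, Real.exp_le_exp]
          nlinarith
  have h2 : Real.exp (Real.log q * (1 / 2)) * Real.exp (Real.log q / 20) *
      Real.exp (Real.log q * ((d : ℝ) / 2 * (1 / 10))) ≤
        Real.exp (Real.log q * ((d : ℝ) / 4)) / Real.log q := by
    rwa [le_div_iff₀ hx]
  calc _ = κ ^ (1 / 10 : ℝ) * (Real.exp (Real.log q * (1 / 2)) * Real.exp (Real.log q / 20) *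
      Real.exp (Real.log q * ((d : ℝ) / 2 * (1 / 10)))) := by ring
    _ ≤ _ := by gcongr

end IsLarge

/-- The length of the sums contributes `q^{d/4}` to the norm. -/
theorem sqrt_mul_rpow_half {κ : ℝ} (hκ : 0 < κ) (d q : ℕ) :
    Real.sqrt (κ * (q : ℝ) ^ ((d : ℝ) / 2)) = Real.sqrt κ * (q : ℝ) ^ ((d : ℝ) / 4) := by
  rw [Real.sqrt_mul hκ.le, Real.sqrt_eq_rpow ((q : ℝ) ^ _), ← Real.rpow_mul (Nat.cast_nonneg q)]
  congr 2
  ring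

theorem sqrt_rpow_sub_one {x : ℝ} (hx : 0 < x) (β : ℝ) :
    Real.sqrt (x ^ (β - 1)) = x ^ ((β - 1) / 2) := by
  rw [Real.sqrt_eq_rpow, ← Real.rpow_mul hx.le]
  congr 1
  ring

section Estimates

variable {d : ℕ} {F : LData d} {β κ : ℝ}

/-- A mean square of size `x^{β-1}` (with `x = log q`), up to `q^{1/10}`, saves `x^{(β-1)/2}`. -/
theorem exists_norm_sum_weightVec_isLarge_le (hd : 3 ≤ d) (hβ0 : 0 < β) (hβ1 : β < 1)
    {K : ℂ → ℂ} {C : ℝ} (hK : AdmissibleKernel K C) (hκ : 0 < κ) {A : ℝ} (hA : 0 < A) :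
    ∃ D : ℝ, 0 < D ∧ ∀ q : ℕ, IsLarge β q → ∀ (𝓕 : Finset (DirichletCharacter ℂ q)) (N : ℝ), 0 < N →
      N ≤ (κ * (q : ℝ) ^ ((d : ℝ) / 2)) ^ 2 → ∀ (b : ℕ → ℂ) (Z : ℕ),
      (∀ M : ℕ, M ≤ Z → ∑ n ∈ Finset.Icc 1 M, ‖b n‖ ^ 2 ≤
        A * Real.log q ^ (β - 1) * M + A * Real.exp (Real.log q / 10)) →
      ‖∑ n ∈ Finset.Icc 1 Z, b n • weightVec K N 𝓕 n‖ ≤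
        D * ((q : ℝ) ^ ((d : ℝ) / 4) * Real.log q ^ ((β - 1) / 2)) := by
  obtain ⟨D₀, hD₀, hdy⟩ := exists_norm_sum_weightVec_le hK
  refine ⟨D₀ * (Real.sqrt A * Real.sqrt κ + Real.sqrt (2 * A) * κ ^ (1 / 10 : ℝ)), by positivity,
    fun q h 𝓕 N hN hNY b Z hb ↦ ?_⟩
  have hq : (0:ℝ) < q := by exact_mod_cast h.pos
  have hx := h.log_pos
  have hY : 0 < κ * (q : ℝ) ^ ((d : ℝ) / 2) := by positivity
  have h1 := hdy q h.pos 𝓕 N _ hN hY hNY b Z (A * Real.log q ^ (β - 1))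
    (A * Real.exp (Real.log q / 10)) (by positivity) (by positivity) hb
  obtain ⟨h2, h3⟩ := h.one_div_log_le hβ0 hβ1
  set Δ := Real.log q ^ ((β - 1) / 2) with hΔ
  have hΔ2 : 1 / Real.log q ≤ Δ := by
    refine h2.trans (Real.rpow_le_rpow_of_exponent_le (by linarith [h.le_log]) (by linarith))
  have h4 : Real.sqrt (q * (A * Real.log q ^ (β - 1) + A * Real.exp (Real.log q / 10))) ≤
      Real.sqrt q * (Real.sqrt (2 * A) * Real.exp (Real.log q / 20)) := by
    rw [Real.sqrt_mul hq.le]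
    gcongr
    have h5 : Real.exp (Real.log q / 20) = Real.sqrt (Real.exp (Real.log q / 10)) := by
      rw [← Real.exp_half]
      congr 1
      ring
    rw [h5, ← Real.sqrt_mul (by positivity)]
    refine Real.sqrt_le_sqrt ?_
    have h6 : 1 ≤ Real.exp (Real.log q / 10) := Real.one_le_exp (by positivity)
    have h7 : A * Real.log q ^ (β - 1) ≤ A * Real.exp (Real.log q / 10) := by
      gcongr
      linarith
    linarith
  have h5 := h.sqrt_mul_rpow_le hd hκ
  refine h1.trans ?_
  rw [Real.sqrt_mul hA.le, sqrt_rpow_sub_one hx, sqrt_mul_rpow_half hκ]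
  have hq4 : 0 < (q : ℝ) ^ ((d : ℝ) / 4) := by positivity
  calc _ ≤ D₀ * (Real.sqrt A * Δ * (Real.sqrt κ * (q : ℝ) ^ ((d : ℝ) / 4)) +
        Real.sqrt q * (Real.sqrt (2 * A) * Real.exp (Real.log q / 20)) *
          (κ * (q : ℝ) ^ ((d : ℝ) / 2)) ^ (1 / 10 : ℝ)) := by gcongr
    _ = D₀ * (Real.sqrt A * Real.sqrt κ * ((q : ℝ) ^ ((d : ℝ) / 4) * Δ) + Real.sqrt (2 * A) *
        (Real.sqrt q * Real.exp (Real.log q / 20) *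
          (κ * (q : ℝ) ^ ((d : ℝ) / 2)) ^ (1 / 10 : ℝ))) := by ring
    _ ≤ D₀ * (Real.sqrt A * Real.sqrt κ * ((q : ℝ) ^ ((d : ℝ) / 4) * Δ) + Real.sqrt (2 * A) *
        (κ ^ (1 / 10 : ℝ) * ((q : ℝ) ^ ((d : ℝ) / 4) * Δ))) := by
        have h6 : (q : ℝ) ^ ((d : ℝ) / 4) / Real.log q ≤ (q : ℝ) ^ ((d : ℝ) / 4) * Δ := by
          rw [div_eq_mul_one_div]
          exact mul_le_mul_of_nonneg_left hΔ2 hq4.le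
        have h7 := h5.trans (mul_le_mul_of_nonneg_left h6 (by positivity))
        exact mul_le_mul_of_nonneg_left
          (add_le_add le_rfl (mul_le_mul_of_nonneg_left h7 (by positivity))) hD₀.le
    _ = _ := by ring

/-- The sum over the windows of the bilinear sums. -/
theorem LData.SieveBound.exists_norm_bilinear_isLarge_le (hA1 : F.RamanujanBound) (hA3 : F.SieveBound)
    (hd : 3 ≤ d) (hβ0 : 0 < β) (hβ1 : β < 1) {K : ℂ → ℂ} {C : ℝ} (hK : AdmissibleKernel K C)
    (hκ : 0 < κ) {C_W : ℝ} (hC_W : 0 < C_W) :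
    ∃ D : ℝ, 0 < D ∧ ∀ q : ℕ, IsLarge β q → ∀ (𝓕 : Finset (DirichletCharacter ℂ q)) (N : ℝ), 0 < N →
      N ≤ (κ * (q : ℝ) ^ ((d : ℝ) / 2)) ^ 2 →
      (∀ χ ∈ 𝓕, ∀ v ∈ Finset.Icc (firstWindow β q) (lastWindow q), ∀ s : ℂ,
        (s.re = 3 / 5 ∨ s.re = 5 / 2) → |s.im| ≤ Real.log q →
        ‖F.primeWindow χ (windowPrimes β q) v s‖ ≤
          C_W * Real.exp (v * (1 - s.re)) / Real.log q ^ 90) →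
      ∀ (f : ℕ → ℂ), (∀ m, ‖f m‖ ≤ 1) → ∀ Z : ℕ,
      ‖∑ p ∈ windowPrimes β q, ∑ m ∈ Finset.Icc 1 Z,
        ((windowWeight β q p : ℂ) * F.coeff p * (F.coeff m * f m)) • weightVec K N 𝓕 (p * m)‖ ≤
        D * ((q : ℝ) ^ ((d : ℝ) / 4) * Real.log q ^ ((β - 1) / 2)) := by
  obtain ⟨D₀, hD₀, hbil⟩ := hA3.exists_norm_bilinear_le hA1 hK hC_W
  refine ⟨D₀ * (Real.sqrt κ + κ ^ (1 / 10 : ℝ)), by positivity, fun q h 𝓕 N hN hNY hPW f hf Z ↦ ?_⟩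
  have hq : (0:ℝ) < q := by exact_mod_cast h.pos
  have hx := h.log_pos
  have hx1 : 1 ≤ Real.log q := by linarith [h.le_log]
  have hY : 0 < κ * (q : ℝ) ^ ((d : ℝ) / 2) := by positivity
  have hsplit : ∑ p ∈ windowPrimes β q, ∑ m ∈ Finset.Icc 1 Z,
        ((windowWeight β q p : ℂ) * F.coeff p * (F.coeff m * f m)) • weightVec K N 𝓕 (p * m) =
      ∑ v ∈ Finset.Icc (firstWindow β q) (lastWindow q), ∑ p ∈ windowPrimes β q,
        ∑ m ∈ Finset.Icc 1 Z,
        ((tri (Real.log p - v) : ℂ) * F.coeff p * (F.coeff m * f m)) • weightVec K N 𝓕 (p * m) := by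
    symm
    rw [Finset.sum_comm]
    refine Finset.sum_congr rfl fun p _ ↦ ?_
    rw [Finset.sum_comm]
    refine Finset.sum_congr rfl fun m _ ↦ ?_
    rw [windowWeight, windowSum, Complex.ofReal_sum, Finset.sum_mul, Finset.sum_mul, Finset.sum_smul]
  set Δ := Real.log q ^ ((β - 1) / 2) with hΔ
  have hΔ2 : 1 / Real.log q ≤ Δ :=
    (h.one_div_log_le hβ0 hβ1).1.trans (Real.rpow_le_rpow_of_exponent_le hx1 (by linarith))
  have hpiece : ∀ v ∈ Finset.Icc (firstWindow β q) (lastWindow q), ‖∑ p ∈ windowPrimes β q,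
      ∑ m ∈ Finset.Icc 1 Z,
      ((tri (Real.log p - v) : ℂ) * F.coeff p * (F.coeff m * f m)) • weightVec K N 𝓕 (p * m)‖ ≤
      D₀ / Real.log q ^ 90 * ((Real.sqrt κ + κ ^ (1 / 10 : ℝ)) * (q : ℝ) ^ ((d : ℝ) / 4)) := by
    intro v hv
    have h1 := hbil q h.pos hx1 h.pow_le_exp 𝓕 N _ hN hY hNY (windowPrimes β q) v
      (fun p hp ↦ (IsLarge.mem_windowPrimes hp).1) (fun χ hχ s ↦ hPW χ hχ v hv s) f hf Z
    refine h1.trans ?_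
    have hv1 : (v:ℝ) ≤ lastWindow q := by exact_mod_cast (Finset.mem_Icc.1 hv).2
    have h2 : Real.exp (2 / 5 * v) ≤ Real.exp (Real.log q / 20) :=
      Real.exp_le_exp.2 (by linarith [h.lastWindow_le])
    have h3 := h.sqrt_mul_rpow_le hd hκ
    have h4 : (q : ℝ) ^ ((d : ℝ) / 4) / Real.log q ≤ (q : ℝ) ^ ((d : ℝ) / 4) :=
      div_le_self (by positivity) hx1
    rw [sqrt_mul_rpow_half hκ]
    gcongr D₀ / Real.log q ^ 90 * ?_
    calc _ ≤ Real.sqrt κ * (q : ℝ) ^ ((d : ℝ) / 4) + Real.sqrt q * Real.exp (Real.log q / 20) *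
          (κ * (q : ℝ) ^ ((d : ℝ) / 2)) ^ (1 / 10 : ℝ) := by gcongr
      _ ≤ Real.sqrt κ * (q : ℝ) ^ ((d : ℝ) / 4) + κ ^ (1 / 10 : ℝ) * (q : ℝ) ^ ((d : ℝ) / 4) := by
          exact add_le_add le_rfl (h3.trans (mul_le_mul_of_nonneg_left h4 (by positivity)))
      _ = _ := by ring
  rw [hsplit]
  refine (norm_sum_le_of_le _ hpiece).trans ?_
  rw [Finset.sum_const, nsmul_eq_mul]
  have hcard : ((Finset.Icc (firstWindow β q) (lastWindow q)).card : ℝ) ≤ Real.log q := by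
    rw [Nat.card_Icc]
    have h1 := h.one_le_firstWindow
    have h2 : ((lastWindow q + 1 - firstWindow β q : ℕ) : ℝ) ≤ lastWindow q := by
      exact_mod_cast (by omega : lastWindow q + 1 - firstWindow β q ≤ lastWindow q)
    linarith [h.lastWindow_le]
  have h5 : Real.log q / Real.log q ^ 90 ≤ 1 / Real.log q := by
    rw [div_le_div_iff₀ (by positivity) hx, one_mul, ← pow_two]
    gcongr; first | exact hx1 | norm_num
  calc _ ≤ Real.log q * (D₀ / Real.log q ^ 90 *
        ((Real.sqrt κ + κ ^ (1 / 10 : ℝ)) * (q : ℝ) ^ ((d : ℝ) / 4))) := by gcongr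
    _ = D₀ * (Real.sqrt κ + κ ^ (1 / 10 : ℝ)) * ((q : ℝ) ^ ((d : ℝ) / 4) *
        (Real.log q / Real.log q ^ 90)) := by ring
    _ ≤ _ := by
        gcongr
        exact h5.trans hΔ2

end Estimates

/-! ### The long sum over the integers -/

/-- The size of the square root of the bound, for sums of length about `q ^ (d / 2)`. -/
noncomputable def savedSize (d : ℕ) (β : ℝ) (q : ℕ) : ℝ :=
  (q : ℝ) ^ ((d : ℝ) / 4) * Real.log q ^ ((β - 1) / 2)

theorem mul_rpow_half_sq (κ : ℝ) (d q : ℕ) :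
    (κ * (q : ℝ) ^ ((d : ℝ) / 2)) ^ 2 = κ ^ 2 * (q : ℝ) ^ d := by
  have h : ((q : ℝ) ^ ((d : ℝ) / 2)) ^ 2 = (q : ℝ) ^ d := by
    rw [← Real.rpow_natCast _ 2, ← Real.rpow_mul (Nat.cast_nonneg q), ← Real.rpow_natCast _ d]
    congr 1
    push_cast
    ring
  rw [mul_pow, h]

namespace IsLarge

variable {d : ℕ} {β : ℝ} {q : ℕ}

theorem log_le_self (h : IsLarge β q) : Real.log q ≤ q := by
  have := Real.log_le_sub_one_of_pos (show (0:ℝ) < q by exact_mod_cast h.pos)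
  linarith

theorem one_div_le_savedSize (h : IsLarge β q) (hβ0 : 0 < β) (hβ1 : β < 1) :
    1 / (q : ℝ) ≤ savedSize d β q ∧ 1 / (q : ℝ) ≤ savedSize d β q ^ 2 := by
  have hx := h.log_pos
  have hx1 : 1 ≤ Real.log q := by linarith [h.le_log]
  have hq1 : (1:ℝ) ≤ q := by exact_mod_cast h.pos
  have h1 : 1 / (q : ℝ) ≤ 1 / Real.log q := one_div_le_one_div_of_le hx h.log_le_self
  obtain ⟨h2, h3⟩ := h.one_div_log_le hβ0 hβ1
  have h4 : (1:ℝ) ≤ (q : ℝ) ^ ((d : ℝ) / 4) := Real.one_le_rpow hq1 (by positivity)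
  have h5 : (Real.log q ^ ((β - 1) / 2)) ^ 2 = Real.log q ^ (β - 1) := by
    rw [← Real.rpow_natCast, ← Real.rpow_mul hx.le]
    congr 1
    push_cast
    ring
  have h6 : Real.log q ^ (β - 1) ≤ Real.log q ^ ((β - 1) / 2) :=
    Real.rpow_le_rpow_of_exponent_le hx1 (by linarith)
  have h7 : 0 < Real.log q ^ (β - 1) := Real.rpow_pos_of_pos hx _
  constructor
  · calc _ ≤ 1 * Real.log q ^ ((β - 1) / 2) := by linarith
      _ ≤ _ := mul_le_mul_of_nonneg_right h4 (by linarith)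
  · rw [savedSize, mul_pow, h5]
    calc _ ≤ 1 * Real.log q ^ (β - 1) := by linarith
      _ ≤ _ := mul_le_mul_of_nonneg_right (one_le_pow₀ h4) h7.le

theorem savedSize_sq (h : IsLarge β q) :
    savedSize d β q ^ 2 = (q : ℝ) ^ ((d : ℝ) / 2) * Real.log q ^ (β - 1) := by
  rw [savedSize, mul_pow, ← Real.rpow_natCast, ← Real.rpow_natCast, ← Real.rpow_mul h.log_pos.le,
    ← Real.rpow_mul (Nat.cast_nonneg q)]
  congr 2 <;> push_cast <;> ring

/-- The gain from truncating at `q^{2d}`. -/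
theorem pow_div_pow_le (h : IsLarge β q) (hd : 3 ≤ d) :
    (q : ℝ) ^ d / (q ^ (2 * d) : ℕ) ≤ 1 / (q : ℝ) ^ 3 := by
  have hq1 : (1:ℝ) ≤ q := by exact_mod_cast h.pos
  have hq0 : (0:ℝ) < q := by linarith
  rw [Nat.cast_pow, div_le_div_iff₀ (by positivity) (by positivity), one_mul, ← pow_add]
  exact pow_le_pow_right₀ hq1 (by omega)

end IsLarge

namespace LData

variable {d : ℕ} {F : LData d} {β κ : ℝ}

/-- The sum over the integers that survive the sieve by the primes of the windows is small, since there are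
few of them. -/
theorem SieveBound.exists_norm_sieved_le (hA1 : F.RamanujanBound) (hA3 : F.SieveBound)
    (hd : 3 ≤ d) (hβ0 : 0 < β) (hβ1 : β < 1) {K : ℂ → ℂ} {C : ℝ} (hK : AdmissibleKernel K C)
    (hκ : 0 < κ) :
    ∃ D : ℝ, 0 < D ∧ ∀ q : ℕ, IsLarge β q → ∀ (𝓕 : Finset (DirichletCharacter ℂ q)) (N : ℝ), 0 < N →
      N ≤ (κ * (q : ℝ) ^ ((d : ℝ) / 2)) ^ 2 → ∀ Z : ℕ,
      ‖∑ n ∈ Finset.Icc 1 Z, (F.coeff n * sieveFlow (windowWeight β q) 1 n) • weightVec K N 𝓕 n‖ ≤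
        D * savedSize d β q := by
  obtain ⟨A, hA, hbd⟩ := hA3.exists_secondMoment_sieveFlow_le hA1
  obtain ⟨D, hD, hsum⟩ := exists_norm_sum_weightVec_isLarge_le hd hβ0 hβ1 hK hκ
    (show 0 < 41 * A by positivity)
  refine ⟨D, hD, fun q h 𝓕 N hN hNY Z ↦ hsum q h 𝓕 N hN hNY _ Z fun M _ ↦ ?_⟩
  have hx := h.log_pos
  have hx1 : 1 ≤ Real.log q := by linarith [h.le_log]
  have hv0 : (1:ℝ) ≤ firstWindow β q := by exact_mod_cast h.one_le_firstWindow
  have hv : (firstWindow β q : ℝ) ≤ lastWindow q := by exact_mod_cast h.firstWindow_le_lastWindow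
  have h1 := hbd (Real.exp (firstWindow β q)) (Real.exp (lastWindow q))
    (by linarith [Real.add_one_le_exp (firstWindow β q : ℝ)]) (Real.exp_le_exp.2 hv)
    (windowWeight β q) (fun p hp ↦ windowWeight_mem hp)
    (fun p hp h1 h2 ↦ IsLarge.windowWeight_eq_one hp h1 h2) M
  refine h1.trans ?_
  rw [Real.log_exp, Real.log_exp, one_div, ← Real.exp_neg]
  have h2 := h.firstWindow_div_le hβ0
  have h3 : Real.exp (-firstWindow β q) ≤ Real.log q ^ (β - 1) := by
    refine h.exp_neg_firstWindow_le.trans (le_trans ?_ (h.one_div_log_le hβ0 hβ1).1)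
    exact one_div_le_one_div_of_le hx (by nlinarith)
  have h4 : Real.exp (lastWindow q) ≤ Real.exp (Real.log q / 10) := Real.exp_le_exp.2 h.lastWindow_le
  have h5 := Real.exp_pos (Real.log q / 10)
  refine add_le_add (mul_le_mul_of_nonneg_right ?_ (Nat.cast_nonneg M)) ?_
  · rw [mul_comm 41, mul_assoc]
    exact mul_le_mul_of_nonneg_left (by linarith) hA.le
  · rw [mul_comm 41, mul_assoc]
    exact mul_le_mul_of_nonneg_left (by linarith) hA.le

/-- The integers divisible by the square of a prime of the windows contribute little. -/
theorem SieveBound.exists_norm_square_le (hA1 : F.RamanujanBound) (hA3 : F.SieveBound)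
    (hd : 3 ≤ d) (hβ0 : 0 < β) (hβ1 : β < 1) {K : ℂ → ℂ} {C : ℝ} (hK : AdmissibleKernel K C)
    (hκ : 0 < κ) :
    ∃ D : ℝ, 0 < D ∧ ∀ q : ℕ, IsLarge β q → ∀ (𝓕 : Finset (DirichletCharacter ℂ q)) (N : ℝ), 0 < N →
      N ≤ (κ * (q : ℝ) ^ ((d : ℝ) / 2)) ^ 2 → ∀ f : ℕ → ℝ, (∀ m, |f m| ≤ 1) →
      ‖∑ n ∈ Finset.Icc 1 (q ^ (2 * d)), (∑ p ∈ windowPrimes β q with p ^ 2 ∣ n,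
        ((windowWeight β q p : ℂ) * F.coeff p * (F.coeff (n / p) * f (n / p)))) •
          weightVec K N 𝓕 n‖ ≤ D * savedSize d β q := by
  obtain ⟨A, hA, hbd⟩ := hA3.exists_secondMoment_square_le hA1
  have hd0 : (0:ℝ) < d := by exact_mod_cast (by omega : 0 < d)
  obtain ⟨D, hD, hsum⟩ := exists_norm_sum_weightVec_isLarge_le hd hβ0 hβ1 hK hκ
    (show 0 < 12 * d * A by positivity)
  refine ⟨D, hD, fun q h 𝓕 N hN hNY f hf ↦ hsum q h 𝓕 N hN hNY _ _ fun M hM ↦ ?_⟩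
  have hx := h.log_pos
  have hx1 : 1 ≤ Real.log q := by linarith [h.le_log]
  have hv0 : (1:ℝ) ≤ firstWindow β q := by exact_mod_cast h.one_le_firstWindow
  have h1 := hbd (windowPrimes β q) (Real.exp (firstWindow β q - 1)) (Real.one_le_exp (by linarith))
    (fun p hp ↦ IsLarge.mem_windowPrimes hp) (windowWeight β q) f
    (fun p hp ↦ by
      have := windowWeight_mem (β := β) (q := q) (IsLarge.mem_windowPrimes hp).1
      rw [abs_of_nonneg this.1]
      exact this.2) hf (q ^ (2 * d)) M hM
  refine h1.trans ?_
  have hlog : (Nat.log 2 (q ^ (2 * d)) : ℝ) ≤ 4 * d * Real.log q := by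
    have h2 := Real.natLog_le_logb (q ^ (2 * d)) 2
    have h3 : (0.6931471803 : ℝ) < Real.log 2 := Real.log_two_gt_d9
    refine h2.trans ?_
    rw [Real.logb, Nat.cast_pow, Real.log_pow, div_le_iff₀ (by push_cast; linarith)]
    push_cast
    nlinarith [mul_pos hd0 hx]
  have hexp : 1 / Real.exp (firstWindow β q - 1) ≤ 3 * (1 / Real.log q ^ 2) := by
    rw [one_div, ← Real.exp_neg, neg_sub, sub_eq_add_neg, Real.exp_add]
    have h2 : Real.exp 1 ≤ 3 := by linarith [Real.exp_one_lt_d9]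
    exact mul_le_mul h2 h.exp_neg_firstWindow_le (Real.exp_pos _).le (by norm_num)
  have h6 : A * Nat.log 2 (q ^ (2 * d)) / Real.exp (firstWindow β q - 1) ≤
      12 * d * A * Real.log q ^ (β - 1) := by
    calc _ = A * (Nat.log 2 (q ^ (2 * d)) * (1 / Real.exp (firstWindow β q - 1))) := by ring
      _ ≤ A * (4 * d * Real.log q * (3 * (1 / Real.log q ^ 2))) :=
          mul_le_mul_of_nonneg_left (mul_le_mul hlog hexp (by positivity) (by positivity)) hA.le
      _ = 12 * d * A * (1 / Real.log q) := by
          field_simp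
          norm_num
      _ ≤ _ := mul_le_mul_of_nonneg_left (h.one_div_log_le hβ0 hβ1).1 (by positivity)
  have h7 : 0 ≤ 12 * d * A * Real.exp (Real.log q / 10) := by positivity
  exact (mul_le_mul_of_nonneg_right h6 (Nat.cast_nonneg M)).trans (le_add_of_nonneg_right h7)

/-- The terms beyond the length of the sum contribute little. -/
theorem Axioms.exists_norm_bilinear_tail_le (hF : F.Axioms) (hA1 : F.RamanujanBound)
    (hd : 3 ≤ d) (hβ0 : 0 < β) (hβ1 : β < 1) {K : ℂ → ℂ} {C : ℝ} (hK : AdmissibleKernel K C)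
    (hκ : 0 < κ) :
    ∃ D : ℝ, 0 ≤ D ∧ ∀ q : ℕ, IsLarge β q → ∀ (𝓕 : Finset (DirichletCharacter ℂ q)) (N : ℝ), 0 < N →
      N ≤ (κ * (q : ℝ) ^ ((d : ℝ) / 2)) ^ 2 → ∀ f : ℕ → ℝ, (∀ m, |f m| ≤ 1) →
      ‖∑ p ∈ windowPrimes β q, ∑ m ∈ Finset.Icc 1 (q ^ (2 * d)) with q ^ (2 * d) < p * m,
        ((windowWeight β q p : ℂ) * F.coeff p * (F.coeff m * f m)) • weightVec K N 𝓕 (p * m)‖ ≤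
          D * savedSize d β q := by
  have hC := hK.pos
  set L := ∑' n, ‖LSeries.term F.coeff ((3 / 2 : ℝ) : ℂ) n‖ with hL
  have hL0 : 0 ≤ L := tsum_nonneg fun n ↦ norm_nonneg _
  clear_value L
  refine ⟨8 * 2 ^ d * C * κ ^ 2 * L, by positivity, fun q h 𝓕 N hN hNY f hf ↦ ?_⟩
  have : NeZero q := ⟨h.pos.ne'⟩
  have hq1 : (1:ℝ) ≤ q := by exact_mod_cast h.pos
  have hq0 : (0:ℝ) < q := by linarith
  have hY : 0 < κ * (q : ℝ) ^ ((d : ℝ) / 2) := by positivity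
  have h1 := norm_bilinear_tail_le hF hA1 hK hN hY hNY 𝓕 (S := windowPrimes β q)
    (fun p hp ↦ (IsLarge.mem_windowPrimes hp).1) (w := windowWeight β q) (f := f)
    (fun p hp ↦ by
      have := windowWeight_mem (β := β) (q := q) (IsLarge.mem_windowPrimes hp).1
      rw [abs_of_nonneg this.1]
      exact this.2) hf (Z := q ^ (2 * d)) (Nat.one_le_pow _ _ h.pos)
  rw [← hL] at h1
  rw [mul_rpow_half_sq] at h1
  have hs : Real.sqrt (1 + q) ≤ 2 * q := Real.sqrt_le_iff.2 ⟨by positivity, by nlinarith⟩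
  have hS := h.card_windowPrimes_le
  refine h1.trans ?_
  calc _ = 2 * 2 ^ d * C * κ ^ 2 * L * (((q : ℝ) ^ d / (q ^ (2 * d) : ℕ)) *
        (Real.sqrt (1 + q) * (windowPrimes β q).card)) := by ring
    _ ≤ 2 * 2 ^ d * C * κ ^ 2 * L * ((1 / (q : ℝ) ^ 3) * ((2 * q) * (2 * q))) := by
        refine mul_le_mul_of_nonneg_left (mul_le_mul (h.pow_div_pow_le hd)
          (mul_le_mul hs hS (by positivity) (by positivity)) (by positivity) (by positivity))
          (by positivity)
    _ = 8 * 2 ^ d * C * κ ^ 2 * L * (1 / q) := by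
        field_simp
        ring
    _ ≤ _ := mul_le_mul_of_nonneg_left (h.one_div_le_savedSize hβ0 hβ1).1 (by positivity)

/-- The long sum of the approximate functional equation, as a vector over the characters: the derivative
along the sieve flow is a bilinear form in the primes of the windows, up to the squares and the tail. -/
theorem exists_norm_sum_coeff_le (hF : F.Axioms) (hA1 : F.RamanujanBound) (hA3 : F.SieveBound)
    (hd : 3 ≤ d) (hβ0 : 0 < β) (hβ1 : β < 1) {K : ℂ → ℂ} {C : ℝ} (hK : AdmissibleKernel K C)
    (hκ : 0 < κ) {C_W : ℝ} (hC_W : 0 < C_W) :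
    ∃ D : ℝ, 0 < D ∧ ∀ q : ℕ, IsLarge β q → ∀ (𝓕 : Finset (DirichletCharacter ℂ q)) (N : ℝ), 0 < N →
      N ≤ (κ * (q : ℝ) ^ ((d : ℝ) / 2)) ^ 2 →
      (∀ χ ∈ 𝓕, ∀ v ∈ Finset.Icc (firstWindow β q) (lastWindow q), ∀ s : ℂ,
        (s.re = 3 / 5 ∨ s.re = 5 / 2) → |s.im| ≤ Real.log q →
        ‖F.primeWindow χ (windowPrimes β q) v s‖ ≤
          C_W * Real.exp (v * (1 - s.re)) / Real.log q ^ 90) →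
      ‖∑ n ∈ Finset.Icc 1 (q ^ (2 * d)), F.coeff n • weightVec K N 𝓕 n‖ ≤ D * savedSize d β q := by
  obtain ⟨D₀, hD₀, h₀⟩ := hA3.exists_norm_sieved_le hA1 hd hβ0 hβ1 hK hκ
  obtain ⟨D₁, hD₁, h₁⟩ := hA3.exists_norm_bilinear_isLarge_le hA1 hd hβ0 hβ1 hK hκ hC_W
  obtain ⟨D₂, hD₂, h₂⟩ := hA3.exists_norm_square_le hA1 hd hβ0 hβ1 hK hκ
  obtain ⟨D₃, hD₃, h₃⟩ := hF.exists_norm_bilinear_tail_le hA1 hd hβ0 hβ1 hK hκ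
  refine ⟨D₀ + (D₁ + D₂ + D₃), by positivity, fun q h 𝓕 N hN hNY hPW ↦ ?_⟩
  have hflow : ∀ x ∈ Set.Icc (0:ℝ) 1, ∀ m, |sieveFlow (windowWeight β q) x m| ≤ 1 := fun x hx m ↦
    abs_sieveFlow_le (fun p hp ↦ windowWeight_mem hp) hx m
  have hmain := norm_sum_le_of_sieveFlow (F := F) (S := windowPrimes β q)
    (fun p hp ↦ (IsLarge.mem_windowPrimes hp).1) (w := windowWeight β q)
    (fun p hp hw ↦ h.mem_windowPrimes_of_windowWeight_ne_zero hp hw) (q ^ (2 * d))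
    (weightVec K N 𝓕)
    (fun x hx ↦ h₁ q h 𝓕 N hN hNY hPW (fun m ↦ (sieveFlow (windowWeight β q) x m : ℂ))
      (fun m ↦ by rw [Complex.norm_real]; exact hflow x hx m) _)
    (fun x hx ↦ h₂ q h 𝓕 N hN hNY _ (hflow x hx))
    (fun x hx ↦ h₃ q h 𝓕 N hN hNY _ (hflow x hx))
  refine hmain.trans ?_
  have h4 := h₀ q h 𝓕 N hN hNY (q ^ (2 * d))
  change _ ≤ _ at h4
  simp only [savedSize] at h4 ⊢
  linarith

end LData

/-! ### The second moment -/

namespace LData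

variable {d : ℕ} {F : LData d} {β κ : ℝ}

theorem weightVec_apply_eq {q : ℕ} (K : ℂ → ℂ) (N : ℝ) {𝓕 : Finset (DirichletCharacter ℂ q)} (χ : 𝓕)
    (Z : ℕ) : ∑ n ∈ Finset.Icc 1 Z, LSeries.term (F.twistedCoeff χ.1) (1 / 2) n * mellinWeight K N n =
      (∑ n ∈ Finset.Icc 1 Z, F.coeff n • weightVec K N 𝓕 n) χ := by
  rw [WithLp.ofLp_sum, Finset.sum_apply]
  refine Finset.sum_congr rfl fun n hn ↦ ?_
  have hn0 : n ≠ 0 := Nat.one_le_iff_ne_zero.1 (Finset.mem_Icc.1 hn).1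
  rw [LSeries.term_of_ne_zero hn0, twistedCoeff, div_eq_mul_inv, ← Complex.cpow_neg]
  simp only [weightVec, charVec, PiLp.smul_apply, smul_eq_mul]
  ring

/-- The second moment over the characters of a given parity, from the norm of the long sum of the
approximate functional equation. -/
theorem Axioms.exists_sum_norm_L_half_sq_le (hF : F.Axioms) (hd : 3 ≤ d) (hβ0 : 0 < β) (hβ1 : β < 1)
    (hκ : 0 < κ) (ε : ℂ) :
    ∃ (K : ℂ → ℂ) (C D : ℝ), AdmissibleKernel K C ∧ 0 ≤ D ∧ ∀ q : ℕ, IsLarge β q →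
      ∀ 𝓕 : Finset (DirichletCharacter ℂ q), (∀ χ ∈ 𝓕, χ.IsPrimitive) → (∀ χ ∈ 𝓕, χ (-1) = ε) →
      F.N q ≤ (κ * (q : ℝ) ^ ((d : ℝ) / 2)) ^ 2 →
      ∑ χ ∈ 𝓕, ‖F.L χ (1 / 2)‖ ^ 2 ≤
        2 * ‖∑ n ∈ Finset.Icc 1 (q ^ (2 * d)), F.coeff n • weightVec K (F.N q) 𝓕 n‖ ^ 2 +
          D * savedSize d β q ^ 2 := by
  obtain ⟨K, C, hC, hdiff, hnorm, hL⟩ := hF.exists_norm_L_half_le ε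
  have hK : AdmissibleKernel K C := ⟨hC, hdiff, hnorm⟩
  set A₀ := ∑' n, ‖LSeries.term F.coeff ((3 / 2 : ℝ) : ℂ) n‖ with hA₀
  have hA₀0 : 0 ≤ A₀ := tsum_nonneg fun n ↦ norm_nonneg _
  clear_value A₀
  refine ⟨K, C, 4 * (2 * C * κ ^ 2 * A₀) ^ 2, hK, by positivity, fun q h 𝓕 hprim hpar hN ↦ ?_⟩
  have : NeZero q := ⟨h.pos.ne'⟩
  have hq1 : (1:ℝ) ≤ q := by exact_mod_cast h.pos
  have hq0 : (0:ℝ) < q := by linarith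
  have hq2 : 2 ≤ q := by
    have h1 := h.log_le_self
    have h2 := h.le_log
    exact_mod_cast (by linarith : (2:ℝ) ≤ q)
  have hNpos := hF.conductor_pos q hq2
  have hY : 0 < κ * (q : ℝ) ^ ((d : ℝ) / 2) := by positivity
  set u := ∑ n ∈ Finset.Icc 1 (q ^ (2 * d)), F.coeff n • weightVec K (F.N q) 𝓕 n with hu
  set δ := 2 * C * κ ^ 2 * A₀ * (1 / q) with hδ
  have hone : ∀ χ : 𝓕, ‖F.L χ.1 (1 / 2)‖ ^ 2 ≤ 2 * ‖u χ‖ ^ 2 + 2 * δ ^ 2 := by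
    intro χ
    have hχ := hprim χ.1 χ.2
    have hsum := hK.integral_mul_LSeries hNpos (a := F.twistedCoeff χ.1)
      (hF.summable_twist q χ.1 hq2 hχ _ (by rw [Complex.ofReal_re]; norm_num))
    have h1 := norm_tsum_mellinWeight_le hF hK hNpos hY hN (Nat.one_le_pow (2 * d) q h.pos) hsum
    rw [← hA₀, mul_rpow_half_sq, weightVec_apply_eq K (F.N q) χ] at h1
    have h2 : 2 * C * (κ ^ 2 * (q : ℝ) ^ d) / (q ^ (2 * d) : ℕ) * A₀ ≤ δ := by
      have h3 : 1 / (q : ℝ) ^ 3 ≤ 1 / q :=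
        one_div_le_one_div_of_le hq0 (le_self_pow₀ hq1 (by norm_num))
      calc _ = 2 * C * κ ^ 2 * A₀ * ((q : ℝ) ^ d / (q ^ (2 * d) : ℕ)) := by ring
        _ ≤ _ := mul_le_mul_of_nonneg_left ((h.pow_div_pow_le hd).trans h3) (by positivity)
    have h4 : ‖F.L χ.1 (1 / 2)‖ ≤ ‖u χ‖ + δ := by
      linarith [hL q χ.1 hq2 hχ (hpar χ.1 χ.2)]
    have h5 := pow_le_pow_left₀ (norm_nonneg _) h4 2
    linarith [add_sq_le (a := ‖u χ‖) (b := δ)]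
  rw [← Finset.sum_coe_sort]
  refine (Finset.sum_le_sum fun χ _ ↦ hone χ).trans ?_
  rw [Finset.sum_add_distrib, ← Finset.mul_sum, ← EuclideanSpace.norm_sq_eq, Finset.sum_const,
    nsmul_eq_mul, Finset.card_univ, Fintype.card_coe]
  have hcard : (𝓕.card : ℝ) ≤ 2 * q := by linarith [card_le_of_characters 𝓕]
  refine add_le_add le_rfl ?_
  calc (𝓕.card : ℝ) * (2 * δ ^ 2) ≤ 2 * q * (2 * δ ^ 2) :=
        mul_le_mul_of_nonneg_right hcard (by positivity)
    _ = 4 * (2 * C * κ ^ 2 * A₀) ^ 2 * (1 / q) := by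
        rw [hδ]
        field_simp
        ring
    _ ≤ _ := mul_le_mul_of_nonneg_left (h.one_div_le_savedSize hβ0 hβ1).2 (by positivity)

/-- The theorem for the characters of a given parity and for large `q`; the zero free region is only
needed at the height `T = K₁ log^100 q`. -/
theorem exists_secondMoment_parity_le (hF : F.Axioms) (hA1 : F.RamanujanBound) (hA3 : F.SieveBound)
    (hd : 3 ≤ d) {c β β' K₁ : ℝ} (hc : 0 < c) (hβ0 : 0 ≤ β) (hβ : β < β') (hβ1 : β' < 1)
    (hK₁ : 0 < K₁) (ε : ℂ) :
    ∃ D : ℝ, 0 ≤ D ∧ ∀ᶠ q : ℕ in atTop, ∀ 𝓕 : Finset (DirichletCharacter ℂ q),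
      (∀ χ ∈ 𝓕, χ.IsPrimitive) → (∀ χ ∈ 𝓕, χ (-1) = ε) →
      F.ZeroFreeRegion 𝓕 c β (K₁ * Real.log q ^ 100) →
      ∑ χ ∈ 𝓕, ‖F.L χ (1 / 2)‖ ^ 2 ≤
        D * ((q : ℝ) ^ ((d : ℝ) / 2) * Real.log q ^ (β' - 1)) := by
  have hβ'0 : 0 < β' := hβ0.trans_lt hβ
  obtain ⟨M, hM1, hM⟩ := hF.exists_conductor_le
  have hκ : 0 < Real.sqrt M := Real.sqrt_pos.2 (by linarith)
  obtain ⟨K, C, D₁, hK, hD₁, hmom⟩ := hF.exists_sum_norm_L_half_sq_le hd hβ'0 hβ1 hκ ε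
  obtain ⟨C_W, hC_W, hPW⟩ := hF.exists_norm_primeWindow_le hA1 ε hc hβ0 hβ hβ1 hK₁
  obtain ⟨D₂, hD₂, hvec⟩ := exists_norm_sum_coeff_le hF hA1 hA3 hd hβ'0 hβ1 hK hκ hC_W
  refine ⟨2 * D₂ ^ 2 + D₁, by positivity, ?_⟩
  filter_upwards [hM, hPW, eventually_isLarge hβ'0 hβ1] with q hMq hPWq h 𝓕 hprim hpar hzero
  rcases 𝓕.eq_empty_or_nonempty with rfl | ⟨χ₀, hχ₀⟩
  · have := h.log_pos
    rw [Finset.sum_empty]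
    positivity
  have hq2 : 2 ≤ q := by
    have h1 := h.log_le_self
    have h2 := h.le_log
    exact_mod_cast (by linarith : (2:ℝ) ≤ q)
  have hN : F.N q ≤ (Real.sqrt M * (q : ℝ) ^ ((d : ℝ) / 2)) ^ 2 := by
    rw [mul_rpow_half_sq, Real.sq_sqrt (by linarith)]
    exact hMq χ₀ (hprim χ₀ hχ₀)
  have hwin : ∀ χ ∈ 𝓕, ∀ v ∈ Finset.Icc (firstWindow β' q) (lastWindow q), ∀ s : ℂ,
      (s.re = 3 / 5 ∨ s.re = 5 / 2) → |s.im| ≤ Real.log q →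
      ‖F.primeWindow χ (windowPrimes β' q) v s‖ ≤
        C_W * Real.exp (v * (1 - s.re)) / Real.log q ^ 90 := by
    intro χ hχ v hv
    have hv' := Finset.mem_Icc.1 hv
    have h1 : (firstWindow β' q : ℝ) ≤ v := by exact_mod_cast hv'.1
    have h2 : (v : ℝ) ≤ lastWindow q := by exact_mod_cast hv'.2
    refine hPWq χ (hprim χ hχ) (hpar χ hχ)
      (fun σ t hσ ht ↦ Finset.prod_ne_zero_iff.1 (hzero σ t hσ ht) χ hχ) _ _
      (fun p hp ↦ (IsLarge.mem_windowPrimes hp).1)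
      (fun p hp ht ↦ h.mem_windowPrimes_of_tri_ne_zero hp hv ht) (h.le_firstWindow.trans h1) ?_
    linarith [h.lastWindow_le, h.log_pos]
  have h3 := hvec q h 𝓕 (F.N q) (hF.conductor_pos q hq2) hN hwin
  rw [← h.savedSize_sq]
  calc _ ≤ _ := hmom q h 𝓕 hprim hpar hN
    _ ≤ 2 * (D₂ * savedSize d β' q) ^ 2 + D₁ * savedSize d β' q ^ 2 := by gcongr
    _ = _ := by ring

end LData

theorem mainTheorem2 {d : ℕ} (hd : 3 ≤ d) (F : LData d) (hF : F.Axioms)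
    (hA1 : F.RamanujanBound) (hA2 : F.ShortIntervalBound) (hA3 : F.SieveBound)
    (c β : ℝ) (hc : 0 < c) (hβ0 : 0 ≤ β) (hβ1 : β < 1)
    -- The range `log^100 q ≪ T ≪ q^{o(1)}` of the zero free region is
    -- `K₁ log^100 q ≤ T ≤ K₂ q^(ψ q)`, where `ψ → 0`, nonempty for large `q`.
    (K₁ K₂ : ℝ) (hK₁ : 0 < K₁) (hK₂ : 0 < K₂) (ψ : ℕ → ℝ) (hψ : Tendsto ψ atTop (𝓝 0))
    (hrange : ∀ᶠ q : ℕ in atTop, K₁ * Real.log q ^ 100 ≤ K₂ * (q : ℝ) ^ ψ q)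
    (η : ℝ) (hη : η < 1 - β) :
    ∃ C : ℝ, ∀ q : ℕ, 2 ≤ q →
      ∀ 𝓕 : Finset (DirichletCharacter ℂ q), (∀ χ ∈ 𝓕, χ.IsPrimitive) →
        F.ZeroFreeRegions 𝓕 c β K₁ K₂ (ψ q) →
        ∑ χ ∈ 𝓕, ‖F.L χ (1 / 2)‖ ^ 2 ≤ C * ((q : ℝ) ^ ((d : ℝ) / 2) / Real.log q ^ η) := by
  classical
  obtain ⟨β', hβ, hβ'⟩ : ∃ β', β < β' ∧ β' < min 1 (1 - η) :=
    exists_between (lt_min hβ1 (by linarith))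
  rw [lt_min_iff] at hβ'
  obtain ⟨D₁, hD₁, h₁⟩ := LData.exists_secondMoment_parity_le hF hA1 hA3 hd hc hβ0 hβ hβ'.1 hK₁ 1
  obtain ⟨D₂, hD₂, h₂⟩ := LData.exists_secondMoment_parity_le hF hA1 hA3 hd hc hβ0 hβ hβ'.1 hK₁ (-1)
  have hlog : Tendsto (fun q : ℕ ↦ Real.log q) atTop atTop :=
    Real.tendsto_log_atTop.comp tendsto_natCast_atTop_atTop
  have e1 := hlog.eventually (eventually_mul_le_mul_pow 1 hK₁)
  obtain ⟨q₀, hq₀⟩ := eventually_atTop.1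
    (h₁.and (h₂.and (hrange.and (e1.and (hlog.eventually_ge_atTop 1)))))
  -- For bounded `q` there are only finitely many characters, and any bound will do.
  have hsmall : ∀ q : ℕ, ∃ M : ℝ, 0 ≤ M ∧ (2 ≤ q → ∀ 𝓕 : Finset (DirichletCharacter ℂ q),
      ∑ χ ∈ 𝓕, ‖F.L χ (1 / 2)‖ ^ 2 ≤ M * ((q : ℝ) ^ ((d : ℝ) / 2) / Real.log q ^ η)) := by
    intro q
    rcases lt_or_ge q 2 with hq | hq
    · exact ⟨0, le_rfl, fun h ↦ by omega⟩
    have : NeZero q := ⟨by omega⟩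
    have : Fintype (DirichletCharacter ℂ q) := Fintype.ofFinite _
    have hq0 : (0:ℝ) < q := by exact_mod_cast (by omega : 0 < q)
    have hx : 0 < Real.log q := Real.log_pos (by exact_mod_cast (by omega : 1 < q))
    have hpos : 0 < (q : ℝ) ^ ((d : ℝ) / 2) / Real.log q ^ η := by positivity
    refine ⟨(∑ χ : DirichletCharacter ℂ q, ‖F.L χ (1 / 2)‖ ^ 2) /
      ((q : ℝ) ^ ((d : ℝ) / 2) / Real.log q ^ η), by positivity, fun _ 𝓕 ↦ ?_⟩
    rw [div_mul_cancel₀ _ hpos.ne']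
    exact Finset.sum_le_sum_of_subset_of_nonneg (Finset.subset_univ _) fun _ _ _ ↦ by positivity
  choose M hM0 hM using hsmall
  refine ⟨D₁ + D₂ + ∑ q ∈ Finset.range q₀, M q, fun q hq 𝓕 hprim hzero ↦ ?_⟩
  have hx : 0 < Real.log q := Real.log_pos (by exact_mod_cast (by omega : 1 < q))
  have hpos : 0 < (q : ℝ) ^ ((d : ℝ) / 2) / Real.log q ^ η := by positivity
  have hMsum : 0 ≤ ∑ q ∈ Finset.range q₀, M q := Finset.sum_nonneg fun q _ ↦ hM0 q
  rcases lt_or_ge q q₀ with hlt | hge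
  · refine (hM q hq 𝓕).trans (mul_le_mul_of_nonneg_right ?_ hpos.le)
    have := Finset.single_le_sum (fun q _ ↦ hM0 q) (Finset.mem_range.2 hlt)
    linarith
  obtain ⟨h₁q, h₂q, hr, hT, hx1⟩ := hq₀ q hge
  have hzero' : F.ZeroFreeRegion 𝓕 c β (K₁ * Real.log q ^ 100) := hzero _ (by linarith) le_rfl hr
  have hsub : ∀ 𝓖 ⊆ 𝓕, F.ZeroFreeRegion 𝓖 c β (K₁ * Real.log q ^ 100) := fun 𝓖 h𝓖 σ t hσ ht ↦
    Finset.prod_ne_zero_iff.2 fun χ hχ ↦ Finset.prod_ne_zero_iff.1 (hzero' σ t hσ ht) χ (h𝓖 hχ)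
  have hW : (q : ℝ) ^ ((d : ℝ) / 2) * Real.log q ^ (β' - 1) ≤
      (q : ℝ) ^ ((d : ℝ) / 2) / Real.log q ^ η := by
    rw [div_eq_mul_inv _ (_ ^ η), ← Real.rpow_neg hx.le]
    exact mul_le_mul_of_nonneg_left (Real.rpow_le_rpow_of_exponent_le hx1 (by linarith))
      (by positivity)
  rw [← Finset.sum_filter_add_sum_filter_not 𝓕 fun χ ↦ χ (-1) = 1]
  have b₁ := h₁q (𝓕.filter fun χ ↦ χ (-1) = 1) (fun χ hχ ↦ hprim χ (Finset.mem_filter.1 hχ).1)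
    (fun χ hχ ↦ (Finset.mem_filter.1 hχ).2) (hsub _ (Finset.filter_subset _ _))
  have b₂ := h₂q (𝓕.filter fun χ ↦ ¬ χ (-1) = 1) (fun χ hχ ↦ hprim χ (Finset.mem_filter.1 hχ).1)
    (fun χ hχ ↦ χ.even_or_odd.resolve_left (Finset.mem_filter.1 hχ).2)
    (hsub _ (Finset.filter_subset _ _))
  have c₁ := mul_le_mul_of_nonneg_left hW hD₁
  have c₂ := mul_le_mul_of_nonneg_left hW hD₂
  have c₃ := mul_nonneg hMsum hpos.le
  linarith
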